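/- Let $N\ge 1$, $g,h_0>0$, let $a_1,\dots,a_N>0$ be pairwise distinct and $s_1,\dots,s_N\in\mathbb R$. Put $a=\max_i a_i$, $$\beta_i=\sqrt{\tfrac{3a_i}{4h_0^3}},\quad c_i=\sqrt{gh_0}\Big(1+\tfrac{a_i}{2h_0}\Big),\quad \alpha(i,j)=\Big(\tfrac{\sqrt{a_i}-\sqrt{a_j}}{\sqrt{a_i}+\sqrt{a_j}}\Big)^2,\quad f_i(z,t)=e^{-2\beta_i(z-s_i-c_it)},$$ $$F(z,t)=\sum_{S\subseteq\{1,\dots,N\}}\ \prod_{i<j,\ i,j\in S}\alpha(i,j)\ \prod_{i\in S}f_i(z,t),\qquad \eta=\tfrac{4h_0^3}{3}(\ln F)_{xx}$$ (the $N$-soliton solution of KdV, continued analytically to complex arguments), and let $$u(x,y,t)=\tfrac12\sqrt{\tfrac g{h_0}}\big(\eta(x+iy,t)+\eta(x-iy,t)\big),\qquad v(x,y,t)=\tfrac i2\sqrt{\tfrac g{h_0}}\big(\eta(x+iy,t)-\eta(x-iy,t)\big).$$ A trajectory is a pair $X,Y:\mathbb R\to\mathbb R$ with $X'=u(X,Y,t)$,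 $Y'=v(X,Y,t)$ for all $t$. For $R>0$ it avoids interactions at distance $R$ if at no time $t$ there are two different indices $i\neq j$ with $|\beta_i(X(t)-s_i-c_it)|\le R$ and $|\beta_j(X(t)-s_j-c_jt)|\le R$. There is $\varepsilon_0>0$, depending only on $N$, such that $a_i/h_0\le\varepsilon_0$ for all $i$ implies the smallness condition $$(h_0+a)\sum_{i=1}^N\beta_i\le\frac\pi4, \tag{$*$}$$ and such that the following holds. Under $(*)$: (a) $v(x,0,t)=0$ and $u(x,0,t)>0$ for all $x,t$, and a trajectory with $Y(t_0)=0$ for some $t_0$ has $Y(t)=0$ and $X'(t)>0$ for all $t$; (b) $\eta(x,t)\le a$ for all real $x,t$, and $u(x,y,t)>0$ whenever $0\le y\le h_0+\eta(x,t)$. Moreover, under $(*)$, for every $\delta>0$ there is $R>0$, depending only on $\delta,N,g,h_0$ and the $a_i$ (not on the $s_i$ or the trajectory), such that for every trajectory that avoids interactions at distance $R$ and satisfies $0<Y(t)\le\pi/(4\sum_i\beta_i)$ for all $t$ (by $(*)$ and (b), this upper bound holds for particles that stay below the surface), there are times $t_1<\dots<t_{2N-1}$ and a permutation $\sigma$ of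 $\{1,\dots,N\}$ with: (c) $v(X(t),Y(t),t)>0$ for $t\in(-\infty,t_1)\cup\bigcup_{k=1}^{N-1}(t_{2k},t_{2k+1})$, and $v(X(t),Y(t),t)<0$ for $t\in\bigcup_{k=1}^{N-1}(t_{2k-1},t_{2k})\cup(t_{2N-1},\infty)$; (d) for $1\le k\le N$ and $T=t_{2k-1}$, with $i=\sigma(k)$: the solitons $\sigma(j)$, $j<k$, have passed the particle and the solitons $\sigma(j)$, $j>k$, have not yet reached it, i.e. $\beta_{\sigma(j)}(X(T)-s_{\sigma(j)}-c_{\sigma(j)}T)$ is $<-R$ for $j<k$ and $>R$ for $j>k$, and the particle is at the phase-shifted crest of soliton $i$ up to $\delta$: $$\Big|X(T)-s_i-c_iT-\frac1{2\beta_i}\ln\prod_{j<k}\alpha(\sigma(j),i)\Big|<\delta .$$ If $a_i/h_0\le\varepsilon_0$ for all $i$, then likewise for every $\delta>0$ there is $R>0$, depending only on $\delta,N,g,h_0$ and the $a_i$, such that (c) and (d) hold for every trajectory that avoids interactions at distance $R$ and starts in the fluid above the bed, i.e. $X(t)\to x_0$ and $Y(t)\to y_0$ as $t\to-\infty$ with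 $x_0\in\mathbb R$, $0<y_0\le h_0$ (with no bound assumed on $Y$ at later times). -/

import Mathlib

namespace KdVSoliton

noncomputable section

/-- Inverse width `β_i = √(3 a_i / (4 h₀³))` of a soliton of amplitude `ai`. -/
def beta (h₀ ai : ℝ) : ℝ := √(3 * ai / (4 * h₀ ^ 3))

/-- Speed `c_i = √(g h₀) (1 + a_i / (2 h₀))` of a soliton of amplitude `ai`. -/
def speed (g h₀ ai : ℝ) : ℝ := √(g * h₀) * (1 + ai / (2 * h₀))

/-- Interaction coefficient `α(i,j) = ((√a_i - √a_j) / (√a_i + √a_j))²`. -/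
def alpha (ai aj : ℝ) : ℝ := ((√ai - √aj) / (√ai + √aj)) ^ 2

/-- `α(i₁,…,iₙ)`: the product of the coefficients over all pairs of indices in `S`
(equal to `1` if `S` has at most one element). -/
def alphaSet {N : ℕ} (a : Fin N → ℝ) (S : Finset (Fin N)) : ℝ :=
  ∏ p ∈ (S ×ˢ S).filter (fun p => p.1 < p.2), alpha (a p.1) (a p.2)

/-- The exponential `f_i(z,t) = exp (-2 β_i (z - s_i - c_i t))`, for complex `z`. -/
def expo (g h₀ ai si : ℝ) (z : ℂ) (t : ℝ) : ℂ :=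
  Complex.exp (-2 * (beta h₀ ai : ℂ) * (z - (si : ℂ) - (speed g h₀ ai : ℂ) * (t : ℂ)))

/-- Hirota's function `F = 1 + ∑ₙ ∑ α(i₁,…,iₙ) f_{i₁} ⋯ f_{iₙ}`; the leading `1` is the term of the
empty set of indices. -/
def hirotaF {N : ℕ} (g h₀ : ℝ) (a s : Fin N → ℝ) (z : ℂ) (t : ℝ) : ℂ :=
  ∑ S : Finset (Fin N), (alphaSet a S : ℂ) * ∏ i ∈ S, expo g h₀ (a i) (s i) z t

/-- The `N`-soliton surface elevation `η = (4 h₀³ / 3) (ln F)_xx`, for real `x`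
(`F` is real and positive there). -/
def eta {N : ℕ} (g h₀ : ℝ) (a s : Fin N → ℝ) (x t : ℝ) : ℝ :=
  4 * h₀ ^ 3 / 3 * iteratedDeriv 2 (fun x' : ℝ => Real.log (hirotaF g h₀ a s (x' : ℂ) t).re) x

/-- The analytic continuation of `η(·,t)` to complex arguments, `(4 h₀³ / 3) (F'/F)'`. -/
def etaC {N : ℕ} (g h₀ : ℝ) (a s : Fin N → ℝ) (z : ℂ) (t : ℝ) : ℂ :=
  (4 * h₀ ^ 3 / 3 : ℝ) * deriv (logDeriv (fun w : ℂ => hirotaF g h₀ a s w t)) z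

/-- Horizontal velocity `u = ½ √(g/h₀) (η(x+iy,t) + η(x-iy,t))`
(the complex number on the right is real). -/
def velU {N : ℕ} (g h₀ : ℝ) (a s : Fin N → ℝ) (x y t : ℝ) : ℝ :=
  (1 / 2 * (√(g / h₀) : ℂ) * (etaC g h₀ a s (x + Complex.I * y) t
    + etaC g h₀ a s (x - Complex.I * y) t)).re

/-- Vertical velocity `v = (i/2) √(g/h₀) (η(x+iy,t) - η(x-iy,t))`
(the complex number on the right is real). -/
def velV {N : ℕ} (g h₀ : ℝ) (a s : Fin N → ℝ) (x y t : ℝ) : ℝ :=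
  (Complex.I / 2 * (√(g / h₀) : ℂ) * (etaC g h₀ a s (x + Complex.I * y) t
    - etaC g h₀ a s (x - Complex.I * y) t)).re

/-- `(X, Y)` is the path of a particle carried by the velocity field `(u, v)`. -/
def IsTrajectory {N : ℕ} (g h₀ : ℝ) (a s : Fin N → ℝ) (X Y : ℝ → ℝ) : Prop :=
  ∀ t, HasDerivAt X (velU g h₀ a s (X t) (Y t) t) t ∧
    HasDerivAt Y (velV g h₀ a s (X t) (Y t) t) t

/-- Signed distance `β_i (x - s_i - c_i t)` of `x` to the `i`-th soliton at time `t`, in units of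
its width, so that `f_i = exp (-2 phase)`. -/
def phase {N : ℕ} (g h₀ : ℝ) (a s : Fin N → ℝ) (i : Fin N) (x t : ℝ) : ℝ :=
  beta h₀ (a i) * (x - s i - speed g h₀ (a i) * t)

/-- The particle meets no soliton interaction (at distance `R`): at no time is it within `R` widths
of two different solitons, that is, whenever `exp (-2R) ≤ f_k ≤ exp (2R)`, every other `f_i` is
larger than `exp (2R)` or smaller than `exp (-2R)`. -/
def AvoidsInteractions {N : ℕ} (g h₀ : ℝ) (a s : Fin N → ℝ) (R : ℝ) (X : ℝ → ℝ) : Prop :=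
  ∀ t : ℝ, ∀ i j : Fin N, |phase g h₀ a s i (X t) t| ≤ R → |phase g h₀ a s j (X t) t| ≤ R → i = j

/-- The vertical velocity of the particle is positive on `(-∞, τ₁)` and on `(τ_{2k}, τ_{2k+1})`,
`1 ≤ k ≤ N-1`, and negative on `(τ_{2k-1}, τ_{2k})`, `1 ≤ k ≤ N-1`, and on `(τ_{2N-1}, ∞)`. -/
def UpDownPattern {N : ℕ} (g h₀ : ℝ) (a s : Fin N → ℝ) (X Y : ℝ → ℝ) (τ : ℕ → ℝ) : Prop :=
  StrictMonoOn τ (Set.Icc 1 (2 * N - 1)) ∧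
  (∀ t, (t < τ 1 ∨ ∃ k ∈ Set.Icc 1 (N - 1), t ∈ Set.Ioo (τ (2 * k)) (τ (2 * k + 1))) →
    0 < velV g h₀ a s (X t) (Y t) t) ∧
  (∀ t, ((∃ k ∈ Set.Icc 1 (N - 1), t ∈ Set.Ioo (τ (2 * k - 1)) (τ (2 * k))) ∨ τ (2 * N - 1) < t) →
    velV g h₀ a s (X t) (Y t) t < 0)

/-- With `σ` the order in which the solitons pass the particle (here counted from `0`): at time
`τ_{2k+1}` the solitons `σ j`, `j < k`, have passed the particle, the solitons `σ j`, `j > k`, are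
still to come, all of them more than `R` widths away, and the particle is within `δ` of
`s_i + c_i τ + (1 / 2β_i) ln ∏_{j<k} α(σ j, i)`, `i = σ k`, the centre of the phase-shifted soliton
`i`. -/
def FollowsPhaseShifts {N : ℕ} (g h₀ : ℝ) (a s : Fin N → ℝ) (R δ : ℝ) (X : ℝ → ℝ) (τ : ℕ → ℝ)
    (σ : Equiv.Perm (Fin N)) : Prop :=
  ∀ k : Fin N,
    (∀ j < k, phase g h₀ a s (σ j) (X (τ (2 * (k : ℕ) + 1))) (τ (2 * (k : ℕ) + 1)) < -R) ∧
    (∀ j > k, R < phase g h₀ a s (σ j) (X (τ (2 * (k : ℕ) + 1))) (τ (2 * (k : ℕ) + 1))) ∧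
    |X (τ (2 * (k : ℕ) + 1)) - (s (σ k) + speed g h₀ (a (σ k)) * τ (2 * (k : ℕ) + 1)
      + 1 / (2 * beta h₀ (a (σ k)))
        * Real.log (∏ j ∈ Finset.univ.filter (fun j => j < k), alpha (a (σ j)) (a (σ k))))| < δ

/-- The particle moves up and down as prescribed by `N` successive solitons, and follows their
phase shifts with error at most `δ`. -/
def MovesWithSolitons {N : ℕ} (g h₀ : ℝ) (a s : Fin N → ℝ) (R δ : ℝ) (X Y : ℝ → ℝ) : Prop :=
  ∃ (τ : ℕ → ℝ) (σ : Equiv.Perm (Fin N)),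
    UpDownPattern g h₀ a s X Y τ ∧ FollowsPhaseShifts g h₀ a s R δ X τ σ

/-- The smallness condition `(h₀ + a) ∑ β_i ≤ π / 4`, `a = max a_i`. -/
def SmallAmplitude {N : ℕ} (h₀ : ℝ) (a : Fin N → ℝ) : Prop :=
  (h₀ + ⨆ i, a i) * ∑ i, beta h₀ (a i) ≤ Real.pi / 4

end

end KdVSoliton

/-! On a vertical line, `F(x+iy,t) = ∑_T w_T exp(-i μ_T y)` with positive weights `w_T` and
frequencies `μ_T = 2 ∑_{i∈T} β_i` in `[0, 2L]`, `L = ∑ β_i`. Up to positive constants, `u` and `-v`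
are the real and imaginary parts of `(F F'' - F'²)/F²`. Multiplying by `|F|⁴` leaves trigonometric
sums over quadruples of index sets, with coefficients `(μ₁-μ₂)²/2` and frequencies `μ₁+μ₂-μ₃-μ₄`.
For `L|y| ≤ π/4` the phases of the terms of `F` spread over at most `π/2`. Hence `F ≠ 0`, and
symmetrizing the cosine sum over the pairings of four indices makes it positive (`quadCos_pos`), so
`u > 0`. The sine sum is `O(|y|)`, so the bed is invariant.

On the real line `F = det(1+A)` with the Cauchy matrix `A_ij = v_i v_j/(β_i+β_j)`. The Lyapunov
equation `BA + AB = vvᵀ`, `B = diag β`, gives `(ln F)_xx = 2 w·Bw ≤ max β_i²` for `w = (1+A)⁻¹v`,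
which is `η ≤ a` (`two_dot_le_sq`). Hence `u` is at most `2√(g/h₀) a`, and by (∗) every soliton is
faster than every particle by a fixed margin: it passes exactly once, and its phase decreases
strictly.

The sign of `v` is that of `psi`, the sine sum divided by `y`, with weights normalized by that of a
set `S` of solitons that have passed. Far from all solitons `w_S` dominates; the terms in which one
index differs from `S` by one soliton make `psi` increase along the path, positive if `S = ∅`,
negative if `S` is everything (`exists_gap_radius`). Near soliton `i` alone, `S` and `S ∪ {i}`
dominate, and with `q = w_{S∪{i}}/w_S` one has `psi ≈ A(q - q³)`, `A > 0`, `q` increasing in time.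
So `psi` goes from positive to negative, with exactly one zero, near `q = 1` (`exists_core_radius`),
and `q = 1` is the crest shifted by `(1/2β_i) ln ∏_{j∈S} α(j,i)`. Alternating near and far intervals
in the order of passage gives (c) and (d).

For small amplitudes the height bound is automatic. Along a path the trace of `(1+A)⁻¹`, which lies
in `[0,N]`, falls fast enough to pay for the growth of `ln Y`: `ln Y + Tr/(2N)` does not increase
(`exists_deriv_trace_le`), so `Y` stays below `2h₀`. -/

namespace KdVSoliton

noncomputable section

/-! ### Exponential sums with positive weights and their second logarithmic derivative -/

open Complex in
/-- The exponential sum `∑ w_T exp (-i μ_T y)`. -/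
def expSum {ι : Type*} [Fintype ι] (w μ : ι → ℝ) (y : ℝ) : ℂ :=
  ∑ T, (w T : ℂ) * exp (-((μ T * y : ℝ) : ℂ) * I)

open Complex in
/-- The numerator `G G'' - (G')²` of the second logarithmic derivative of an exponential sum `G`. -/
def expNum {ι : Type*} [Fintype ι] (w μ : ι → ℝ) (y : ℝ) : ℂ :=
  ∑ S, ∑ T, ((w S * w T * ((μ S - μ T) ^ 2 / 2) : ℝ) : ℂ) * exp (-(((μ S + μ T) * y : ℝ) : ℂ) * I)

/-- The value of `expNum` at `y = 0`. -/
def expVar {ι : Type*} [Fintype ι] (w μ : ι → ℝ) : ℝ :=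
  ∑ S, ∑ T, w S * w T * ((μ S - μ T) ^ 2 / 2)

/-- The product of four weights. -/
def quadWeight {ι : Type*} (w : ι → ℝ) (q : ι × ι × ι × ι) : ℝ :=
  w q.1 * w q.2.1 * w q.2.2.1 * w q.2.2.2

/-- The coefficient `(μ₁ - μ₂)² / 2`. -/
def quadCoeff {ι : Type*} (μ : ι → ℝ) (q : ι × ι × ι × ι) : ℝ :=
  (μ q.1 - μ q.2.1) ^ 2 / 2

/-- The frequency `μ₁ + μ₂ - μ₃ - μ₄`. -/
def quadFreq {ι : Type*} (μ : ι → ℝ) (q : ι × ι × ι × ι) : ℝ :=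
  μ q.1 + μ q.2.1 - μ q.2.2.1 - μ q.2.2.2

/-- The negative of the imaginary part of `expNum * conj (expSum)²`. -/
def quadSin {ι : Type*} [Fintype ι] (w μ : ι → ℝ) (y : ℝ) : ℝ :=
  ∑ q, quadWeight w q * (quadCoeff μ q * Real.sin (quadFreq μ q * y))

/-- The real part of `expNum * conj (expSum)²`. -/
def quadCos {ι : Type*} [Fintype ι] (w μ : ι → ℝ) (y : ℝ) : ℝ :=
  ∑ q, quadWeight w q * (quadCoeff μ q * Real.cos (quadFreq μ q * y))

open Complex ComplexConjugate in
theorem expNum_mul_conj_sq {ι : Type*} [Fintype ι] (w μ : ι → ℝ) (y : ℝ) :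
    expNum w μ y * conj (expSum w μ y) ^ 2 =
      ∑ q, ((quadWeight w q * quadCoeff μ q : ℝ) : ℂ) * exp (-((quadFreq μ q * y : ℝ) : ℂ) * I) := by
  have h1 : conj (expSum w μ y) = ∑ T, (w T : ℂ) * exp (((μ T * y : ℝ) : ℂ) * I) := by
    simp only [expSum, map_sum, map_mul, conj_ofReal, ← exp_conj, map_neg, conj_I]
    simp
  rw [h1, sq, Finset.sum_mul_sum]
  simp only [expNum, Fintype.sum_prod_type, Finset.sum_mul]
  refine Finset.sum_congr rfl fun a _ => Finset.sum_congr rfl fun b _ => ?_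
  rw [Finset.mul_sum]
  refine Finset.sum_congr rfl fun c _ => ?_
  rw [Finset.mul_sum]
  refine Finset.sum_congr rfl fun d _ => ?_
  simp only [quadWeight, quadCoeff, quadFreq]
  have : exp (-(((μ a + μ b - μ c - μ d) * y : ℝ) : ℂ) * I)
      = exp (-(((μ a + μ b) * y : ℝ) : ℂ) * I) * (exp (((μ c * y : ℝ) : ℂ) * I) *
        exp (((μ d * y : ℝ) : ℂ) * I)) := by
    rw [← exp_add, ← exp_add]; congr 1; push_cast; ring
  rw [this]; push_cast; ring

open Complex in
theorem re_expNum_mul {ι : Type*} [Fintype ι] (w μ : ι → ℝ) (y : ℝ) :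
    (expNum w μ y * (starRingEnd ℂ) (expSum w μ y) ^ 2).re = quadCos w μ y := by
  rw [expNum_mul_conj_sq, re_sum]
  refine Finset.sum_congr rfl fun q _ => ?_
  rw [re_ofReal_mul, ← ofReal_neg, exp_ofReal_mul_I_re, Real.cos_neg, mul_assoc]

open Complex in
theorem im_expNum_mul {ι : Type*} [Fintype ι] (w μ : ι → ℝ) (y : ℝ) :
    (expNum w μ y * (starRingEnd ℂ) (expSum w μ y) ^ 2).im = -quadSin w μ y := by
  rw [expNum_mul_conj_sq, im_sum, quadSin, ← Finset.sum_neg_distrib]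
  refine Finset.sum_congr rfl fun q _ => ?_
  rw [im_ofReal_mul, ← ofReal_neg, exp_ofReal_mul_I_im, Real.sin_neg]; ring

open Complex in
theorem div_sq_eq_mul_conj_sq (n d : ℂ) :
    n / d ^ 2 = ((((normSq d) ^ 2)⁻¹ : ℝ) : ℂ) * (n * (starRingEnd ℂ) d ^ 2) := by
  rw [div_eq_mul_inv, ← inv_pow, inv_def]; push_cast; ring

theorem re_expNum_div {ι : Type*} [Fintype ι] (w μ : ι → ℝ) (y : ℝ) :
    (expNum w μ y / expSum w μ y ^ 2).re =
      quadCos w μ y / (Complex.normSq (expSum w μ y)) ^ 2 := by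
  rw [div_sq_eq_mul_conj_sq, Complex.re_ofReal_mul, re_expNum_mul, div_eq_inv_mul]

theorem im_expNum_div {ι : Type*} [Fintype ι] (w μ : ι → ℝ) (y : ℝ) :
    (expNum w μ y / expSum w μ y ^ 2).im =
      -(quadSin w μ y / (Complex.normSq (expSum w μ y)) ^ 2) := by
  rw [div_sq_eq_mul_conj_sq, Complex.im_ofReal_mul, im_expNum_mul, div_eq_inv_mul]; ring

theorem cos_add_cos_nonneg {p q : ℝ} (h : |p| + |q| ≤ Real.pi) : 0 ≤ Real.cos p + Real.cos q := by
  rw [Real.cos_add_cos]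
  have h1 : |p + q| ≤ |p| + |q| := abs_add_le p q
  have h2 : |p - q| ≤ |p| + |q| := abs_sub p q
  have := abs_le.1 (h1.trans h)
  have := abs_le.1 (h2.trans h)
  exact mul_nonneg (mul_nonneg zero_le_two
    (Real.cos_nonneg_of_mem_Icc ⟨by linarith, by linarith⟩))
    (Real.cos_nonneg_of_mem_Icc ⟨by linarith, by linarith⟩)

/-- The sum over all pairings of four frequencies. -/
theorem sum_pairings_cos {a b c d y : ℝ} :
    ((a - b) ^ 2 + (c - d) ^ 2) * Real.cos ((a + b - c - d) * y)
      + ((a - c) ^ 2 + (b - d) ^ 2) * Real.cos ((a + c - b - d) * y)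
      + ((a - d) ^ 2 + (b - c) ^ 2) * Real.cos ((a + d - b - c) * y)
    = ((a + c - b - d) ^ 2 * (Real.cos ((a + b - c - d) * y) + Real.cos ((a + d - b - c) * y))
      + (a + d - b - c) ^ 2 * (Real.cos ((a + b - c - d) * y) + Real.cos ((a + c - b - d) * y))
      + (a + b - c - d) ^ 2 * (Real.cos ((a + c - b - d) * y) + Real.cos ((a + d - b - c) * y)))
        / 2 := by
  ring

/-- With `A = a+b-c-d`, `B = a+c-b-d`, `C = a+d-b-c` one has `(a-b)²+(c-d)² = (B²+C²)/2`, and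
likewise for the other pairings. Regrouped by squares, the sum contains only sums of two cosines.
Each is nonnegative: for instance `A ± C` are `2(a-c)` and `2(b-d)`, so `|A|+|C|` is twice the
larger of two differences of frequencies. -/
theorem sum_pairings_cos_nonneg {a b c d y : ℝ}
    (h : ∀ p ∈ ({a, b, c, d} : Set ℝ), ∀ q ∈ ({a, b, c, d} : Set ℝ), |(p - q) * y| ≤ Real.pi / 2) :
    0 ≤ ((a - b) ^ 2 + (c - d) ^ 2) * Real.cos ((a + b - c - d) * y)
      + ((a - c) ^ 2 + (b - d) ^ 2) * Real.cos ((a + c - b - d) * y)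
      + ((a - d) ^ 2 + (b - c) ^ 2) * Real.cos ((a + d - b - c) * y) := by
  have key : ∀ p q r s : ℝ, |(p - q) * y| ≤ Real.pi / 2 → |(r - s) * y| ≤ Real.pi / 2 →
      |((p - q) + (r - s)) * y| + |((p - q) - (r - s)) * y| ≤ Real.pi := by
    intro p q r s h1 h2
    rw [add_mul, sub_mul (p - q)]
    generalize (p - q) * y = u at *
    generalize (r - s) * y = v at *
    rw [abs_le] at h1 h2
    rcases abs_cases (u + v) with h | h <;> rcases abs_cases (u - v) with h' | h' <;> linarith
  have hab := h a (by simp) b (by simp)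
  have hac := h a (by simp) c (by simp)
  have had := h a (by simp) d (by simp)
  have hbc := h b (by simp) c (by simp)
  have hbd := h b (by simp) d (by simp)
  have hcd := h c (by simp) d (by simp)
  rw [sum_pairings_cos]
  have e1 := cos_add_cos_nonneg (p := (a + b - c - d) * y) (q := (a + d - b - c) * y) (by
    convert key a c b d hac hbd using 3 <;> ring_nf)
  have e2 := cos_add_cos_nonneg (p := (a + b - c - d) * y) (q := (a + c - b - d) * y) (by
    convert key a d b c had hbc using 3 <;> ring_nf)
  have e3 := cos_add_cos_nonneg (p := (a + c - b - d) * y) (q := (a + d - b - c) * y) (by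
    convert key a b c d hab hcd using 3 <;> ring_nf)
  positivity

/-- The six summands choose which two of the four indices form the distinguished pair. A single term
of `quadCos` may be negative; only this average is nonnegative termwise. -/
theorem sum_quad_symm {ι : Type*} [Fintype ι] (f : ι → ι → ι → ι → ℝ) :
    6 * ∑ q : ι × ι × ι × ι, f q.1 q.2.1 q.2.2.1 q.2.2.2 =
      ∑ q : ι × ι × ι × ι, (f q.1 q.2.1 q.2.2.1 q.2.2.2 + f q.2.2.1 q.2.2.2 q.1 q.2.1
        + (f q.1 q.2.2.1 q.2.1 q.2.2.2 + f q.2.1 q.2.2.2 q.1 q.2.2.1)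
        + (f q.1 q.2.2.2 q.2.1 q.2.2.1 + f q.2.1 q.2.2.1 q.1 q.2.2.2)) := by
  have e1 : ∑ q : ι × ι × ι × ι, f q.2.2.1 q.2.2.2 q.1 q.2.1
      = ∑ q : ι × ι × ι × ι, f q.1 q.2.1 q.2.2.1 q.2.2.2 :=
    Fintype.sum_equiv ⟨fun q => (q.2.2.1, q.2.2.2, q.1, q.2.1),
      fun q => (q.2.2.1, q.2.2.2, q.1, q.2.1), fun _ => rfl, fun _ => rfl⟩ _ _ fun _ => rfl
  have e2 : ∑ q : ι × ι × ι × ι, f q.1 q.2.2.1 q.2.1 q.2.2.2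
      = ∑ q : ι × ι × ι × ι, f q.1 q.2.1 q.2.2.1 q.2.2.2 :=
    Fintype.sum_equiv ⟨fun q => (q.1, q.2.2.1, q.2.1, q.2.2.2),
      fun q => (q.1, q.2.2.1, q.2.1, q.2.2.2), fun _ => rfl, fun _ => rfl⟩ _ _ fun _ => rfl
  have e3 : ∑ q : ι × ι × ι × ι, f q.2.1 q.2.2.2 q.1 q.2.2.1
      = ∑ q : ι × ι × ι × ι, f q.1 q.2.1 q.2.2.1 q.2.2.2 :=
    Fintype.sum_equiv ⟨fun q => (q.2.1, q.2.2.2, q.1, q.2.2.1),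
      fun q => (q.2.2.1, q.1, q.2.2.2, q.2.1), fun _ => rfl, fun _ => rfl⟩ _ _ fun _ => rfl
  have e4 : ∑ q : ι × ι × ι × ι, f q.1 q.2.2.2 q.2.1 q.2.2.1
      = ∑ q : ι × ι × ι × ι, f q.1 q.2.1 q.2.2.1 q.2.2.2 :=
    Fintype.sum_equiv ⟨fun q => (q.1, q.2.2.2, q.2.1, q.2.2.1),
      fun q => (q.1, q.2.2.1, q.2.2.2, q.2.1), fun _ => rfl, fun _ => rfl⟩ _ _ fun _ => rfl
  have e5 : ∑ q : ι × ι × ι × ι, f q.2.1 q.2.2.1 q.1 q.2.2.2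
      = ∑ q : ι × ι × ι × ι, f q.1 q.2.1 q.2.2.1 q.2.2.2 :=
    Fintype.sum_equiv ⟨fun q => (q.2.1, q.2.2.1, q.1, q.2.2.2),
      fun q => (q.2.2.1, q.1, q.2.1, q.2.2.2), fun _ => rfl, fun _ => rfl⟩ _ _ fun _ => rfl
  simp only [Finset.sum_add_distrib, e1, e2, e3, e4, e5]
  ring

/-- The real part of the second logarithmic derivative of an exponential sum with positive weights
is positive in a strip. -/
theorem quadCos_pos {ι : Type*} [Fintype ι] (w μ : ι → ℝ) (y : ℝ) (hw : ∀ T, 0 < w T)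
    (hμ : ∀ S T, |(μ S - μ T) * y| ≤ Real.pi / 2) (hne : ∃ S T, μ S ≠ μ T) :
    0 < quadCos w μ y := by
  have h6 := sum_quad_symm (fun a b c d : ι => w a * w b * w c * w d *
    ((μ a - μ b) ^ 2 / 2 * Real.cos ((μ a + μ b - μ c - μ d) * y)))
  have hq : quadCos w μ y = ∑ q : ι × ι × ι × ι, w q.1 * w q.2.1 * w q.2.2.1 * w q.2.2.2 *
    ((μ q.1 - μ q.2.1) ^ 2 / 2 *
      Real.cos ((μ q.1 + μ q.2.1 - μ q.2.2.1 - μ q.2.2.2) * y)) := rfl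
  rw [← hq] at h6
  have hterm : ∀ a b c d : ι,
      w a * w b * w c * w d * ((μ a - μ b) ^ 2 / 2 * Real.cos ((μ a + μ b - μ c - μ d) * y))
        + w c * w d * w a * w b * ((μ c - μ d) ^ 2 / 2 * Real.cos ((μ c + μ d - μ a - μ b) * y))
        + (w a * w c * w b * w d * ((μ a - μ c) ^ 2 / 2 * Real.cos ((μ a + μ c - μ b - μ d) * y))
        + w b * w d * w a * w c * ((μ b - μ d) ^ 2 / 2 * Real.cos ((μ b + μ d - μ a - μ c) * y)))
        + (w a * w d * w b * w c * ((μ a - μ d) ^ 2 / 2 * Real.cos ((μ a + μ d - μ b - μ c) * y))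
        + w b * w c * w a * w d * ((μ b - μ c) ^ 2 / 2 * Real.cos ((μ b + μ c - μ a - μ d) * y)))
      = w a * w b * w c * w d / 2 *
        (((μ a - μ b) ^ 2 + (μ c - μ d) ^ 2) * Real.cos ((μ a + μ b - μ c - μ d) * y)
      + ((μ a - μ c) ^ 2 + (μ b - μ d) ^ 2) * Real.cos ((μ a + μ c - μ b - μ d) * y)
      + ((μ a - μ d) ^ 2 + (μ b - μ c) ^ 2) * Real.cos ((μ a + μ d - μ b - μ c) * y)) := by
    intro a b c d
    have e1 : Real.cos ((μ c + μ d - μ a - μ b) * y) = Real.cos ((μ a + μ b - μ c - μ d) * y) := by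
      rw [← Real.cos_neg]; congr 1; ring
    have e2 : Real.cos ((μ b + μ d - μ a - μ c) * y) = Real.cos ((μ a + μ c - μ b - μ d) * y) := by
      rw [← Real.cos_neg]; congr 1; ring
    have e3 : Real.cos ((μ b + μ c - μ a - μ d) * y) = Real.cos ((μ a + μ d - μ b - μ c) * y) := by
      rw [← Real.cos_neg]; congr 1; ring
    rw [e1, e2, e3]; ring
  simp only [hterm] at h6
  have hpos : 0 < 6 * quadCos w μ y := by
    rw [h6]
    obtain ⟨S, T, hST⟩ := hne
    -- For the quadruple `(S,T,S,T)` two of the three pairing frequencies vanish, so two cosines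
    -- equal one with the square of the third frequency in front, which gives strict positivity.
    refine Finset.sum_pos' (fun q _ => ?_) ⟨(S, T, S, T), Finset.mem_univ _, ?_⟩
    · have := hw q.1; have := hw q.2.1; have := hw q.2.2.1; have := hw q.2.2.2
      refine mul_nonneg (by positivity) (sum_pairings_cos_nonneg ?_)
      intro p hp r hr
      simp only [Set.mem_insert_iff, Set.mem_singleton_iff] at hp hr
      rcases hp with rfl | rfl | rfl | rfl <;> rcases hr with rfl | rfl | rfl | rfl <;> apply hμ
    · have := hw S; have := hw T
      have h0 : 0 < (μ S - μ T) ^ 2 := by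
        have := sub_ne_zero.2 hST; positivity
      refine mul_pos (by positivity) ?_
      rw [sum_pairings_cos]
      simp
      nlinarith
  linarith

/-- The angles of the terms of an exponential sum lie in a quarter plane. -/
theorem normSq_expSum_ge {ι : Type*} [Fintype ι] (w μ : ι → ℝ) (y L : ℝ) (hw : ∀ T, 0 < w T)
    (hμ : ∀ T, 0 ≤ μ T ∧ μ T ≤ 2 * L) (hy : L * |y| ≤ Real.pi / 4) :
    (∑ T, w T) ^ 2 / 2 ≤ Complex.normSq (expSum w μ y) := by
  -- Rotation by the central frequency `L` brings all phases into `[-π/4, π/4]`, where the cosine is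
  -- at least `√2/2`.
  have hre : ((expSum w μ y) * Complex.exp ((L * y : ℝ) * Complex.I)).re
      = ∑ T, w T * Real.cos ((μ T - L) * y) := by
    rw [expSum, Finset.sum_mul, Complex.re_sum]
    refine Finset.sum_congr rfl fun T _ => ?_
    rw [mul_assoc, ← Complex.exp_add, Complex.re_ofReal_mul]
    have : (-((μ T * y : ℝ) : ℂ) * Complex.I + ((L * y : ℝ) : ℂ) * Complex.I)
      = (((L - μ T) * y : ℝ) : ℂ) * Complex.I := by push_cast; ring
    rw [this, Complex.exp_ofReal_mul_I_re, ← Real.cos_neg]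
    congr 2; ring
  have hle : (∑ T, w T) * (√2 / 2) ≤ ∑ T, w T * Real.cos ((μ T - L) * y) := by
    rw [Finset.sum_mul]
    refine Finset.sum_le_sum fun T _ => mul_le_mul_of_nonneg_left ?_ (hw T).le
    rw [← Real.cos_pi_div_four, ← Real.cos_abs ((μ T - L) * y)]
    have hb : |(μ T - L) * y| ≤ Real.pi / 4 := by
      rw [abs_mul]
      refine le_trans (mul_le_mul_of_nonneg_right ?_ (abs_nonneg y)) hy
      rw [abs_le]; constructor <;> linarith [(hμ T).1, (hμ T).2]
    exact Real.cos_le_cos_of_nonneg_of_le_pi (abs_nonneg _) (by linarith [Real.pi_pos]) hb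
  have hnorm : ‖(expSum w μ y) * Complex.exp ((L * y : ℝ) * Complex.I)‖ = ‖expSum w μ y‖ := by
    rw [norm_mul, Complex.norm_exp_ofReal_mul_I, mul_one]
  have hle2 : (∑ T, w T) * (√2 / 2) ≤ ‖expSum w μ y‖ := by
    rw [← hnorm]; exact hle.trans (hre ▸ Complex.re_le_norm _)
  rw [Complex.normSq_eq_norm_sq]
  have h0 : 0 ≤ (∑ T, w T) * (√2 / 2) := mul_nonneg (Finset.sum_nonneg fun T _ => (hw T).le)
    (by positivity)
  calc (∑ T, w T) ^ 2 / 2 = ((∑ T, w T) * (√2 / 2)) ^ 2 := by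
        rw [mul_pow, div_pow, Real.sq_sqrt zero_le_two]; ring
    _ ≤ _ := by gcongr

theorem norm_expNum_le {ι : Type*} [Fintype ι] (w μ : ι → ℝ) (y : ℝ) (hw : ∀ T, 0 < w T) :
    ‖expNum w μ y‖ ≤ expVar w μ := by
  refine (norm_sum_le _ _).trans (Finset.sum_le_sum fun S _ => (norm_sum_le _ _).trans
    (Finset.sum_le_sum fun T _ => ?_))
  rw [norm_mul, ← Complex.ofReal_neg, Complex.norm_exp_ofReal_mul_I, mul_one, Complex.norm_real,
    Real.norm_of_nonneg]
  have := hw S; have := hw T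
  positivity

theorem expVar_nonneg {ι : Type*} [Fintype ι] (w μ : ι → ℝ) (hw : ∀ T, 0 < w T) :
    0 ≤ expVar w μ :=
  Finset.sum_nonneg fun S _ => Finset.sum_nonneg fun T _ => by
    have := hw S; have := hw T
    positivity

theorem norm_expNum_div_le {ι : Type*} [Fintype ι] [Nonempty ι] (w μ : ι → ℝ) (y L : ℝ)
    (hw : ∀ T, 0 < w T) (hμ : ∀ T, 0 ≤ μ T ∧ μ T ≤ 2 * L) (hy : L * |y| ≤ Real.pi / 4) :
    ‖expNum w μ y / expSum w μ y ^ 2‖ ≤ 2 * (expVar w μ / (∑ T, w T) ^ 2) := by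
  have h1 := normSq_expSum_ge w μ y L hw hμ hy
  have h2 : 0 < ∑ T, w T := Finset.sum_pos (fun T _ => hw T) Finset.univ_nonempty
  rw [norm_div, norm_pow, ← Complex.normSq_eq_norm_sq]
  calc _ ≤ expVar w μ / ((∑ T, w T) ^ 2 / 2) := by
        gcongr
        · exact expVar_nonneg w μ hw
        · exact norm_expNum_le w μ y hw
    _ = _ := by field_simp

theorem quadWeight_pos {ι : Type*} {w : ι → ℝ} (hw : ∀ T, 0 < w T) (q : ι × ι × ι × ι) :
    0 < quadWeight w q := by
  unfold quadWeight
  have := hw q.1; have := hw q.2.1; have := hw q.2.2.1; have := hw q.2.2.2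
  positivity

theorem quadCoeff_nonneg {ι : Type*} (μ : ι → ℝ) (q : ι × ι × ι × ι) : 0 ≤ quadCoeff μ q := by
  unfold quadCoeff; positivity

theorem sum_quadWeight_mul_coeff {ι : Type*} [Fintype ι] (w μ : ι → ℝ) :
    ∑ q, quadWeight w q * quadCoeff μ q = expVar w μ * (∑ T, w T) ^ 2 := by
  rw [sq, Finset.sum_mul_sum, expVar]
  simp only [Fintype.sum_prod_type, Finset.sum_mul]
  refine Finset.sum_congr rfl fun a _ => Finset.sum_congr rfl fun b _ => ?_
  rw [Finset.mul_sum]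
  refine Finset.sum_congr rfl fun c _ => ?_
  rw [Finset.mul_sum]
  refine Finset.sum_congr rfl fun d _ => ?_
  simp only [quadWeight, quadCoeff]
  ring

theorem abs_quadFreq_le {ι : Type*} {μ : ι → ℝ} {L : ℝ} (hμ : ∀ T, 0 ≤ μ T ∧ μ T ≤ 2 * L)
    (q : ι × ι × ι × ι) : |quadFreq μ q| ≤ 4 * L := by
  unfold quadFreq
  rw [abs_le]
  constructor <;> linarith [(hμ q.1).1, (hμ q.1).2, (hμ q.2.1).1, (hμ q.2.1).2, (hμ q.2.2.1).1,
    (hμ q.2.2.1).2, (hμ q.2.2.2).1, (hμ q.2.2.2).2]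

theorem abs_quadSin_le {ι : Type*} [Fintype ι] (w μ : ι → ℝ) (y L : ℝ) (hw : ∀ T, 0 < w T)
    (hμ : ∀ T, 0 ≤ μ T ∧ μ T ≤ 2 * L) :
    |quadSin w μ y| ≤ 4 * L * |y| * (expVar w μ * (∑ T, w T) ^ 2) := by
  rw [← sum_quadWeight_mul_coeff, Finset.mul_sum]
  refine (Finset.abs_sum_le_sum_abs _ _).trans (Finset.sum_le_sum fun q _ => ?_)
  have h1 := (quadWeight_pos hw q).le
  have h2 := quadCoeff_nonneg μ q
  rw [abs_mul, abs_mul, abs_of_nonneg h1, abs_of_nonneg h2]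
  have h3 : |Real.sin (quadFreq μ q * y)| ≤ 4 * L * |y| := by
    refine Real.abs_sin_le_abs.trans ?_
    rw [abs_mul]
    exact mul_le_mul_of_nonneg_right (abs_quadFreq_le hμ q) (abs_nonneg y)
  calc _ ≤ quadWeight w q * (quadCoeff μ q * (4 * L * |y|)) := by gcongr
    _ = _ := by ring

/-- The factor `|y|`, from `|sin x| ≤ |x|`, matters: the vertical velocity vanishes on the bed, and
its quotient by the height is bounded uniformly. -/
theorem abs_im_expNum_div_le {ι : Type*} [Fintype ι] [Nonempty ι] (w μ : ι → ℝ) (y L : ℝ)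
    (hw : ∀ T, 0 < w T) (hμ : ∀ T, 0 ≤ μ T ∧ μ T ≤ 2 * L) (hy : L * |y| ≤ Real.pi / 4) :
    |(expNum w μ y / expSum w μ y ^ 2).im| ≤ 16 * L * |y| * (expVar w μ / (∑ T, w T) ^ 2) := by
  have h1 := normSq_expSum_ge w μ y L hw hμ hy
  have h2 : 0 < ∑ T, w T := Finset.sum_pos (fun T _ => hw T) Finset.univ_nonempty
  have h3 := abs_quadSin_le w μ y L hw hμ
  have hs : 0 < (∑ T, w T) ^ 2 / 2 := by positivity
  rw [im_expNum_div, abs_neg, abs_div, abs_of_nonneg (sq_nonneg (Complex.normSq _))]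
  calc _ ≤ 4 * L * |y| * (expVar w μ * (∑ T, w T) ^ 2) / ((∑ T, w T) ^ 2 / 2) ^ 2 := by
        gcongr
        exact (abs_nonneg _).trans h3
    _ = _ := by field_simp; ring

end

end KdVSoliton

/-! ### Hirota's function as an exponential sum; formulas for the velocities and the elevation -/

namespace KdVSoliton

noncomputable section

/-- Lagrange's identity: the numerator of the second logarithmic derivative is a variance, hence has
nonnegative coefficients. -/
theorem sum_mul_sum_sub_sq {ι R : Type*} [Fintype ι] [Field R] [CharZero R] (e μ : ι → R) :
    (∑ T, e T) * (∑ T, μ T ^ 2 * e T) - (∑ T, μ T * e T) ^ 2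
      = ∑ S, ∑ T, e S * e T * ((μ S - μ T) ^ 2 / 2) := by
  have h1 : (∑ T, e T) * (∑ T, μ T ^ 2 * e T) = ∑ S, ∑ T, e S * (μ T ^ 2 * e T) :=
    Finset.sum_mul_sum ..
  have h2 : (∑ T, e T) * (∑ T, μ T ^ 2 * e T) = ∑ S, ∑ T, (μ S ^ 2 * e S) * e T := by
    rw [mul_comm, Finset.sum_mul_sum]
  have h3 : (∑ T, μ T * e T) ^ 2 = ∑ S, ∑ T, (μ S * e S) * (μ T * e T) := by
    rw [sq, Finset.sum_mul_sum]
  have h4 : ∑ S, ∑ T, e S * e T * ((μ S - μ T) ^ 2 / 2)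
      = ((∑ S, ∑ T, e S * (μ T ^ 2 * e T)) + ∑ S, ∑ T, (μ S ^ 2 * e S) * e T) / 2
        - ∑ S, ∑ T, (μ S * e S) * (μ T * e T) := by
    rw [← Finset.sum_add_distrib, Finset.sum_div, ← Finset.sum_sub_distrib]
    refine Finset.sum_congr rfl fun S _ => ?_
    rw [← Finset.sum_add_distrib, Finset.sum_div, ← Finset.sum_sub_distrib]
    refine Finset.sum_congr rfl fun T _ => ?_
    ring
  rw [h4, ← h1, ← h2, h3]; ring

/-- First derivative of a sum of exponentials. -/
theorem hasDerivAt_sum_exp {ι : Type*} [Fintype ι] (c μ : ι → ℂ) (z : ℂ) :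
    HasDerivAt (fun z => ∑ T, c T * Complex.exp (-μ T * z))
      (-∑ T, μ T * (c T * Complex.exp (-μ T * z))) z := by
  rw [← Finset.sum_neg_distrib]
  refine HasDerivAt.fun_sum fun T _ => ?_
  have := (((hasDerivAt_id z).const_mul (-μ T)).cexp).const_mul (c T)
  refine this.congr_deriv ?_
  simp; ring

theorem deriv_logDeriv_sum_exp {ι : Type*} [Fintype ι] (c μ : ι → ℂ) (z : ℂ)
    (hz : ∑ T, c T * Complex.exp (-μ T * z) ≠ 0) :
    deriv (logDeriv (fun z => ∑ T, c T * Complex.exp (-μ T * z))) z =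
      (∑ S, ∑ T, (c S * Complex.exp (-μ S * z)) * (c T * Complex.exp (-μ T * z))
        * ((μ S - μ T) ^ 2 / 2)) / (∑ T, c T * Complex.exp (-μ T * z)) ^ 2 := by
  have h1 : logDeriv (fun z => ∑ T, c T * Complex.exp (-μ T * z)) = fun z =>
      (-∑ T, μ T * (c T * Complex.exp (-μ T * z))) / ∑ T, c T * Complex.exp (-μ T * z) := by
    funext z
    rw [logDeriv_apply, (hasDerivAt_sum_exp c μ z).deriv]
  have h2 : HasDerivAt (fun z => -∑ T, μ T * (c T * Complex.exp (-μ T * z)))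
      (∑ T, μ T ^ 2 * (c T * Complex.exp (-μ T * z))) z := by
    have := (hasDerivAt_sum_exp (fun T => μ T * c T) μ z).neg
    refine (this.congr_of_eventuallyEq (.of_forall fun z => ?_)).congr_deriv ?_
    · simp only [Pi.neg_apply]; congr 1; exact Finset.sum_congr rfl fun T _ => by ring
    · rw [neg_neg]; exact Finset.sum_congr rfl fun T _ => by ring
  rw [h1, (h2.fun_div (hasDerivAt_sum_exp c μ z) hz).deriv, ← sum_mul_sum_sub_sq]
  congr 1
  ring

theorem alpha_pos {p q : ℝ} (hp : 0 < p) (hq : 0 < q) (h : p ≠ q) : 0 < alpha p q := by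
  unfold alpha
  have h1 : √p - √q ≠ 0 := fun h' => h (by
    have := sub_eq_zero.1 h'
    rwa [Real.sqrt_inj hp.le hq.le] at this)
  have h2 : 0 < √p + √q := by positivity
  have := div_ne_zero h1 h2.ne'
  positivity

theorem alpha_comm (p q : ℝ) : alpha p q = alpha q p := by
  unfold alpha
  rw [div_pow, div_pow, add_comm (√q)]
  congr 1; ring

variable {N : ℕ}

theorem alphaSet_pos {a : Fin N → ℝ} (ha : ∀ i, 0 < a i) (hinj : Function.Injective a)
    (S : Finset (Fin N)) : 0 < alphaSet a S := by
  refine Finset.prod_pos fun p hp => alpha_pos (ha _) (ha _) fun h => ?_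
  have := (Finset.mem_filter.1 hp).2
  exact this.ne (hinj h)

/-- As `α` is symmetric, the ordering of the pairs plays no role, and each `j ∈ S` forms exactly one
new pair with `i`. -/
theorem alphaSet_insert (a : Fin N → ℝ) (S : Finset (Fin N)) (i : Fin N) (hi : i ∉ S) :
    alphaSet a (insert i S) = alphaSet a S * ∏ j ∈ S, alpha (a j) (a i) := by
  classical
  unfold alphaSet
  rw [Finset.prod_filter, Finset.prod_filter, Finset.prod_product, Finset.prod_product,
    Finset.prod_insert hi]
  simp_rw [Finset.prod_insert hi]
  rw [Finset.prod_mul_distrib, if_neg (lt_irrefl _), one_mul, ← mul_assoc, mul_comm,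
    ← Finset.prod_mul_distrib]
  congr 1
  refine Finset.prod_congr rfl fun j hj => ?_
  rcases lt_trichotomy i j with h | h | h
  · rw [if_pos h, if_neg h.not_gt, mul_one, alpha_comm]
  · exact absurd (h ▸ hj) hi
  · rw [if_pos h, if_neg h.not_gt, one_mul]

/-- The frequency `2 ∑ β_i` of the term of a set of indices. -/
def freq (h₀ : ℝ) (a : Fin N → ℝ) (T : Finset (Fin N)) : ℝ := ∑ i ∈ T, 2 * beta h₀ (a i)

/-- The modulus of the term of a set of indices in Hirota's function. -/
def weight (g h₀ : ℝ) (a s : Fin N → ℝ) (x t : ℝ) (T : Finset (Fin N)) : ℝ :=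
  alphaSet a T * Real.exp (-2 * ∑ i ∈ T, phase g h₀ a s i x t)

/-- The second derivative of `ln F` on the real line. -/
def curv (g h₀ : ℝ) (a s : Fin N → ℝ) (x t : ℝ) : ℝ :=
  expVar (weight g h₀ a s x t) (freq h₀ a) / (∑ T, weight g h₀ a s x t T) ^ 2

/-- The factor between `η` and the velocities and the second derivative of `ln F`. -/
def velFactor (g h₀ : ℝ) : ℝ := √(g / h₀) * (4 * h₀ ^ 3 / 3)

theorem weight_pos {g h₀ : ℝ} {a : Fin N → ℝ} (ha : ∀ i, 0 < a i) (hinj : Function.Injective a)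
    (s : Fin N → ℝ) (x t : ℝ) (T : Finset (Fin N)) : 0 < weight g h₀ a s x t T :=
  mul_pos (alphaSet_pos ha hinj T) (Real.exp_pos _)

theorem beta_pos {h₀ p : ℝ} (h : 0 < h₀) (hp : 0 < p) : 0 < beta h₀ p :=
  Real.sqrt_pos.2 (by positivity)

theorem freq_bounds {h₀ : ℝ} (a : Fin N → ℝ) (T : Finset (Fin N)) :
    0 ≤ freq h₀ a T ∧ freq h₀ a T ≤ 2 * ∑ i, beta h₀ (a i) := by
  constructor
  · exact Finset.sum_nonneg fun i _ => mul_nonneg zero_le_two (Real.sqrt_nonneg _)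
  · rw [freq, ← Finset.mul_sum]
    refine mul_le_mul_of_nonneg_left ?_ zero_le_two
    exact Finset.sum_le_sum_of_subset_of_nonneg (Finset.subset_univ T)
      fun i _ _ => Real.sqrt_nonneg _

theorem prod_expo (g h₀ : ℝ) (a s : Fin N → ℝ) (z : ℂ) (t : ℝ) (T : Finset (Fin N)) :
    ∏ i ∈ T, expo g h₀ (a i) (s i) z t
      = (Real.exp (∑ i ∈ T, 2 * beta h₀ (a i) * (s i + speed g h₀ (a i) * t)) : ℂ)
        * Complex.exp (-(freq h₀ a T : ℂ) * z) := by
  unfold expo freq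
  rw [← Complex.exp_sum, Complex.ofReal_exp, ← Complex.exp_add]
  congr 1
  push_cast
  rw [neg_mul, Finset.sum_mul, ← sub_eq_add_neg, ← Finset.sum_sub_distrib]
  exact Finset.sum_congr rfl fun i _ => by ring

theorem hirotaF_eq_sum_exp (g h₀ : ℝ) (a s : Fin N → ℝ) (t : ℝ) :
    (fun z : ℂ => hirotaF g h₀ a s z t) = fun z => ∑ T : Finset (Fin N),
      ((alphaSet a T : ℂ)
        * (Real.exp (∑ i ∈ T, 2 * beta h₀ (a i) * (s i + speed g h₀ (a i) * t)) : ℂ))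
        * Complex.exp (-(freq h₀ a T : ℂ) * z) := by
  funext z
  unfold hirotaF
  refine Finset.sum_congr rfl fun T _ => ?_
  rw [prod_expo, mul_assoc]

theorem hirota_term (g h₀ : ℝ) (a s : Fin N → ℝ) (x y t : ℝ) (T : Finset (Fin N)) :
    ((alphaSet a T : ℂ)
        * (Real.exp (∑ i ∈ T, 2 * beta h₀ (a i) * (s i + speed g h₀ (a i) * t)) : ℂ))
        * Complex.exp (-(freq h₀ a T : ℂ) * (x + Complex.I * y))
      = (weight g h₀ a s x t T : ℂ) * Complex.exp (-((freq h₀ a T * y : ℝ) : ℂ) * Complex.I) := by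
  unfold weight
  push_cast
  rw [mul_assoc, mul_assoc, ← Complex.exp_add, ← Complex.exp_add]
  congr 2
  have h : ∑ i ∈ T, 2 * beta h₀ (a i) * (s i + speed g h₀ (a i) * t) - freq h₀ a T * x
      = -2 * ∑ i ∈ T, phase g h₀ a s i x t := by
    unfold freq phase
    rw [Finset.mul_sum, Finset.sum_mul, ← Finset.sum_sub_distrib]
    exact Finset.sum_congr rfl fun i _ => by ring
  have h' := congrArg (fun r : ℝ => (r : ℂ)) h
  push_cast at h'
  linear_combination h'

theorem hirotaF_eq_expSum (g h₀ : ℝ) (a s : Fin N → ℝ) (x y t : ℝ) :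
    hirotaF g h₀ a s (x + Complex.I * y) t = expSum (weight g h₀ a s x t) (freq h₀ a) y := by
  have := congrFun (hirotaF_eq_sum_exp g h₀ a s t) (x + Complex.I * y)
  rw [this, expSum]
  exact Finset.sum_congr rfl fun T _ => hirota_term ..

theorem etaC_eq (g h₀ : ℝ) (a s : Fin N → ℝ) (x y t : ℝ)
    (h : expSum (weight g h₀ a s x t) (freq h₀ a) y ≠ 0) :
    etaC g h₀ a s (x + Complex.I * y) t = ((4 * h₀ ^ 3 / 3 : ℝ) : ℂ) *
      (expNum (weight g h₀ a s x t) (freq h₀ a) y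
        / expSum (weight g h₀ a s x t) (freq h₀ a) y ^ 2) := by
  have hF := hirotaF_eq_expSum g h₀ a s x y t
  have hF' := congrFun (hirotaF_eq_sum_exp g h₀ a s t) (x + Complex.I * y)
  unfold etaC
  rw [hirotaF_eq_sum_exp, deriv_logDeriv_sum_exp _ _ _ (by rw [← hF', hF]; exact h), ← hF', hF]
  congr 2
  refine Finset.sum_congr rfl fun S _ => Finset.sum_congr rfl fun T _ => ?_
  rw [hirota_term, hirota_term]
  have : Complex.exp (-(((freq h₀ a S + freq h₀ a T) * y : ℝ) : ℂ) * Complex.I)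
      = Complex.exp (-((freq h₀ a S * y : ℝ) : ℂ) * Complex.I) *
        Complex.exp (-((freq h₀ a T * y : ℝ) : ℂ) * Complex.I) := by
    rw [← Complex.exp_add]; congr 1; push_cast; ring
  rw [this]; push_cast; ring

theorem expSum_neg {ι : Type*} [Fintype ι] (w μ : ι → ℝ) (y : ℝ) :
    expSum w μ (-y) = (starRingEnd ℂ) (expSum w μ y) := by
  simp only [expSum, map_sum, map_mul, Complex.conj_ofReal, ← Complex.exp_conj, map_neg,
    Complex.conj_I]
  simp

theorem expNum_neg {ι : Type*} [Fintype ι] (w μ : ι → ℝ) (y : ℝ) :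
    expNum w μ (-y) = (starRingEnd ℂ) (expNum w μ y) := by
  simp only [expNum, map_sum, map_mul, Complex.conj_ofReal, ← Complex.exp_conj, map_neg,
    Complex.conj_I]
  simp

/-- `F` is real on the real axis, so its continuation commutes with conjugation; this turns the sum
and the difference that define `u` and `v` into a real and an imaginary part. -/
theorem etaC_conj (g h₀ : ℝ) (a s : Fin N → ℝ) (x y t : ℝ)
    (h : expSum (weight g h₀ a s x t) (freq h₀ a) y ≠ 0) :
    etaC g h₀ a s (x - Complex.I * y) t
      = (starRingEnd ℂ) (etaC g h₀ a s (x + Complex.I * y) t) := by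
  have : (x : ℂ) - Complex.I * y = x + Complex.I * ((-y : ℝ) : ℂ) := by push_cast; ring
  rw [this, etaC_eq g h₀ a s x y t h, etaC_eq, expSum_neg, expNum_neg]
  · rw [map_mul, Complex.conj_ofReal, map_div₀, map_pow]
  · rw [expSum_neg]; simpa using h

theorem velU_eq (g h₀ : ℝ) (a s : Fin N → ℝ) (x y t : ℝ)
    (h : expSum (weight g h₀ a s x t) (freq h₀ a) y ≠ 0) :
    velU g h₀ a s x y t = velFactor g h₀ *
      (expNum (weight g h₀ a s x t) (freq h₀ a) y
        / expSum (weight g h₀ a s x t) (freq h₀ a) y ^ 2).re := by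
  unfold velU velFactor
  rw [etaC_conj _ _ _ _ _ _ _ h, Complex.add_conj, etaC_eq _ _ _ _ _ _ _ h, Complex.re_ofReal_mul]
  have : (1 / 2 * (√(g / h₀) : ℂ)) = ((1 / 2 * √(g / h₀) : ℝ) : ℂ) := by push_cast; rfl
  rw [this, Complex.re_ofReal_mul, Complex.ofReal_re]; ring

theorem velV_eq (g h₀ : ℝ) (a s : Fin N → ℝ) (x y t : ℝ)
    (h : expSum (weight g h₀ a s x t) (freq h₀ a) y ≠ 0) :
    velV g h₀ a s x y t = -(velFactor g h₀ *
      (expNum (weight g h₀ a s x t) (freq h₀ a) y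
        / expSum (weight g h₀ a s x t) (freq h₀ a) y ^ 2).im) := by
  unfold velV velFactor
  rw [etaC_conj _ _ _ _ _ _ _ h, Complex.sub_conj, etaC_eq _ _ _ _ _ _ _ h, Complex.im_ofReal_mul]
  generalize (expNum (weight g h₀ a s x t) (freq h₀ a) y
        / expSum (weight g h₀ a s x t) (freq h₀ a) y ^ 2).im = r
  have : Complex.I / 2 * (√(g / h₀) : ℂ) * (((2 * (4 * h₀ ^ 3 / 3 * r) : ℝ) : ℂ) * Complex.I)
      = ((-(√(g / h₀) * (4 * h₀ ^ 3 / 3) * r) : ℝ) : ℂ) := by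
    have hI := Complex.I_mul_I
    push_cast
    linear_combination (√(g / h₀) * (4 * h₀ ^ 3 / 3) * r : ℂ) * hI
  rw [this, Complex.ofReal_re]

theorem hasDerivAt_phase (g h₀ : ℝ) (a s : Fin N → ℝ) (i : Fin N) (x t : ℝ) :
    HasDerivAt (fun x => phase g h₀ a s i x t) (beta h₀ (a i)) x := by
  unfold phase
  simpa using (((hasDerivAt_id x).sub_const (s i)).sub_const
    (speed g h₀ (a i) * t)).const_mul (beta h₀ (a i))

theorem hasDerivAt_weight (g h₀ : ℝ) (a s : Fin N → ℝ) (x t : ℝ) (T : Finset (Fin N)) :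
    HasDerivAt (fun x => weight g h₀ a s x t T) (-freq h₀ a T * weight g h₀ a s x t T) x := by
  have h := ((HasDerivAt.fun_sum fun i (_ : i ∈ T) => hasDerivAt_phase g h₀ a s i x t).const_mul
    (-2)).exp.const_mul (alphaSet a T)
  refine h.congr_deriv ?_
  unfold weight freq
  rw [Finset.mul_sum (s := T) (f := fun i => beta h₀ (a i)), ← Finset.sum_neg_distrib]
  simp only [neg_mul]
  ring

/-- The mean `-(ln F)_x` of the frequencies. -/
def slope (g h₀ : ℝ) (a s : Fin N → ℝ) (x t : ℝ) : ℝ :=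
  (∑ T, freq h₀ a T * weight g h₀ a s x t T) / ∑ T, weight g h₀ a s x t T

theorem sum_weight_pos {g h₀ : ℝ} {a : Fin N → ℝ} (ha : ∀ i, 0 < a i)
    (hinj : Function.Injective a) (s : Fin N → ℝ) (x t : ℝ) :
    0 < ∑ T, weight g h₀ a s x t T :=
  Finset.sum_pos (fun T _ => weight_pos ha hinj s x t T) Finset.univ_nonempty

theorem hasDerivAt_log_sum_weight {g h₀ : ℝ} {a : Fin N → ℝ} (ha : ∀ i, 0 < a i)
    (hinj : Function.Injective a) (s : Fin N → ℝ) (x t : ℝ) :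
    HasDerivAt (fun x => Real.log (∑ T, weight g h₀ a s x t T)) (-slope g h₀ a s x t) x := by
  refine ((HasDerivAt.fun_sum fun T _ => hasDerivAt_weight g h₀ a s x t T).log
    (sum_weight_pos ha hinj s x t).ne').congr_deriv ?_
  rw [slope, ← neg_div, ← Finset.sum_neg_distrib]
  simp only [neg_mul]

theorem hasDerivAt_slope {g h₀ : ℝ} {a : Fin N → ℝ} (ha : ∀ i, 0 < a i)
    (hinj : Function.Injective a) (s : Fin N → ℝ) (x t : ℝ) :
    HasDerivAt (fun x => slope g h₀ a s x t) (-curv g h₀ a s x t) x := by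
  have h1 := HasDerivAt.fun_sum fun T (_ : T ∈ Finset.univ) => hasDerivAt_weight g h₀ a s x t T
  have h2 := HasDerivAt.fun_sum fun T (_ : T ∈ Finset.univ) =>
    (hasDerivAt_weight g h₀ a s x t T).const_mul (freq h₀ a T)
  refine (h2.fun_div h1 (sum_weight_pos ha hinj s x t).ne').congr_deriv ?_
  have h3 := sum_mul_sum_sub_sq (weight g h₀ a s x t) (freq h₀ a)
  rw [curv, expVar, ← h3, ← neg_div]
  congr 1
  have e1 : ∑ T, freq h₀ a T * (-freq h₀ a T * weight g h₀ a s x t T)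
      = -∑ T, freq h₀ a T ^ 2 * weight g h₀ a s x t T := by
    rw [← Finset.sum_neg_distrib]; exact Finset.sum_congr rfl fun T _ => by ring
  have e2 : ∑ T, -freq h₀ a T * weight g h₀ a s x t T
      = -∑ T, freq h₀ a T * weight g h₀ a s x t T := by
    rw [← Finset.sum_neg_distrib]; exact Finset.sum_congr rfl fun T _ => by ring
  rw [e1, e2]; ring

theorem hirotaF_ofReal_re (g h₀ : ℝ) (a s : Fin N → ℝ) (x t : ℝ) :
    (hirotaF g h₀ a s (x : ℂ) t).re = ∑ T, weight g h₀ a s x t T := by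
  have := hirotaF_eq_expSum g h₀ a s x 0 t
  simp only [Complex.ofReal_zero, mul_zero, add_zero] at this
  rw [this, expSum]
  simp

theorem eta_eq {g h₀ : ℝ} {a : Fin N → ℝ} (ha : ∀ i, 0 < a i)
    (hinj : Function.Injective a) (s : Fin N → ℝ) (x t : ℝ) :
    eta g h₀ a s x t = 4 * h₀ ^ 3 / 3 * curv g h₀ a s x t := by
  unfold eta
  simp only [hirotaF_ofReal_re]
  rw [iteratedDeriv_succ, iteratedDeriv_one]
  have : deriv (fun x => Real.log (∑ T, weight g h₀ a s x t T))
      = fun x => -slope g h₀ a s x t := by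
    funext x; exact (hasDerivAt_log_sum_weight ha hinj s x t).deriv
  rw [this, (hasDerivAt_slope ha hinj s x t).fun_neg.deriv, neg_neg]

theorem slope_bounds {g h₀ : ℝ} {a : Fin N → ℝ} (ha : ∀ i, 0 < a i)
    (hinj : Function.Injective a) (s : Fin N → ℝ) (x t : ℝ) :
    0 ≤ slope g h₀ a s x t ∧ slope g h₀ a s x t ≤ 2 * ∑ i, beta h₀ (a i) := by
  have hw := weight_pos (g := g) (h₀ := h₀) ha hinj s x t
  constructor
  · exact div_nonneg (Finset.sum_nonneg fun T _ => mul_nonneg (freq_bounds a T).1 (hw T).le)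
      (sum_weight_pos ha hinj s x t).le
  · rw [slope, div_le_iff₀ (sum_weight_pos ha hinj s x t), Finset.mul_sum]
    exact Finset.sum_le_sum fun T _ => mul_le_mul_of_nonneg_right (freq_bounds a T).2 (hw T).le

end

end KdVSoliton

/-! ### Determinant form of `F` and algebra of the Cauchy matrix -/

namespace KdVSoliton

noncomputable section

open Matrix

/-! ### Determinants -/

/-- The determinant of `1 + M` is the sum of all principal minors of `M`. -/
theorem det_one_add_eq_sum_minors {n : Type*} [Fintype n] [DecidableEq n] (M : Matrix n n ℝ) :
    (1 + M).det = ∑ s : Finset n, (M.submatrix (Subtype.val : s → n) (Subtype.val : s → n)).det := by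
  have h := (detRowAlternating : (n → ℝ) [⋀^n]→ₗ[ℝ] ℝ).toMultilinearMap.map_add_univ
    (fun i => M i) (fun i => (1 : Matrix n n ℝ) i)
  rw [add_comm]
  refine Eq.trans h (Finset.sum_congr rfl fun s _ => ?_)
  exact det_piecewise_one_eq_submatrix_det M s

/-- The matrix `v_i v_j / (b_i + b_j)`. -/
def cauchy {n : Type*} (b v : n → ℝ) : Matrix n n ℝ := of fun i j => v i * v j / (b i + b j)

/-- Induction by Schur complement of the entry of `m`: the complement is again a Cauchy matrix, with
`x_i` multiplied by `(b_i-b_m)/(b_i+b_m)`. Hence the quantification over all `x`. The squares of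
these factors are the coefficients `α(i,m)`; distinctness of the `b_i` keeps the new `x_i` nonzero,
so that the next pivot is invertible. -/
theorem det_cauchy {N : ℕ} {a b : Fin N → ℝ} (hb : ∀ i, 0 < b i) (hinj : Function.Injective b)
    (hα : ∀ i j, alpha (a i) (a j) = ((b i - b j) / (b i + b j)) ^ 2) (S : Finset (Fin N)) :
    ∀ x : Fin N → ℝ, (∀ i, i ∈ S → x i ≠ 0) →
      ((cauchy b x).submatrix (Subtype.val : S → Fin N) (Subtype.val : S → Fin N)).det
        = (∏ i ∈ S, x i ^ 2 / (2 * b i)) * alphaSet a S := by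
  induction S using Finset.induction_on with
  | empty => intro x _; simp [alphaSet]
  | insert m S hm ih =>
    intro x hx
    let e : {i // i ∈ insert m S} ≃ S ⊕ Unit :=
      (Finset.subtypeInsertEquivOption hm).trans (Equiv.optionEquivSumPUnit _)
    let x' : Fin N → ℝ := fun i => x i * ((b i - b m) / (b i + b m))
    have hxm : x m ≠ 0 := hx m (Finset.mem_insert_self _ _)
    have hbm := hb m
    rw [← det_submatrix_equiv_self e.symm]
    have hblocks : (((cauchy b x).submatrix (Subtype.val : {i // i ∈ insert m S} → Fin N)
        (Subtype.val : {i // i ∈ insert m S} → Fin N)).submatrix e.symm e.symm) =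
        fromBlocks ((cauchy b x).submatrix (Subtype.val : S → Fin N) (Subtype.val : S → Fin N))
          ((cauchy b x).submatrix (Subtype.val : S → Fin N) (fun _ : Unit => m))
          ((cauchy b x).submatrix (fun _ : Unit => m) (Subtype.val : S → Fin N))
          (diagonal fun _ : Unit => x m ^ 2 / (2 * b m)) := by
      ext (i | i) (j | j)
      · rfl
      · rfl
      · rfl
      · simp only [fromBlocks_apply₂₂, diagonal_apply_eq]
        change x m * x m / (b m + b m) = _
        rw [two_mul, sq]
    have hne : x m ^ 2 / (2 * b m) ≠ 0 := by positivity
    have hdet : IsUnit (diagonal fun _ : Unit => x m ^ 2 / (2 * b m)).det := by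
      simpa using hne
    have := invertibleOfIsUnitDet _ hdet
    rw [hblocks, det_fromBlocks₂₂]
    have hinv : ⅟(diagonal fun _ : Unit => x m ^ 2 / (2 * b m))
        = diagonal fun _ : Unit => (x m ^ 2 / (2 * b m))⁻¹ := by
      refine invOf_eq_right_inv ?_
      rw [diagonal_mul_diagonal]
      simp only [mul_inv_cancel₀ hne, diagonal_one]
    have hschur : ((cauchy b x).submatrix (Subtype.val : S → Fin N) (Subtype.val : S → Fin N))
        - ((cauchy b x).submatrix (Subtype.val : S → Fin N) (fun _ : Unit => m))
          * ⅟(diagonal fun _ : Unit => x m ^ 2 / (2 * b m))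
          * ((cauchy b x).submatrix (fun _ : Unit => m) (Subtype.val : S → Fin N))
        = (cauchy b x').submatrix (Subtype.val : S → Fin N) (Subtype.val : S → Fin N) := by
      ext i j
      rw [hinv]
      simp only [Matrix.sub_apply, Matrix.mul_apply, diagonal_apply_eq, submatrix_apply, cauchy,
        of_apply,
        Finset.univ_unique, Finset.sum_singleton, x']
      have := hb i; have := hb j
      field_simp
      ring
    rw [hschur, ih x' fun i hi => ?_]
    · rw [Finset.prod_insert hm, alphaSet_insert a S m hm]
      simp only [det_diagonal, Finset.univ_unique, Finset.prod_singleton, hα, x']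
      have : ∀ i, (x i * ((b i - b m) / (b i + b m))) ^ 2 / (2 * b i)
          = x i ^ 2 / (2 * b i) * ((b i - b m) / (b i + b m)) ^ 2 := fun i => by ring
      simp only [this, Finset.prod_mul_distrib]
      ring
    · refine mul_ne_zero (hx i (Finset.mem_insert_of_mem hi)) (div_ne_zero (sub_ne_zero.2 ?_) ?_)
      · intro h; exact hm (hinj h ▸ hi)
      · have := hb i; positivity

/-! ### Derivatives of determinants and inverses -/

/-- Jacobi's formula, from the Leibniz expansion; column `i` of the adjugate product is Cramer's
determinant with that column replaced by its derivative. -/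
theorem hasDerivAt_det {n : Type*} [Fintype n] [DecidableEq n] {K : ℝ → Matrix n n ℝ}
    {K' : Matrix n n ℝ} {t : ℝ} (hK : ∀ i j, HasDerivAt (fun t => K t i j) (K' i j) t) :
    HasDerivAt (fun t => (K t).det) (((K t).adjugate * K').trace) t := by
  have h : HasDerivAt (fun t => ∑ σ : Equiv.Perm n, (Equiv.Perm.sign σ : ℝ) * ∏ i, K t (σ i) i)
      (∑ σ : Equiv.Perm n, (Equiv.Perm.sign σ : ℝ) *
        ∑ i, (∏ j ∈ Finset.univ.erase i, K t (σ j) j) • K' (σ i) i) t :=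
    HasDerivAt.fun_sum fun σ _ =>
      (HasDerivAt.fun_finsetProd fun i _ => hK (σ i) i).const_mul _
  have e : (fun t => (K t).det) = fun t => ∑ σ : Equiv.Perm n, (Equiv.Perm.sign σ : ℝ) *
      ∏ i, K t (σ i) i := by
    funext t; rw [det_apply']
  rw [e]
  refine h.congr_deriv ?_
  simp only [Finset.mul_sum, smul_eq_mul]
  rw [Finset.sum_comm, trace]
  refine Finset.sum_congr rfl fun i _ => ?_
  have : ((K t).adjugate * K') i i = ((K t).updateCol i (fun k => K' k i)).det := by
    rw [← cramer_apply, cramer_eq_adjugate_mulVec]; rfl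
  rw [diag_apply, this, det_apply']
  refine Finset.sum_congr rfl fun σ _ => ?_
  congr 1
  rw [← Finset.mul_prod_erase _ _ (Finset.mem_univ i), mul_comm]
  congr 1
  · simp
  · refine Finset.prod_congr rfl fun j hj => ?_
    rw [updateCol_ne (Finset.ne_of_mem_erase hj)]

/-- Cramer's rule shows that the entries of the inverse are differentiable; differentiating `K K⁻¹ =
1` then identifies the derivative. -/
theorem hasDerivAt_inv_apply {n : Type*} [Fintype n] [DecidableEq n] {K : ℝ → Matrix n n ℝ}
    {K' : Matrix n n ℝ} {t : ℝ} (hK : ∀ i j, HasDerivAt (fun t => K t i j) (K' i j) t)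
    (hdet : ∀ t, (K t).det ≠ 0) (i j : n) :
    HasDerivAt (fun t => (K t)⁻¹ i j) (-((K t)⁻¹ * K' * (K t)⁻¹) i j) t := by
  have hdiff : ∀ i j, ∃ d, HasDerivAt (fun t => (K t)⁻¹ i j) d t := by
    intro i j
    have e : (fun t => (K t)⁻¹ i j)
        = fun t => ((K t).det)⁻¹ * ((K t).updateRow j (Pi.single i 1)).det := by
      funext t
      rw [inv_def, Ring.inverse_eq_inv', Matrix.smul_apply, adjugate_apply, smul_eq_mul]
    rw [e]
    have h1 := (hasDerivAt_det hK).fun_inv (hdet t)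
    have h2 : ∀ k l, HasDerivAt (fun t => (K t).updateRow j (Pi.single i 1) k l)
        ((K').updateRow j 0 k l) t := by
      intro k l
      by_cases hk : k = j
      · subst hk
        simp only [updateRow_self, Pi.zero_apply]
        exact hasDerivAt_const _ _
      · simp only [updateRow_ne hk]; exact hK k l
    exact ⟨_, h1.fun_mul (hasDerivAt_det h2)⟩
  choose D hD using hdiff
  have hprod : (K' * (K t)⁻¹ + K t * of D) = 0 := by
    ext k l
    have h1 : HasDerivAt (fun t => (K t * (K t)⁻¹) k l) ((K' * (K t)⁻¹ + K t * of D) k l) t := by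
      have := HasDerivAt.fun_sum fun m (_ : m ∈ Finset.univ) => (hK k m).fun_mul (hD m l)
      rw [Finset.sum_add_distrib] at this
      exact this
    have h2 : (fun t => (K t * (K t)⁻¹) k l) = fun _ => (1 : Matrix n n ℝ) k l := by
      funext t
      rw [mul_nonsing_inv _ (Ne.isUnit (hdet t))]
    rw [h2] at h1
    exact h1.unique (hasDerivAt_const _ _)
  have hsol : of D = -((K t)⁻¹ * K' * (K t)⁻¹) := by
    have h3 : (K t)⁻¹ * (K' * (K t)⁻¹ + K t * of D) = 0 := by rw [hprod, Matrix.mul_zero]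
    rw [Matrix.mul_add, ← Matrix.mul_assoc, ← Matrix.mul_assoc,
      nonsing_inv_mul _ (Ne.isUnit (hdet t)), Matrix.one_mul] at h3
    exact eq_neg_of_add_eq_zero_right h3
  have := congrFun (congrFun hsol i) j
  rw [← Matrix.neg_apply, ← this]
  exact hD i j

/-! ### Vector identities for the Cauchy matrix -/

section vector

theorem dotProduct_self_nonneg {n : Type*} [Fintype n] (x : n → ℝ) : 0 ≤ x ⬝ᵥ x :=
  Finset.sum_nonneg fun i _ => mul_self_nonneg (x i)

theorem cauchy_transpose {n : Type*} (b v : n → ℝ) : (cauchy b v)ᵀ = cauchy b v := by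
  ext i j
  simp only [transpose_apply, cauchy, of_apply, mul_comm (v j), add_comm (b j)]

variable {n : Type*} [Fintype n]

theorem dot_cauchy_comm (b v x y : n → ℝ) : x ⬝ᵥ cauchy b v *ᵥ y = y ⬝ᵥ cauchy b v *ᵥ x := by
  rw [dotProduct_mulVec, ← mulVec_transpose, cauchy_transpose, dotProduct_comm]

/-- The Lyapunov equation `B A + A B = v vᵀ`. -/
theorem cauchy_lyapunov {b v : n → ℝ} (hb : ∀ i, 0 < b i) (x : n → ℝ) :
    b * (cauchy b v *ᵥ x) + cauchy b v *ᵥ (b * x) = (v ⬝ᵥ x) • v := by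
  ext i
  simp only [Pi.add_apply, Pi.mul_apply, mulVec, dotProduct, cauchy, of_apply, Pi.smul_apply,
    smul_eq_mul, Finset.mul_sum, Finset.sum_mul, ← Finset.sum_add_distrib]
  refine Finset.sum_congr rfl fun j _ => ?_
  have := hb i; have := hb j
  field_simp

/-- The quadratic form of the Lyapunov equation; both terms on its left agree because `A` is
symmetric. -/
theorem dot_mul_cauchy {b v : n → ℝ} (hb : ∀ i, 0 < b i) (x : n → ℝ) :
    2 * (x ⬝ᵥ (b * (cauchy b v *ᵥ x))) = (v ⬝ᵥ x) ^ 2 := by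
  have h := congrArg (fun z => x ⬝ᵥ z) (cauchy_lyapunov (v := v) hb x)
  simp only [dotProduct_add, dotProduct_smul, smul_eq_mul] at h
  have h2 : x ⬝ᵥ cauchy b v *ᵥ (b * x) = x ⬝ᵥ (b * (cauchy b v *ᵥ x)) := by
    rw [dot_cauchy_comm]
    simp only [dotProduct, Pi.mul_apply]
    exact Finset.sum_congr rfl fun i _ => by ring
  rw [h2, dotProduct_comm x v] at h
  linarith

theorem dot_mul_sq_le {b : n → ℝ} {κ : ℝ} (hb : ∀ i, 0 < b i) (hκ : ∀ i, b i ≤ κ) (x : n → ℝ) :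
    (b * x) ⬝ᵥ (b * x) ≤ κ ^ 2 * (x ⬝ᵥ x) := by
  simp only [dotProduct, Finset.mul_sum, Pi.mul_apply]
  refine Finset.sum_le_sum fun i _ => ?_
  have h1 : b i ^ 2 ≤ κ ^ 2 := pow_le_pow_left₀ (hb i).le (hκ i) 2
  nlinarith [mul_nonneg (sub_nonneg.2 h1) (sq_nonneg (x i))]

/-- The second logarithmic derivative `2 w·Bw` of the determinant is at most `κ²`. -/
theorem two_dot_le_sq {b v w m : n → ℝ} {κ : ℝ} (hb : ∀ i, 0 < b i) (hκ : ∀ i, b i ≤ κ)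
    (hw : w + cauchy b v *ᵥ w = v) (hm : m + cauchy b v *ᵥ m = b * w) :
    2 * (w ⬝ᵥ (b * w)) ≤ κ ^ 2 := by
  -- With `K = 1+A` symmetric, `v·K⁻¹Bw = K⁻¹v·Bw = w·Bw`. Put `U = w·Bw`.
  have hvm : v ⬝ᵥ m = w ⬝ᵥ (b * w) := by
    rw [← hm, dotProduct_add, ← dot_cauchy_comm, dotProduct_comm w m, ← dotProduct_add, hw,
      dotProduct_comm]
  have h1 := dot_mul_cauchy (v := v) hb m
  have hA : cauchy b v *ᵥ m = b * w - m := by rw [← hm]; abel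
  rw [hvm, hA] at h1
  -- The Lyapunov identity for `m` now reads `2 m·B(Bw-m) = U²`. Completing the square, `4 m·B(Bw-m)
  -- ≤ Bw·B(Bw) ≤ κ²U`, hence `2U² ≤ κ²U`; it remains to divide by `U`.
  have h2 : 0 ≤ (b * w - (2 : ℝ) • m) ⬝ᵥ (b * (b * w - (2 : ℝ) • m)) := by
    simp only [dotProduct, Pi.mul_apply]
    refine Finset.sum_nonneg fun i _ => ?_
    have := hb i
    nlinarith [mul_nonneg this.le (sq_nonneg ((b * w - (2 : ℝ) • m) i))]
  have h3 : (b * w - (2 : ℝ) • m) ⬝ᵥ (b * (b * w - (2 : ℝ) • m))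
      = (b * w) ⬝ᵥ (b * (b * w)) - 4 * (m ⬝ᵥ (b * (b * w - m))) := by
    simp only [dotProduct, Pi.mul_apply, Pi.sub_apply, Pi.smul_apply, smul_eq_mul, Finset.mul_sum,
      ← Finset.sum_sub_distrib]
    exact Finset.sum_congr rfl fun i _ => by ring
  have h4 : (b * w) ⬝ᵥ (b * (b * w)) ≤ κ ^ 2 * (w ⬝ᵥ (b * w)) := by
    simp only [dotProduct, Pi.mul_apply, Finset.mul_sum]
    refine Finset.sum_le_sum fun i _ => ?_
    have h5 : b i ^ 2 ≤ κ ^ 2 := pow_le_pow_left₀ (hb i).le (hκ i) 2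
    have h6 : 0 ≤ b i * w i ^ 2 := mul_nonneg (hb i).le (sq_nonneg _)
    nlinarith [mul_nonneg (sub_nonneg.2 h5) h6]
  have h5 : 0 ≤ w ⬝ᵥ (b * w) := by
    simp only [dotProduct, Pi.mul_apply]
    exact Finset.sum_nonneg fun i _ => by nlinarith [mul_nonneg (hb i).le (sq_nonneg (w i))]
  rcases h5.eq_or_lt with h | h
  · rw [← h]; nlinarith [sq_nonneg κ]
  · have : 2 * (w ⬝ᵥ (b * w)) * (w ⬝ᵥ (b * w)) ≤ κ ^ 2 * (w ⬝ᵥ (b * w)) := by nlinarith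
    exact le_of_mul_le_mul_right this h

/-- The form equals `∫₀^∞ (∑ x_i v_i e^{-b_i τ})² dτ`. The integral is avoided: its tail `h` from
`τ` on is antitone and tends to zero, so `h 0 ≥ 0`. -/
theorem cauchy_dot_nonneg {b : n → ℝ} (hb : ∀ i, 0 < b i) (v x : n → ℝ) :
    0 ≤ x ⬝ᵥ cauchy b v *ᵥ x := by
  let h : ℝ → ℝ := fun τ => ∑ i, ∑ j, x i * v i * (x j * v j) / (b i + b j) *
    Real.exp (-(b i + b j) * τ)
  have h0 : h 0 = x ⬝ᵥ cauchy b v *ᵥ x := by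
    simp only [h, mul_zero, Real.exp_zero, mul_one, dotProduct, mulVec, cauchy, of_apply,
      Finset.mul_sum]
    exact Finset.sum_congr rfl fun i _ => Finset.sum_congr rfl fun j _ => by ring
  have hd : ∀ τ, HasDerivAt h (-(∑ i, x i * v i * Real.exp (-b i * τ)) ^ 2) τ := by
    intro τ
    have : HasDerivAt h (∑ i, ∑ j, x i * v i * (x j * v j) / (b i + b j) *
        (Real.exp (-(b i + b j) * τ) * (-(b i + b j) * 1))) τ :=
      HasDerivAt.fun_sum fun i _ => HasDerivAt.fun_sum fun j _ =>
        (((hasDerivAt_id τ).const_mul (-(b i + b j))).exp).const_mul _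
    refine this.congr_deriv ?_
    rw [sq, Finset.sum_mul_sum, ← Finset.sum_neg_distrib]
    refine Finset.sum_congr rfl fun i _ => ?_
    rw [← Finset.sum_neg_distrib]
    refine Finset.sum_congr rfl fun j _ => ?_
    have := hb i; have := hb j
    have e : Real.exp (-(b i + b j) * τ) = Real.exp (-b i * τ) * Real.exp (-b j * τ) := by
      rw [← Real.exp_add]; congr 1; ring
    rw [e]
    field_simp
  have hanti : Antitone h := antitone_of_deriv_nonpos (fun τ => (hd τ).differentiableAt)
    fun τ => by rw [(hd τ).deriv]; nlinarith [sq_nonneg (∑ i, x i * v i * Real.exp (-b i * τ))]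
  have hlim : Filter.Tendsto h Filter.atTop (nhds 0) := by
    have : (0 : ℝ) = ∑ i : n, ∑ j : n, x i * v i * (x j * v j) / (b i + b j) * 0 := by simp
    rw [this]
    refine tendsto_finsetSum _ fun i _ => tendsto_finsetSum _ fun j _ =>
      Filter.Tendsto.const_mul _ ?_
    refine Real.tendsto_exp_atBot.comp ?_
    have : -(b i + b j) < 0 := by linarith [hb i, hb j]
    exact Filter.tendsto_id.const_mul_atTop_of_neg this
  rw [← h0]
  exact hanti.le_of_tendsto hlim 0

/-- Since `A ≥ 0`, the inverse of `1+A` is a contraction. -/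
theorem dot_self_le_of_add_cauchy {b : n → ℝ} (hb : ∀ i, 0 < b i) {v x y : n → ℝ}
    (h : y + cauchy b v *ᵥ y = x) : y ⬝ᵥ y ≤ x ⬝ᵥ x := by
  have h1 := cauchy_dot_nonneg hb v y
  have h2 : y ⬝ᵥ x = y ⬝ᵥ y + y ⬝ᵥ cauchy b v *ᵥ y := by rw [← h, dotProduct_add]
  have h3 : 0 ≤ (x - y) ⬝ᵥ (x - y) := dotProduct_self_nonneg _
  have h4 : (x - y) ⬝ᵥ (x - y) = x ⬝ᵥ x - 2 * (y ⬝ᵥ x) + y ⬝ᵥ y := by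
    simp only [sub_dotProduct, dotProduct_sub, dotProduct_comm x y]; ring
  nlinarith

theorem dot_self_add_three_le (x y z : n → ℝ) :
    (x + y + z) ⬝ᵥ (x + y + z) ≤ 3 * (x ⬝ᵥ x) + 3 * (y ⬝ᵥ y) + 3 * (z ⬝ᵥ z) := by
  simp only [dotProduct, Finset.mul_sum, ← Finset.sum_add_distrib, Pi.add_apply]
  refine Finset.sum_le_sum fun i _ => ?_
  nlinarith [sq_nonneg (x i - y i), sq_nonneg (y i - z i), sq_nonneg (x i - z i)]

/-- With `K = 1 + A` and `w = K⁻¹ v`, `g = K⁻¹ B v`, `p = K⁻¹ B² v`, the vectors `g` and `p` are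
bounded by `w`. -/
theorem abs_trace_error_le [DecidableEq n] {b v w g p : n → ℝ} {L : ℝ} (hb : ∀ i, 0 < b i)
    (hκ : ∀ i, b i ≤ L) (hL : 0 < L)
    (hdet : (1 + cauchy b v).det ≠ 0)
    (hw : w + cauchy b v *ᵥ w = v) (hg : g + cauchy b v *ᵥ g = b * v)
    (hp : p + cauchy b v *ᵥ p = b * (b * v)) (hq : |v ⬝ᵥ w| ≤ 2 * L) :
    |2 * (w ⬝ᵥ p) - g ⬝ᵥ g| ≤ 69 * L ^ 2 * (w ⬝ᵥ w) := by
  have hsolve : ∀ x, ∃ y, y + cauchy b v *ᵥ y = x := by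
    intro x
    refine ⟨(1 + cauchy b v)⁻¹ *ᵥ x, ?_⟩
    have : (1 + cauchy b v) *ᵥ ((1 + cauchy b v)⁻¹ *ᵥ x) = x := by
      rw [mulVec_mulVec, mul_nonsing_inv _ (Ne.isUnit hdet), one_mulVec]
    rwa [add_mulVec, one_mulVec] at this
  have huniq : ∀ y z, y + cauchy b v *ᵥ y = z + cauchy b v *ᵥ z → y = z := by
    intro y z hyz
    have h : (1 + cauchy b v) *ᵥ y = (1 + cauchy b v) *ᵥ z := by
      simpa only [add_mulVec, one_mulVec] using hyz
    have := congrArg ((1 + cauchy b v)⁻¹ *ᵥ ·) h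
    simpa [mulVec_mulVec, nonsing_inv_mul _ (Ne.isUnit hdet)] using this
  -- Commuting `B` past the inverse by the Lyapunov equation: `K⁻¹Bz = 2K⁻¹BK⁻¹z - BK⁻¹z +
  -- (v·K⁻¹z)w`. The right side involves only `K⁻¹z` and `w`, not the possibly large `z`; it is used
  -- for `z = v` and `z = Bv`.
  have hrec : ∀ y z m, y + cauchy b v *ᵥ y = z → m + cauchy b v *ᵥ m = b * y →
      ∀ r, r + cauchy b v *ᵥ r = b * z → r = (2 : ℝ) • m + (-1 : ℝ) • (b * y) + (v ⬝ᵥ y) • w := by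
    intro y z m hy hm r hr
    apply huniq
    rw [hr, ← hy]
    simp only [mulVec_add, mulVec_smul]
    have e1 := cauchy_lyapunov (v := v) hb y
    have e2 : cauchy b v *ᵥ (b * y) = (v ⬝ᵥ y) • v - b * (cauchy b v *ᵥ y) := by
      rw [← e1]; abel
    have e3 : cauchy b v *ᵥ m = b * y - m := by rw [← hm]; abel
    have e4 : cauchy b v *ᵥ w = v - w := by
      conv_rhs => rw [← hw]
      abel
    rw [e2, e3, e4]
    ext i
    simp only [Pi.add_apply, Pi.mul_apply, Pi.smul_apply, Pi.sub_apply, smul_eq_mul]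
    ring
  obtain ⟨m, hm⟩ := hsolve (b * w)
  obtain ⟨m', hm'⟩ := hsolve (b * g)
  have eg := hrec w v m hw hm g hg
  have ep := hrec g (b * v) m' hg hm' p hp
  have hW : 0 ≤ w ⬝ᵥ w := dotProduct_self_nonneg _
  have hscale : ∀ (c : ℝ) (x : n → ℝ), (c • x) ⬝ᵥ (c • x) = c ^ 2 * (x ⬝ᵥ x) := by
    intro c x; simp only [smul_dotProduct, dotProduct_smul, smul_eq_mul]; ring
  have hq2 : (v ⬝ᵥ w) ^ 2 ≤ 4 * L ^ 2 := by
    have := pow_le_pow_left₀ (abs_nonneg _) hq 2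
    rw [sq_abs] at this; nlinarith
  -- The three summands have squared norms at most `4L²`, `L²`, `4L²` times `w·w`, and `27 =
  -- 3(4+1+4)`. In the same way `432 = 3(4·27+27+9)` for `p` below; finally `432 ≤ 21²` and `69 =
  -- 2·21+27`.
  have hG : g ⬝ᵥ g ≤ 27 * L ^ 2 * (w ⬝ᵥ w) := by
    have h1 := dot_self_add_three_le ((2 : ℝ) • m) ((-1 : ℝ) • (b * w)) ((v ⬝ᵥ w) • w)
    rw [← eg, hscale, hscale, hscale] at h1
    have h2 := dot_self_le_of_add_cauchy hb hm
    have h3 := dot_mul_sq_le hb hκ w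
    nlinarith [mul_le_mul_of_nonneg_right hq2 hW]
  have hvg : v ⬝ᵥ g = w ⬝ᵥ (b * w) + (v ⬝ᵥ w) ^ 2 / 2 := by
    have h1 : v ⬝ᵥ g = w ⬝ᵥ (b * v) := by
      rw [← hg, dotProduct_add, ← dot_cauchy_comm, dotProduct_comm w g, ← dotProduct_add, hw,
        dotProduct_comm]
    have h2 := dot_mul_cauchy (v := v) hb w
    have h3 : w ⬝ᵥ (b * v) = w ⬝ᵥ (b * w) + w ⬝ᵥ (b * (cauchy b v *ᵥ w)) := by
      conv_lhs => rw [← hw, mul_add, dotProduct_add]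
    rw [h1, h3]; linarith
  have hU := two_dot_le_sq hb hκ hw hm
  have hU0 : 0 ≤ w ⬝ᵥ (b * w) := by
    simp only [dotProduct, Pi.mul_apply]
    exact Finset.sum_nonneg fun i _ => by nlinarith [mul_nonneg (hb i).le (sq_nonneg (w i))]
  have hvg2 : (v ⬝ᵥ g) ^ 2 ≤ 9 * L ^ 4 := by
    have h1 : 0 ≤ v ⬝ᵥ g := by rw [hvg]; positivity
    have h2 : v ⬝ᵥ g ≤ 3 * L ^ 2 := by rw [hvg]; nlinarith
    have := pow_le_pow_left₀ h1 h2 2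
    nlinarith
  have hP : p ⬝ᵥ p ≤ 432 * L ^ 4 * (w ⬝ᵥ w) := by
    have h1 := dot_self_add_three_le ((2 : ℝ) • m') ((-1 : ℝ) • (b * g)) ((v ⬝ᵥ g) • w)
    rw [← ep, hscale, hscale, hscale] at h1
    have h2 := dot_self_le_of_add_cauchy hb hm'
    have h3 := dot_mul_sq_le hb hκ g
    have h4 : L ^ 2 * (g ⬝ᵥ g) ≤ L ^ 2 * (27 * L ^ 2 * (w ⬝ᵥ w)) :=
      mul_le_mul_of_nonneg_left hG (sq_nonneg L)
    nlinarith [mul_le_mul_of_nonneg_right hvg2 hW]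
  have hcs : (w ⬝ᵥ p) ^ 2 ≤ (w ⬝ᵥ w) * (p ⬝ᵥ p) := by
    have := Finset.sum_mul_sq_le_sq_mul_sq Finset.univ w p
    simpa only [dotProduct, sq] using this
  have hwp : |w ⬝ᵥ p| ≤ 21 * L ^ 2 * (w ⬝ᵥ w) := by
    refine abs_le_of_sq_le_sq ?_ (by positivity)
    have : (w ⬝ᵥ w) * (p ⬝ᵥ p) ≤ (w ⬝ᵥ w) * (432 * L ^ 4 * (w ⬝ᵥ w)) :=
      mul_le_mul_of_nonneg_left hP hW
    have h0 : 0 ≤ L ^ 4 * (w ⬝ᵥ w) ^ 2 := by positivity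
    nlinarith
  have hG0 : 0 ≤ g ⬝ᵥ g := dotProduct_self_nonneg _
  rw [abs_le] at hwp ⊢
  constructor <;> linarith

end vector

end

end KdVSoliton

/-! ### The resolvent along curves and the bound on the elevation -/

namespace KdVSoliton

noncomputable section

open Matrix

section curve

variable {n : Type*} [Fintype n] [DecidableEq n]

/-- The matrix `(1 + A)⁻¹` of the Cauchy matrix `A`. -/
def resolvent (b v : n → ℝ) : Matrix n n ℝ := (1 + cauchy b v)⁻¹

theorem resolvent_transpose (b v : n → ℝ) : (resolvent b v)ᵀ = resolvent b v := by
  rw [resolvent, transpose_nonsing_inv, transpose_add, transpose_one, cauchy_transpose]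

theorem resolvent_spec {b v : n → ℝ} (hdet : (1 + cauchy b v).det ≠ 0) (x : n → ℝ) :
    resolvent b v *ᵥ x + cauchy b v *ᵥ (resolvent b v *ᵥ x) = x := by
  have : (1 + cauchy b v) *ᵥ ((1 + cauchy b v)⁻¹ *ᵥ x) = x := by
    rw [mulVec_mulVec, mul_nonsing_inv _ (Ne.isUnit hdet), one_mulVec]
  rwa [add_mulVec, one_mulVec] at this

theorem resolvent_mul_vecMulVec_mul (b v x y : n → ℝ) :
    resolvent b v * vecMulVec x y * resolvent b v
      = vecMulVec (resolvent b v *ᵥ x) (resolvent b v *ᵥ y) := by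
  rw [mul_vecMulVec, vecMulVec_mul]
  congr 1
  rw [← mulVec_transpose, resolvent_transpose]

theorem trace_resolvent_mul_vecMulVec (b v x y : n → ℝ) :
    (resolvent b v * vecMulVec x y).trace = (resolvent b v *ᵥ x) ⬝ᵥ y := by
  rw [mul_vecMulVec, trace_vecMulVec]

theorem hasDerivAt_one_add_cauchy {n : Type*} [DecidableEq n] {b : n → ℝ} {v : ℝ → n → ℝ}
    {d : n → ℝ} {t : ℝ} (hv : ∀ i, HasDerivAt (fun t => v t i) (d i * v t i) t) (i j : n) :
    HasDerivAt (fun t => (1 + cauchy b (v t)) i j)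
      ((d i + d j) * (v t i * v t j) / (b i + b j)) t := by
  have h := (((hv i).fun_mul (hv j)).div_const (b i + b j)).const_add ((1 : Matrix n n ℝ) i j)
  refine h.congr_deriv ?_
  ring

/-- When each `v_i` decays at rate `b_i`, the factor `b_i+b_j` cancels and the matrix changes by
`-vvᵀ`, of rank one; Jacobi's formula then has a single term. -/
theorem hasDerivAt_log_det_cauchy {b : n → ℝ} {v : ℝ → n → ℝ} {t : ℝ} (hb : ∀ i, 0 < b i)
    (hv : ∀ i, HasDerivAt (fun t => v t i) (-b i * v t i) t)
    (hdet : ∀ t, (1 + cauchy b (v t)).det ≠ 0) :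
    HasDerivAt (fun t => Real.log (1 + cauchy b (v t)).det)
      (-(v t ⬝ᵥ resolvent b (v t) *ᵥ v t)) t := by
  have h1 : ∀ i j, HasDerivAt (fun t => (1 + cauchy b (v t)) i j)
      ((-vecMulVec (v t) (v t)) i j) t := fun i j => by
    refine (hasDerivAt_one_add_cauchy (b := b) hv i j).congr_deriv ?_
    rw [Matrix.neg_apply, vecMulVec_apply]
    have := hb i; have := hb j
    field_simp
    ring
  refine ((hasDerivAt_det h1).log (hdet t)).congr_deriv ?_
  have h2 : (1 + cauchy b (v t)).adjugate = (1 + cauchy b (v t)).det • resolvent b (v t) := by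
    rw [resolvent, inv_def, Ring.inverse_eq_inv', smul_smul, mul_inv_cancel₀ (hdet t), one_smul]
  rw [h2, smul_mul_assoc, Matrix.mul_neg, smul_neg, trace_neg, trace_smul,
    trace_resolvent_mul_vecMulVec, smul_eq_mul, neg_div, mul_div_cancel_left₀ _ (hdet t),
    dotProduct_comm]

/-- The rank-one change gives `(K⁻¹)' = wwᵀ`, so the derivative is `-2w·Bv + (v·w)²`. Inserting `v =
w + Aw`, the Lyapunov identity cancels `(v·w)²`. -/
theorem hasDerivAt_dot_resolvent {b : n → ℝ} {v : ℝ → n → ℝ} {t : ℝ} (hb : ∀ i, 0 < b i)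
    (hv : ∀ i, HasDerivAt (fun t => v t i) (-b i * v t i) t)
    (hdet : ∀ t, (1 + cauchy b (v t)).det ≠ 0) :
    HasDerivAt (fun t => v t ⬝ᵥ resolvent b (v t) *ᵥ v t)
      (-(2 * ((resolvent b (v t) *ᵥ v t) ⬝ᵥ (b * (resolvent b (v t) *ᵥ v t))))) t := by
  set w := resolvent b (v t) *ᵥ v t with hw
  have h1 : ∀ i j, HasDerivAt (fun t => (1 + cauchy b (v t)) i j)
      ((-vecMulVec (v t) (v t)) i j) t := fun i j => by
    refine (hasDerivAt_one_add_cauchy (b := b) hv i j).congr_deriv ?_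
    rw [Matrix.neg_apply, vecMulVec_apply]
    have := hb i; have := hb j
    field_simp
    ring
  have h2 : ∀ i j, HasDerivAt (fun t => resolvent b (v t) i j) (w i * w j) t := fun i j => by
    refine (hasDerivAt_inv_apply h1 hdet i j).congr_deriv ?_
    change -((resolvent b (v t) * -vecMulVec (v t) (v t) * resolvent b (v t)) i j) = _
    rw [Matrix.mul_neg, Matrix.neg_mul, Matrix.neg_apply, neg_neg, resolvent_mul_vecMulVec_mul,
      vecMulVec_apply]
  have h3 : HasDerivAt (fun t => v t ⬝ᵥ resolvent b (v t) *ᵥ v t)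
      (∑ i, (-b i * v t i * (∑ j, resolvent b (v t) i j * v t j)
        + v t i * (∑ j, (w i * w j * v t j + resolvent b (v t) i j * (-b j * v t j))))) t :=
    HasDerivAt.fun_sum fun i _ => (hv i).fun_mul
      (HasDerivAt.fun_sum fun j _ => (h2 i j).fun_mul (hv j))
  refine h3.congr_deriv ?_
  have hspec := resolvent_spec (hdet t) (v t)
  rw [← hw] at hspec
  have e0 : ∀ i, ∑ j, resolvent b (v t) i j * v t j = w i := fun i => rfl
  have e1 : (∑ i, (-b i * v t i * (∑ j, resolvent b (v t) i j * v t j)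
        + v t i * (∑ j, (w i * w j * v t j + resolvent b (v t) i j * (-b j * v t j)))))
      = -(w ⬝ᵥ (b * v t)) + (v t ⬝ᵥ w) ^ 2 - v t ⬝ᵥ resolvent b (v t) *ᵥ (b * v t) := by
    simp only [e0, Finset.sum_add_distrib, mul_add]
    rw [← add_assoc, sub_eq_add_neg]
    congr 1
    · congr 1
      · simp only [dotProduct, ← Finset.sum_neg_distrib, Pi.mul_apply]
        exact Finset.sum_congr rfl fun i _ => by ring
      · rw [dotProduct, sq, Finset.sum_mul_sum]
        simp only [Finset.mul_sum]
        exact Finset.sum_congr rfl fun i _ => Finset.sum_congr rfl fun j _ => by ring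
    · simp only [dotProduct, mulVec, ← Finset.sum_neg_distrib, Pi.mul_apply, Finset.mul_sum]
      exact Finset.sum_congr rfl fun i _ => Finset.sum_congr rfl fun j _ => by ring
  have e2 : v t ⬝ᵥ resolvent b (v t) *ᵥ (b * v t) = w ⬝ᵥ (b * v t) := by
    rw [dotProduct_mulVec, ← mulVec_transpose, resolvent_transpose]
  have e3 := dot_mul_cauchy (v := v t) hb w
  have e4 : w ⬝ᵥ (b * v t) = w ⬝ᵥ (b * w) + w ⬝ᵥ (b * (cauchy b (v t) *ᵥ w)) := by
    rw [← dotProduct_add, ← mul_add, hspec]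
  rw [e1, e2, e4]
  linarith

/-- These growth rates occur along particle paths, where the soliton speeds are affine in `β²`. The
quotient `(b_i³+b_j³)/(b_i+b_j) = b_i² - b_i b_j + b_j²` turns the derivative of the matrix into a
combination of rank-one matrices. -/
theorem hasDerivAt_trace_resolvent {b : n → ℝ} {v : ℝ → n → ℝ} {t e k : ℝ} (hb : ∀ i, 0 < b i)
    (hv : ∀ i, HasDerivAt (fun t => v t i) (b i * (e + k * b i ^ 2) * v t i) t)
    (hdet : ∀ t, (1 + cauchy b (v t)).det ≠ 0) :
    HasDerivAt (fun t => (resolvent b (v t)).trace)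
      (-(e * ((resolvent b (v t) *ᵥ v t) ⬝ᵥ (resolvent b (v t) *ᵥ v t))
        + k * (2 * ((resolvent b (v t) *ᵥ v t) ⬝ᵥ (resolvent b (v t) *ᵥ (b * (b * v t))))
          - (resolvent b (v t) *ᵥ (b * v t)) ⬝ᵥ (resolvent b (v t) *ᵥ (b * v t))))) t := by
  let K' : Matrix n n ℝ := e • vecMulVec (v t) (v t) + k • (vecMulVec (v t) (b * (b * v t))
    + vecMulVec (b * (b * v t)) (v t) - vecMulVec (b * v t) (b * v t))
  have h1 : ∀ i j, HasDerivAt (fun t => (1 + cauchy b (v t)) i j) (K' i j) t := fun i j => by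
    refine (hasDerivAt_one_add_cauchy (b := b) hv i j).congr_deriv ?_
    simp only [K', Matrix.add_apply, Matrix.smul_apply, Matrix.sub_apply, vecMulVec_apply,
      smul_eq_mul, Pi.mul_apply]
    have := hb i; have := hb j
    field_simp
    ring
  have h2 : HasDerivAt (fun t => (resolvent b (v t)).trace)
      (∑ i, -((resolvent b (v t) * K' * resolvent b (v t)) i i)) t :=
    HasDerivAt.fun_sum fun i _ => hasDerivAt_inv_apply h1 hdet i i
  refine h2.congr_deriv ?_
  rw [Finset.sum_neg_distrib]
  change -(resolvent b (v t) * K' * resolvent b (v t)).trace = _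
  simp only [K', Matrix.mul_add, Matrix.add_mul, Matrix.mul_sub, Matrix.sub_mul, Matrix.mul_smul,
    Matrix.smul_mul, resolvent_mul_vecMulVec_mul, trace_add, trace_sub, trace_smul,
    trace_vecMulVec, smul_eq_mul]
  rw [dotProduct_comm (resolvent b (v t) *ᵥ (b * (b * v t)))]
  ring

/-- `A ≥ 0` puts the diagonal entries of `(1+A)⁻¹` between zero and one. -/
theorem trace_resolvent_bounds {b v : n → ℝ} (hb : ∀ i, 0 < b i)
    (hdet : (1 + cauchy b v).det ≠ 0) :
    0 ≤ (resolvent b v).trace ∧ (resolvent b v).trace ≤ Fintype.card n := by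
  have key : ∀ i, 0 ≤ resolvent b v i i ∧ resolvent b v i i ≤ 1 := by
    intro i
    set z := resolvent b v *ᵥ Pi.single i 1 with hz
    have hspec := resolvent_spec hdet (Pi.single i (1 : ℝ))
    rw [← hz] at hspec
    have hzi : z i = resolvent b v i i := by rw [hz, mulVec_single_one]; rfl
    have h1 := dot_self_le_of_add_cauchy hb hspec
    have h2 := cauchy_dot_nonneg hb v z
    have h3 : z ⬝ᵥ Pi.single i 1 = z ⬝ᵥ z + z ⬝ᵥ cauchy b v *ᵥ z := by
      rw [← hspec, dotProduct_add]
    have h4 : z ⬝ᵥ Pi.single i 1 = z i := by simp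
    have h5 := dotProduct_self_nonneg z
    have h6 : z i ^ 2 ≤ z ⬝ᵥ z := by
      rw [dotProduct, sq]
      exact Finset.single_le_sum (f := fun i => z i * z i) (fun j _ => mul_self_nonneg (z j))
        (Finset.mem_univ i)
    have h7 : (Pi.single i (1 : ℝ)) ⬝ᵥ Pi.single i 1 = (1 : ℝ) := by simp
    rw [← hzi]
    constructor
    · linarith
    · nlinarith
  constructor
  · exact Finset.sum_nonneg fun i _ => (key i).1
  · calc (resolvent b v).trace ≤ ∑ _i : n, (1 : ℝ) := Finset.sum_le_sum fun i _ => (key i).2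
      _ = _ := by simp

end curve

/-! ### The soliton matrix -/

variable {N : ℕ}

/-- The inverse widths of the solitons. -/
def betaVec (h₀ : ℝ) (a : Fin N → ℝ) : Fin N → ℝ := fun i => beta h₀ (a i)

/-- The vector that generates the soliton matrix. -/
def solVec (g h₀ : ℝ) (a s : Fin N → ℝ) (x t : ℝ) : Fin N → ℝ := fun i =>
  √(2 * beta h₀ (a i)) * Real.exp (-phase g h₀ a s i x t)

/-- The resolvent applied to the generating vector. -/
def solW (g h₀ : ℝ) (a s : Fin N → ℝ) (x t : ℝ) : Fin N → ℝ :=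
  resolvent (betaVec h₀ a) (solVec g h₀ a s x t) *ᵥ solVec g h₀ a s x t

theorem betaVec_pos {h₀ : ℝ} {a : Fin N → ℝ} (h : 0 < h₀) (ha : ∀ i, 0 < a i) (i : Fin N) :
    0 < betaVec h₀ a i := beta_pos h (ha i)

theorem beta_eq {h₀ : ℝ} (h : 0 < h₀) (p : ℝ) : beta h₀ p = √(3 / (4 * h₀ ^ 3)) * √p := by
  rw [beta, ← Real.sqrt_mul (by positivity)]; congr 1; ring

theorem alpha_eq_beta {h₀ : ℝ} (h : 0 < h₀) (p q : ℝ) :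
    alpha p q = ((beta h₀ p - beta h₀ q) / (beta h₀ p + beta h₀ q)) ^ 2 := by
  have h1 : 0 < √(3 / (4 * h₀ ^ 3)) := Real.sqrt_pos.2 (by positivity)
  rw [beta_eq h, beta_eq h, ← mul_sub, ← mul_add, mul_div_mul_left _ _ h1.ne', alpha]

theorem beta_injective {h₀ : ℝ} (h : 0 < h₀) {a : Fin N → ℝ} (ha : ∀ i, 0 < a i)
    (hinj : Function.Injective a) : Function.Injective (betaVec h₀ a) := by
  intro i j hij
  have h1 : 0 < √(3 / (4 * h₀ ^ 3)) := Real.sqrt_pos.2 (by positivity)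
  simp only [betaVec, beta_eq h] at hij
  have := mul_left_cancel₀ h1.ne' hij
  rw [Real.sqrt_inj (ha i).le (ha j).le] at this
  exact hinj this

/-- The term of `T` in Hirota's sum is the principal minor of `A` on `T`; the factor `√(2β_i)` in
`solVec` cancels the diagonal denominators `2β_i`. -/
theorem sum_weight_eq_det {g h₀ : ℝ} {a : Fin N → ℝ} (h : 0 < h₀) (ha : ∀ i, 0 < a i)
    (hinj : Function.Injective a) (s : Fin N → ℝ) (x t : ℝ) :
    ∑ T, weight g h₀ a s x t T
      = (1 + cauchy (betaVec h₀ a) (solVec g h₀ a s x t)).det := by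
  rw [det_one_add_eq_sum_minors]
  refine Finset.sum_congr rfl fun T _ => ?_
  have hv : ∀ i, 0 < solVec g h₀ a s x t i := fun i =>
    mul_pos (Real.sqrt_pos.2 (mul_pos two_pos (beta_pos h (ha i)))) (Real.exp_pos _)
  rw [det_cauchy (a := a) (betaVec_pos h ha) (beta_injective h ha hinj)
    (fun i j => alpha_eq_beta h (a i) (a j)) T _ fun i _ => (hv i).ne', weight, mul_comm,
    Finset.mul_sum, Real.exp_sum]
  congr 1
  refine Finset.prod_congr rfl fun i _ => ?_
  have hb := beta_pos h (ha i)
  rw [solVec, betaVec, mul_pow, Real.sq_sqrt (by positivity), mul_div_cancel_left₀ _ (by positivity),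
    ← Real.exp_nat_mul]
  congr 1; push_cast; ring

theorem det_soliton_pos {g h₀ : ℝ} {a : Fin N → ℝ} (h : 0 < h₀) (ha : ∀ i, 0 < a i)
    (hinj : Function.Injective a) (s : Fin N → ℝ) (x t : ℝ) :
    0 < (1 + cauchy (betaVec h₀ a) (solVec g h₀ a s x t)).det := by
  rw [← sum_weight_eq_det h ha hinj]; exact sum_weight_pos ha hinj s x t

theorem hasDerivAt_solVec (g h₀ : ℝ) (a s : Fin N → ℝ) (x t : ℝ) (i : Fin N) :
    HasDerivAt (fun x => solVec g h₀ a s x t i)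
      (-betaVec h₀ a i * solVec g h₀ a s x t i) x := by
  have := (hasDerivAt_phase g h₀ a s i x t).fun_neg.exp.const_mul (√(2 * beta h₀ (a i)))
  refine this.congr_deriv ?_
  simp only [solVec, betaVec]; ring

theorem slope_eq {g h₀ : ℝ} {a : Fin N → ℝ} (h : 0 < h₀) (ha : ∀ i, 0 < a i)
    (hinj : Function.Injective a) (s : Fin N → ℝ) (x t : ℝ) :
    slope g h₀ a s x t = solVec g h₀ a s x t ⬝ᵥ solW g h₀ a s x t := by
  have h1 := hasDerivAt_log_sum_weight (g := g) (h₀ := h₀) ha hinj s x t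
  simp only [sum_weight_eq_det h ha hinj] at h1
  have h2 := hasDerivAt_log_det_cauchy (betaVec_pos h ha)
    (fun i => hasDerivAt_solVec g h₀ a s x t i) (fun x => (det_soliton_pos h ha hinj s x t).ne')
  exact neg_injective (h1.unique h2)

theorem curv_eq {g h₀ : ℝ} {a : Fin N → ℝ} (h : 0 < h₀) (ha : ∀ i, 0 < a i)
    (hinj : Function.Injective a) (s : Fin N → ℝ) (x t : ℝ) :
    curv g h₀ a s x t
      = 2 * (solW g h₀ a s x t ⬝ᵥ (betaVec h₀ a * solW g h₀ a s x t)) := by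
  have h1 := hasDerivAt_slope (g := g) (h₀ := h₀) ha hinj s x t
  simp only [slope_eq h ha hinj] at h1
  have h2 := hasDerivAt_dot_resolvent (betaVec_pos h ha)
    (fun i => hasDerivAt_solVec g h₀ a s x t i) (fun x => (det_soliton_pos h ha hinj s x t).ne')
  exact neg_injective (h1.unique h2)

theorem curv_le {g h₀ κ : ℝ} {a : Fin N → ℝ} (h : 0 < h₀) (ha : ∀ i, 0 < a i)
    (hinj : Function.Injective a) (s : Fin N → ℝ) (x t : ℝ) (hκ : ∀ i, beta h₀ (a i) ≤ κ) :
    curv g h₀ a s x t ≤ κ ^ 2 := by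
  rw [curv_eq h ha hinj]
  have hdet := (det_soliton_pos (g := g) h ha hinj s x t).ne'
  exact two_dot_le_sq (betaVec_pos h ha) hκ (resolvent_spec hdet _) (resolvent_spec hdet _)

theorem beta_le_beta {h₀ p q : ℝ} (h : 0 < h₀) (hpq : p ≤ q) : beta h₀ p ≤ beta h₀ q := by
  rw [beta_eq h, beta_eq h]; gcongr

theorem beta_sq {h₀ p : ℝ} (h : 0 < h₀) (hp : 0 ≤ p) : beta h₀ p ^ 2 = 3 * p / (4 * h₀ ^ 3) := by
  rw [beta, Real.sq_sqrt (by positivity)]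

theorem le_iSup_amplitude (a : Fin N → ℝ) (i : Fin N) : a i ≤ ⨆ i, a i :=
  le_ciSup (Set.finite_range a).bddAbove i

theorem iSup_amplitude_pos {a : Fin N → ℝ} (hN : 1 ≤ N) (ha : ∀ i, 0 < a i) : 0 < ⨆ i, a i :=
  (ha ⟨0, hN⟩).trans_le (le_iSup_amplitude a _)

/-- The surface elevation is at most the largest amplitude. -/
theorem eta_le {g h₀ : ℝ} {a : Fin N → ℝ} (hN : 1 ≤ N) (h : 0 < h₀) (ha : ∀ i, 0 < a i)
    (hinj : Function.Injective a) (s : Fin N → ℝ) (x t : ℝ) :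
    eta g h₀ a s x t ≤ ⨆ i, a i := by
  have hA := iSup_amplitude_pos hN ha
  have h1 := curv_le (g := g) h ha hinj s x t
    (fun i => beta_le_beta h (le_iSup_amplitude a i))
  rw [beta_sq h hA.le] at h1
  rw [eta_eq ha hinj]
  calc 4 * h₀ ^ 3 / 3 * curv g h₀ a s x t
      ≤ 4 * h₀ ^ 3 / 3 * (3 * (⨆ i, a i) / (4 * h₀ ^ 3)) := by gcongr
    _ = _ := by field_simp

end

end KdVSoliton

/-! ### Velocity bounds in the strip, speed of the solitons, invariance of the bed -/

namespace KdVSoliton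

noncomputable section

variable {N : ℕ}

theorem velFactor_pos {g h₀ : ℝ} (hg : 0 < g) (h : 0 < h₀) : 0 < velFactor g h₀ :=
  mul_pos (Real.sqrt_pos.2 (by positivity)) (by positivity)

/-- The continued elevation has no pole in the strip `|y| ∑ β_i ≤ π/4`. -/
theorem expSum_ne_zero {g h₀ : ℝ} {a : Fin N → ℝ} (ha : ∀ i, 0 < a i)
    (hinj : Function.Injective a) (s : Fin N → ℝ) (x t : ℝ) {y : ℝ}
    (hy : (∑ i, beta h₀ (a i)) * |y| ≤ Real.pi / 4) :
    expSum (weight g h₀ a s x t) (freq h₀ a) y ≠ 0 := by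
  have h1 := normSq_expSum_ge (weight g h₀ a s x t) (freq h₀ a) y _ (weight_pos ha hinj s x t)
    (freq_bounds a) hy
  have h2 := sum_weight_pos (g := g) (h₀ := h₀) ha hinj s x t
  intro h
  rw [h, map_zero] at h1
  have : 0 < (∑ T, weight g h₀ a s x t T) ^ 2 / 2 := by positivity
  linarith

theorem velU_pos {g h₀ : ℝ} {a : Fin N → ℝ} (hN : 1 ≤ N) (hg : 0 < g) (h : 0 < h₀)
    (ha : ∀ i, 0 < a i) (hinj : Function.Injective a) (s : Fin N → ℝ) (x t : ℝ) {y : ℝ}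
    (hy : (∑ i, beta h₀ (a i)) * |y| ≤ Real.pi / 4) : 0 < velU g h₀ a s x y t := by
  have hne := expSum_ne_zero (g := g) ha hinj s x t hy
  rw [velU_eq _ _ _ _ _ _ _ hne, re_expNum_div]
  refine mul_pos (velFactor_pos hg h) (div_pos (quadCos_pos _ _ _ (weight_pos ha hinj s x t) ?_ ?_)
    (pow_pos (Complex.normSq_pos.2 hne) 2))
  · intro S T
    rw [abs_mul]
    have h1 : |freq h₀ a S - freq h₀ a T| ≤ 2 * ∑ i, beta h₀ (a i) := by
      rw [abs_le]
      constructor <;> linarith [(freq_bounds (h₀ := h₀) a S).1, (freq_bounds (h₀ := h₀) a S).2,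
        (freq_bounds (h₀ := h₀) a T).1, (freq_bounds (h₀ := h₀) a T).2]
    calc _ ≤ 2 * (∑ i, beta h₀ (a i)) * |y| := by gcongr
      _ ≤ _ := by linarith
  · refine ⟨{⟨0, hN⟩}, ∅, ?_⟩
    have := beta_pos h (ha ⟨0, hN⟩)
    simp only [freq, Finset.sum_singleton, Finset.sum_empty]
    positivity

theorem abs_velU_le {g h₀ : ℝ} {a : Fin N → ℝ} (hg : 0 < g) (h : 0 < h₀)
    (ha : ∀ i, 0 < a i) (hinj : Function.Injective a) (s : Fin N → ℝ) (x t : ℝ) {y : ℝ}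
    (hy : (∑ i, beta h₀ (a i)) * |y| ≤ Real.pi / 4) :
    |velU g h₀ a s x y t| ≤ velFactor g h₀ * (2 * curv g h₀ a s x t) := by
  have hne := expSum_ne_zero (g := g) ha hinj s x t hy
  have hf := velFactor_pos hg h
  rw [velU_eq _ _ _ _ _ _ _ hne, abs_mul, abs_of_pos hf]
  refine mul_le_mul_of_nonneg_left ((Complex.abs_re_le_norm _).trans ?_) hf.le
  exact norm_expNum_div_le _ _ _ _ (weight_pos ha hinj s x t) (freq_bounds a) hy

theorem abs_velV_le {g h₀ : ℝ} {a : Fin N → ℝ} (hg : 0 < g) (h : 0 < h₀)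
    (ha : ∀ i, 0 < a i) (hinj : Function.Injective a) (s : Fin N → ℝ) (x t : ℝ) {y : ℝ}
    (hy : (∑ i, beta h₀ (a i)) * |y| ≤ Real.pi / 4) :
    |velV g h₀ a s x y t|
      ≤ velFactor g h₀ * (16 * (∑ i, beta h₀ (a i)) * |y| * curv g h₀ a s x t) := by
  have hne := expSum_ne_zero (g := g) ha hinj s x t hy
  have hf := velFactor_pos hg h
  rw [velV_eq _ _ _ _ _ _ _ hne, abs_neg, abs_mul, abs_of_pos hf]
  refine mul_le_mul_of_nonneg_left ?_ hf.le
  exact abs_im_expNum_div_le _ _ _ _ (weight_pos ha hinj s x t) (freq_bounds a) hy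

theorem velV_bed {g h₀ : ℝ} {a : Fin N → ℝ} (hg : 0 < g) (h : 0 < h₀)
    (ha : ∀ i, 0 < a i) (hinj : Function.Injective a) (s : Fin N → ℝ) (x t : ℝ) :
    velV g h₀ a s x 0 t = 0 := by
  have := abs_velV_le hg h ha hinj s x t (y := 0) (by
    rw [abs_zero, mul_zero]; linarith [Real.pi_pos])
  rw [abs_zero, mul_zero, zero_mul, mul_zero] at this
  exact abs_nonpos_iff.1 this

theorem velFactor_mul_curv_le {g h₀ : ℝ} {a : Fin N → ℝ} (hN : 1 ≤ N) (h : 0 < h₀)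
    (ha : ∀ i, 0 < a i) (hinj : Function.Injective a) (s : Fin N → ℝ) (x t : ℝ) :
    velFactor g h₀ * curv g h₀ a s x t ≤ √(g / h₀) * ⨆ i, a i := by
  have := eta_le (g := g) hN h ha hinj s x t
  rw [eta_eq ha hinj] at this
  rw [velFactor, mul_assoc]
  exact mul_le_mul_of_nonneg_left this (Real.sqrt_nonneg _)

theorem velU_le {g h₀ : ℝ} {a : Fin N → ℝ} (hN : 1 ≤ N) (hg : 0 < g) (h : 0 < h₀)
    (ha : ∀ i, 0 < a i) (hinj : Function.Injective a) (s : Fin N → ℝ) (x t : ℝ) {y : ℝ}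
    (hy : (∑ i, beta h₀ (a i)) * |y| ≤ Real.pi / 4) :
    velU g h₀ a s x y t ≤ 2 * (√(g / h₀) * ⨆ i, a i) := by
  have h1 := (le_abs_self _).trans (abs_velU_le hg h ha hinj s x t hy)
  have h2 := velFactor_mul_curv_le (g := g) hN h ha hinj s x t
  linarith

theorem sqrt_mul_eq {g h₀ : ℝ} (hg : 0 < g) (h : 0 < h₀) : √(g * h₀) = √(g / h₀) * h₀ := by
  have : g * h₀ = g / h₀ * h₀ ^ 2 := by field_simp
  rw [this, Real.sqrt_mul (by positivity), Real.sqrt_sq h.le]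

/-- If `a ≥ h₀/2`, then the largest soliton alone gives `((h₀+a)β)² ≥ (3/2)²·(3/8) = 27/32`, more
than `0.8² > (π/4)²`. The inequality makes the margin `h₀ - 2a` between soliton and particle speeds
positive. -/
theorem iSup_amplitude_lt {h₀ : ℝ} {a : Fin N → ℝ} (hN : 1 ≤ N) (h : 0 < h₀)
    (ha : ∀ i, 0 < a i) (hs : SmallAmplitude h₀ a) : 2 * (⨆ i, a i) < h₀ := by
  have : Nonempty (Fin N) := ⟨⟨0, hN⟩⟩
  obtain ⟨i, hi⟩ := exists_eq_ciSup_of_finite (f := a)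
  rw [SmallAmplitude, ← hi] at hs
  rw [← hi]
  have hai := ha i
  by_contra hcon
  push Not at hcon
  have h1 : beta h₀ (a i) ≤ ∑ i, beta h₀ (a i) :=
    Finset.single_le_sum (f := fun i => beta h₀ (a i)) (fun j _ => Real.sqrt_nonneg _)
      (Finset.mem_univ i)
  have h2 : (h₀ + a i) * beta h₀ (a i) ≤ Real.pi / 4 :=
    (mul_le_mul_of_nonneg_left h1 (by positivity)).trans hs
  have h3 : ((h₀ + a i) * beta h₀ (a i)) ^ 2 ≤ (0.8 : ℝ) ^ 2 := by
    refine pow_le_pow_left₀ (by have := beta_pos h hai; positivity) (h2.trans ?_) 2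
    linarith [Real.pi_lt_d2]
  rw [mul_pow, beta_sq h hai.le] at h3
  have h4 : (h₀ + a i) ^ 2 * (3 * a i / (4 * h₀ ^ 3))
      ≥ (3 / 2 * h₀) ^ 2 * (3 * (h₀ / 2) / (4 * h₀ ^ 3)) := by
    gcongr
    · linarith
    · linarith
  have h5 : (3 / 2 * h₀) ^ 2 * (3 * (h₀ / 2) / (4 * h₀ ^ 3)) = 27 / 32 := by field_simp; norm_num
  rw [h5] at h4
  norm_num at h3
  linarith

/-- Solitons are faster than particles. -/
theorem velU_add_lt_speed {g h₀ : ℝ} {a : Fin N → ℝ} (hN : 1 ≤ N) (hg : 0 < g) (h : 0 < h₀)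
    (ha : ∀ i, 0 < a i) (hinj : Function.Injective a)
    (s : Fin N → ℝ) (x t : ℝ) {y : ℝ} (hy : (∑ i, beta h₀ (a i)) * |y| ≤ Real.pi / 4) (i : Fin N) :
    velU g h₀ a s x y t + √(g / h₀) * (h₀ - 2 * ⨆ i, a i) ≤ speed g h₀ (a i) := by
  have h1 := velU_le hN hg h ha hinj s x t hy
  have h2 : √(g / h₀) * h₀ ≤ speed g h₀ (a i) := by
    rw [speed, sqrt_mul_eq hg h]
    have : 0 < a i / (2 * h₀) := by have := ha i; positivity
    have h3 : 0 < √(g / h₀) * h₀ := mul_pos (Real.sqrt_pos.2 (by positivity)) h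
    nlinarith
  nlinarith

/-- A function whose derivative is bounded by a multiple of itself near its zeros vanishes
identically if it has a zero. -/
theorem eq_zero_of_abs_deriv_le {f f' : ℝ → ℝ} {ε K : ℝ} (hε : 0 < ε)
    (hf : ∀ t, HasDerivAt f (f' t) t) (hb : ∀ t, |f t| ≤ ε → |f' t| ≤ K * |f t|) {t₀ : ℝ}
    (h0 : f t₀ = 0) (t : ℝ) : f t = 0 := by
  have hcont : Continuous f := continuous_iff_continuousAt.2 fun t => (hf t).continuousAt
  have hfwd : ∀ (f f' : ℝ → ℝ), (∀ t, HasDerivAt f (f' t) t) →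
      (∀ t, |f t| ≤ ε → |f' t| ≤ K * |f t|) → ∀ a b, f a = 0 → (∀ t ∈ Set.Icc a b, |f t| ≤ ε) →
      ∀ t ∈ Set.Icc a b, f t = 0 := by
    intro f f' hf hb a b ha hab
    refine eq_zero_of_abs_deriv_le_mul_abs_self_of_eq_zero_right (f' := f') (K := K)
      (fun t _ => (hf t).continuousAt.continuousWithinAt) (fun t _ => (hf t).hasDerivWithinAt) ha ?_
    intro t ht
    exact hb t (hab t ⟨ht.1, ht.2.le⟩)
  -- The linear bound holds only while `|f| ≤ ε`, so Grönwall applies locally, forwards and (after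
  -- reflection) backwards; connectedness of the line does the rest.
  have hopen : IsOpen {t | f t = 0} := by
    rw [Metric.isOpen_iff]
    intro t₁ (ht₁ : f t₁ = 0)
    obtain ⟨r, hr, hball⟩ := Metric.continuous_iff.1 hcont t₁ ε hε
    refine ⟨r, hr, fun t ht => ?_⟩
    have hball' : ∀ t, |t - t₁| < r → |f t| ≤ ε := fun t ht => by
      have := hball t ht
      rw [ht₁, Real.dist_eq, sub_zero] at this
      exact this.le
    rw [Metric.mem_ball, Real.dist_eq, abs_lt] at ht
    rcases le_total t₁ t with h | h
    · exact hfwd f f' hf hb t₁ t ht₁ (fun τ hτ => hball' τ (by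
        rw [abs_lt]; constructor <;> linarith [hτ.1, hτ.2])) t ⟨h, le_rfl⟩
    · have hneg : ∀ t, HasDerivAt (fun t => f (-t)) (-f' (-t)) t := fun t => by
        exact ((hf (-t)).comp t (hasDerivAt_neg t)).congr_deriv (by ring)
      have := hfwd (fun t => f (-t)) (fun t => -f' (-t)) hneg
        (fun t ht => by rw [abs_neg]; exact hb (-t) ht) (-t₁) (-t) (by simpa using ht₁)
        (fun τ hτ => hball' (-τ) (by rw [abs_lt]; constructor <;> linarith [hτ.1, hτ.2]))
        (-t) ⟨by linarith, le_rfl⟩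
      simpa using this
  have hclopen : IsClopen {t | f t = 0} := ⟨isClosed_eq hcont continuous_const, hopen⟩
  rcases isClopen_iff.1 hclopen with h | h
  · exact absurd (show t₀ ∈ {t | f t = 0} from h0) (by rw [h]; simp)
  · exact (h ▸ Set.mem_univ t : t ∈ {t | f t = 0})

theorem sum_beta_pos {h₀ : ℝ} {a : Fin N → ℝ} (hN : 1 ≤ N) (h : 0 < h₀)
    (ha : ∀ i, 0 < a i) : 0 < ∑ i, beta h₀ (a i) :=
  Finset.sum_pos (fun i _ => beta_pos h (ha i)) ⟨⟨0, hN⟩, Finset.mem_univ _⟩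

/-- Uniqueness at the bed from `|Y'| ≤ K|Y|`, valid for `|Y| ≤ π/(4 ∑ β_i)`; no a priori bound on
the height is needed. -/
theorem trajectory_bed {g h₀ : ℝ} {a : Fin N → ℝ} (hN : 1 ≤ N) (hg : 0 < g) (h : 0 < h₀)
    (ha : ∀ i, 0 < a i) (hinj : Function.Injective a) {s : Fin N → ℝ} {X Y : ℝ → ℝ}
    (htr : IsTrajectory g h₀ a s X Y) {t₀ : ℝ} (h0 : Y t₀ = 0) (t : ℝ) : Y t = 0 := by
  have hL := sum_beta_pos hN h ha
  refine eq_zero_of_abs_deriv_le (ε := Real.pi / 4 / ∑ i, beta h₀ (a i))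
    (K := 16 * (∑ i, beta h₀ (a i)) * (√(g / h₀) * ⨆ i, a i)) (by positivity)
    (fun t => (htr t).2) (fun t ht => ?_) h0 t
  rw [le_div_iff₀' hL] at ht
  refine (abs_velV_le hg h ha hinj s (X t) t ht).trans ?_
  have := velFactor_mul_curv_le (g := g) hN h ha hinj s (X t) t
  have h2 : 0 ≤ 16 * (∑ i, beta h₀ (a i)) * |Y t| := by positivity
  nlinarith [mul_le_mul_of_nonneg_left this h2]

end

end KdVSoliton

/-! ### Dominant terms in sums over quadruples -/

namespace KdVSoliton

noncomputable section

variable {ι : Type*}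

/-- The coefficient of a product of four weights in the time derivative of `quadSin / y`, if the
product grows at the rate `ρ` and `y` at the rate `z`. -/
def quadKernel (μ : ι → ℝ) (ρ : ι × ι × ι × ι → ℝ) (y z : ℝ) (q : ι × ι × ι × ι) : ℝ :=
  quadCoeff μ q * (ρ q * (Real.sin (quadFreq μ q * y) / y)
    + (quadFreq μ q * Real.cos (quadFreq μ q * y) - Real.sin (quadFreq μ q * y) / y) * z)

/-- The growth rate of a product of four weights. -/
def quadRate (r : ι → ℝ) (q : ι × ι × ι × ι) : ℝ := r q.1 + r q.2.1 + r q.2.2.1 + r q.2.2.2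

/-- Division by the height keeps every kernel bounded as `y → 0`; only the relative vertical
velocity `y'/y` enters. -/
theorem hasDerivAt_quadSin_div [Fintype ι] {w : ℝ → ι → ℝ} {μ r : ι → ℝ} {Y : ℝ → ℝ} {y' t : ℝ}
    (hw : ∀ T, HasDerivAt (fun t => w t T) (r T * w t T) t) (hY : HasDerivAt Y y' t)
    (h0 : Y t ≠ 0) :
    HasDerivAt (fun t => quadSin (w t) μ (Y t) / Y t)
      (∑ q, quadWeight (w t) q * quadKernel μ (quadRate r) (Y t) (y' / Y t) q) t := by
  have h1 : ∀ q, HasDerivAt (fun t => quadWeight (w t) q) (quadRate r q * quadWeight (w t) q) t := by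
    intro q
    refine ((((hw q.1).fun_mul (hw q.2.1)).fun_mul (hw q.2.2.1)).fun_mul (hw q.2.2.2)).congr_deriv ?_
    unfold quadRate quadWeight; ring
  have h2 : ∀ m, HasDerivAt (fun t => Real.sin (m * Y t)) (Real.cos (m * Y t) * (m * y')) t :=
    fun m => (hY.const_mul m).sin
  have h3 := (HasDerivAt.fun_sum fun q (_ : q ∈ Finset.univ) =>
    (h1 q).fun_mul ((h2 (quadFreq μ q)).const_mul (quadCoeff μ q))).fun_div hY h0
  refine h3.congr_deriv ?_
  rw [Finset.sum_mul, Finset.sum_mul, ← Finset.sum_sub_distrib, Finset.sum_div]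
  refine Finset.sum_congr rfl fun q _ => ?_
  unfold quadKernel
  field_simp
  ring

theorem abs_sin_mul_div_le (m : ℝ) {y : ℝ} (hy : 0 < y) : |Real.sin (m * y) / y| ≤ |m| := by
  rw [abs_div, abs_of_pos hy, div_le_iff₀ hy]
  refine Real.abs_sin_le_abs.trans ?_
  rw [abs_mul, abs_of_pos hy]

theorem abs_quadKernel_le {μ : ι → ℝ} {ρ : ι × ι × ι × ι → ℝ} {y z L P Z : ℝ}
    (hμ : ∀ T, 0 ≤ μ T ∧ μ T ≤ 2 * L) (hy : 0 < y) (hρ : ∀ q, |ρ q| ≤ P) (hz : |z| ≤ Z)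
    (q : ι × ι × ι × ι) : |quadKernel μ ρ y z q| ≤ 8 * L ^ 3 * (P + 2 * Z) := by
  have hm := abs_quadFreq_le hμ q
  have hs := (abs_sin_mul_div_le (quadFreq μ q) hy).trans hm
  have hL : 0 ≤ L := by linarith [(hμ q.1).1, (hμ q.1).2]
  have hc : quadCoeff μ q ≤ 2 * L ^ 2 := by
    unfold quadCoeff
    have : |μ q.1 - μ q.2.1| ≤ 2 * L := by
      rw [abs_le]; constructor <;> linarith [(hμ q.1).1, (hμ q.1).2, (hμ q.2.1).1, (hμ q.2.1).2]
    have := pow_le_pow_left₀ (abs_nonneg _) this 2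
    rw [sq_abs] at this; linarith
  have hcos : |quadFreq μ q * Real.cos (quadFreq μ q * y)| ≤ 4 * L := by
    rw [abs_mul]
    calc _ ≤ |quadFreq μ q| * 1 := by gcongr; exact Real.abs_cos_le_one _
      _ ≤ _ := by linarith
  have hP : 0 ≤ P := (abs_nonneg _).trans (hρ q)
  have hZ : 0 ≤ Z := (abs_nonneg _).trans hz
  unfold quadKernel
  rw [abs_mul, abs_of_nonneg (quadCoeff_nonneg μ q)]
  have h1 : |ρ q * (Real.sin (quadFreq μ q * y) / y)
      + (quadFreq μ q * Real.cos (quadFreq μ q * y) - Real.sin (quadFreq μ q * y) / y) * z|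
      ≤ P * (4 * L) + (4 * L + 4 * L) * Z := by
    refine (abs_add_le _ _).trans (add_le_add ?_ ?_)
    · rw [abs_mul]; gcongr; exact hρ q
    · rw [abs_mul]; gcongr
      exact (abs_sub _ _).trans (add_le_add hcos hs)
  calc _ ≤ 2 * L ^ 2 * (P * (4 * L) + (4 * L + 4 * L) * Z) := by gcongr
    _ = _ := by ring

theorem sum_pos_of_dominant {κ : Type*} [Fintype κ] {f : κ → ℝ} {m θ : ℝ} (q₀ : κ)
    (h0 : m ≤ f q₀) (h : ∀ q, -θ ≤ f q) (hθ : 0 ≤ θ) (hm : Fintype.card κ * θ < m) :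
    0 < ∑ q, f q := by
  classical
  rw [← Finset.add_sum_erase _ _ (Finset.mem_univ q₀)]
  have h1 : -(Fintype.card κ * θ) ≤ ∑ q ∈ Finset.univ.erase q₀, f q := by
    have h2 := Finset.card_nsmul_le_sum (Finset.univ.erase q₀) f (-θ) fun q _ => h q
    refine le_trans ?_ h2
    have h3 : ((Finset.univ.erase q₀).card : ℝ) ≤ Fintype.card κ := by
      exact_mod_cast Finset.card_le_univ _
    rw [nsmul_eq_mul]; nlinarith
  linarith

theorem mul_half_le_sin {x : ℝ} (h0 : 0 ≤ x) (h1 : x ≤ Real.pi / 2) : x / 2 ≤ Real.sin x := by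
  refine le_trans ?_ (Real.mul_le_sin h0 h1)
  have h2 : (1 : ℝ) / 2 ≤ 2 / Real.pi := by
    rw [div_le_div_iff₀ two_pos Real.pi_pos]; linarith [Real.pi_le_four]
  nlinarith

/-- A rate with the sign of a frequency times the sine of this frequency. -/
theorem mul_sin_div_ge {d r y : ℝ} (hy : 0 < y) (hd : |d| * y ≤ Real.pi / 2) (hr : 0 ≤ d * r) :
    d * r / 2 ≤ r * (Real.sin (d * y) / y) := by
  rcases lt_trichotomy d 0 with h | h | h
  · have hr' : r ≤ 0 := by nlinarith
    rw [abs_of_neg h] at hd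
    have h1 := mul_half_le_sin (x := -d * y) (by nlinarith) hd
    rw [neg_mul, Real.sin_neg] at h1
    have h2 : Real.sin (d * y) / y ≤ d / 2 := by rw [div_le_iff₀ hy]; linarith
    nlinarith
  · subst h; simp
  · have hr' : 0 ≤ r := by nlinarith
    rw [abs_of_pos h] at hd
    have h1 := mul_half_le_sin (x := d * y) (by positivity) hd
    have h2 : d / 2 ≤ Real.sin (d * y) / y := by rw [le_div_iff₀ hy]; linarith
    nlinarith

/-- For a quadruple with one index off the reference term, the leading part `d²/2·r·sin(dy)/y` has a
sign as soon as `d` and `r` agree in sign; the motion in `y` is an error of size `z`. -/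
theorem quadKernel_ge_of_single {μ : ι → ℝ} {ρ : ι × ι × ι × ι → ℝ} {y z L Z r d : ℝ}
    {q : ι × ι × ι × ι} (hμ : ∀ T, 0 ≤ μ T ∧ μ T ≤ 2 * L) (hy : 0 < y) (hLy : L * y ≤ Real.pi / 4)
    (hz : |z| ≤ Z) (hq : quadFreq μ q = d) (hc : quadCoeff μ q = d ^ 2 / 2) (hd : |d| ≤ 2 * L)
    (hρ : ρ q = r) (hr : 0 ≤ d * r) :
    d ^ 2 * (d * r) / 4 - 8 * L ^ 3 * Z ≤ quadKernel μ ρ y z q := by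
  have hL : 0 ≤ L := by linarith [(hμ q.1).1, (hμ q.1).2]
  have hZ : 0 ≤ Z := (abs_nonneg _).trans hz
  have h1 := mul_sin_div_ge hy (d := d) (r := r) (by nlinarith) hr
  have h2 : |(d * Real.cos (d * y) - Real.sin (d * y) / y) * z| ≤ (2 * L + 2 * L) * Z := by
    rw [abs_mul]
    gcongr
    refine (abs_sub _ _).trans (add_le_add ?_ ((abs_sin_mul_div_le d hy).trans hd))
    rw [abs_mul]
    calc _ ≤ |d| * 1 := by gcongr; exact Real.abs_cos_le_one _
      _ ≤ _ := by linarith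
  have h3 : d ^ 2 ≤ 4 * L ^ 2 := by
    have := pow_le_pow_left₀ (abs_nonneg _) hd 2
    rw [sq_abs] at this; linarith
  unfold quadKernel
  rw [hq, hc, hρ]
  have h4 := (abs_le.1 h2).1
  have h5 : d ^ 2 / 2 * (d * r / 2) ≤ d ^ 2 / 2 * (r * (Real.sin (d * y) / y)) := by gcongr
  have h6 : d ^ 2 / 2 * (-((2 * L + 2 * L) * Z))
      ≤ d ^ 2 / 2 * ((d * Real.cos (d * y) - Real.sin (d * y) / y) * z) := by gcongr
  have h7 : d ^ 2 / 2 * ((2 * L + 2 * L) * Z) ≤ 4 * L ^ 2 / 2 * ((2 * L + 2 * L) * Z) := by gcongr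
  nlinarith

/-- If one of the terms that differ from the reference term `S` dominates all others, then it
determines the sign. -/
theorem sum_quadKernel_pos [Fintype ι] {w μ r : ι → ℝ} {ρ : ι × ι × ι × ι → ℝ}
    {y z L P B θ m : ℝ} (S T₀ : ι) (nb : ι → Prop)
    (hw : ∀ T, 0 < w T) (hμ : ∀ T, 0 ≤ μ T ∧ μ T ≤ 2 * L) (hy : 0 < y)
    (hLy : L * y ≤ Real.pi / 4) (hρ : ∀ q, |ρ q| ≤ P) (hz : |z| ≤ θ) (hθ1 : θ ≤ 1) (hB : 1 ≤ B)
    (hS : w S = 1) (hwB : ∀ T, w T ≤ B) (hwθ : ∀ T, T ≠ S → w T ≤ θ)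
    (hwT : ∀ T, T ≠ S → w T ≤ B * w T₀) (hnb : ∀ T, T ≠ S → ¬ nb T → w T ≤ θ * w T₀)
    (hρ1 : ∀ T, ρ (T, S, S, S) = r T) (hρ2 : ∀ T, ρ (S, T, S, S) = r T)
    (hr : ∀ T, nb T → 0 ≤ (μ T - μ S) * r T)
    (hm : m ≤ (μ T₀ - μ S) ^ 2 * ((μ T₀ - μ S) * r T₀) / 4) (hT₀ : 0 ≤ (μ T₀ - μ S) * r T₀)
    (hsmall : (Fintype.card (ι × ι × ι × ι) + 1) * (θ * B ^ 3 * (8 * L ^ 3 * (P + 2))) < m) :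
    0 < ∑ q, quadWeight w q * quadKernel μ ρ y z q := by
  have hL : 0 ≤ L := by linarith [(hμ S).1, (hμ S).2]
  have hP : 0 ≤ P := (abs_nonneg _).trans (hρ (S, S, S, S))
  have hθ : 0 ≤ θ := (abs_nonneg _).trans hz
  have hw0 := hw T₀
  set C := 8 * L ^ 3 * (P + 2) with hC
  have hC0 : 0 ≤ C := by positivity
  have hker : ∀ q, |quadKernel μ ρ y z q| ≤ C := fun q => by
    refine (abs_quadKernel_le hμ hy hρ hz q).trans ?_
    rw [hC]; gcongr; linarith
  have h8 : 8 * L ^ 3 ≤ C := by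
    have : 0 ≤ 8 * L ^ 3 := by positivity
    rw [hC]; nlinarith
  have hdL : ∀ T, |μ T - μ S| ≤ 2 * L := fun T => by
    rw [abs_le]; constructor <;> linarith [(hμ T).1, (hμ T).2, (hμ S).1, (hμ S).2]
  have hB3 : 1 ≤ B ^ 3 := one_le_pow₀ hB
  have hsmallw : ∀ q, quadWeight w q ≤ θ * B ^ 3 * w T₀ →
      -(θ * B ^ 3 * C * w T₀) ≤ quadWeight w q * quadKernel μ ρ y z q := by
    intro q hq
    have h1 := (abs_le.1 (hker q)).1
    have h2 := (quadWeight_pos hw q).le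
    nlinarith [mul_le_mul_of_nonneg_left h1 h2, mul_le_mul_of_nonneg_right hq hC0]
  have hsingle : ∀ T, T ≠ S → ∀ q, quadWeight w q = w T → quadFreq μ q = μ T - μ S →
      quadCoeff μ q = (μ T - μ S) ^ 2 / 2 → ρ q = r T →
      -(θ * B ^ 3 * C * w T₀) ≤ quadWeight w q * quadKernel μ ρ y z q := by
    intro T hT q hq1 hq2 hq3 hq4
    by_cases hn : nb T
    · have h1 := quadKernel_ge_of_single hμ hy hLy hz hq2 hq3 (hdL T) hq4 (hr T hn)
      have h2 : 0 ≤ (μ T - μ S) ^ 2 * ((μ T - μ S) * r T) / 4 := by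
        have := hr T hn; positivity
      have h3 : -(C * θ) ≤ quadKernel μ ρ y z q := by nlinarith
      rw [hq1]
      have h4 := (hw T).le
      have h5 : B ≤ B ^ 3 := le_self_pow₀ hB (by norm_num)
      have h6 : w T ≤ B ^ 3 * w T₀ := (hwT T hT).trans (by gcongr)
      have h7 : 0 ≤ C * θ := by positivity
      nlinarith [mul_le_mul_of_nonneg_left h3 h4, mul_le_mul_of_nonneg_right h6 h7]
    · apply hsmallw
      rw [hq1]
      refine (hnb T hT hn).trans ?_
      have : 0 ≤ θ * w T₀ := by positivity
      nlinarith
  have hprod : ∀ x₁ x₂ x₃ x₄ : ℝ, 0 ≤ x₁ → 0 ≤ x₂ → 0 ≤ x₃ → 0 ≤ x₄ → x₁ ≤ θ → x₂ ≤ B * w T₀ →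
      x₃ ≤ B → x₄ ≤ B → x₁ * x₂ * x₃ * x₄ ≤ θ * B ^ 3 * w T₀ := by
    intro x₁ x₂ x₃ x₄ h1 h2 h3 h4 h5 h6 h7 h8
    calc x₁ * x₂ * x₃ * x₄ ≤ θ * (B * w T₀) * B * B := by gcongr
      _ = _ := by ring
  -- Three kinds of quadruples: those with both leading indices equal to `S` have coefficient zero;
  -- those with exactly one index off `S`, in a leading place, are `hsingle`; all others contain two
  -- weights off `S`, one bounded by `θ` and one by `B * w T₀`.
  have hall : ∀ q, -(θ * B ^ 3 * C * w T₀) ≤ quadWeight w q * quadKernel μ ρ y z q := by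
    rintro ⟨a, b, c, d⟩
    have ha := (hw a).le
    have hb := (hw b).le
    have hc := (hw c).le
    have hd := (hw d).le
    by_cases h1 : a = S
    · by_cases h2 : b = S
      · subst h1; subst h2
        have : quadKernel μ ρ y z (b, b, c, d) = 0 := by
          unfold quadKernel quadCoeff; simp
        rw [this, mul_zero]
        have : 0 ≤ θ * B ^ 3 * C * w T₀ := by positivity
        linarith
      · by_cases h3 : c = S
        · by_cases h4 : d = S
          · subst h1; subst h3; subst h4
            refine hsingle b h2 _ ?_ ?_ ?_ (hρ2 b)
            · simp only [quadWeight, hS]; ring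
            · simp only [quadFreq]; ring
            · simp only [quadCoeff]; ring
          · apply hsmallw
            have := hprod (w b) (w d) (w a) (w c) hb hd ha hc (hwθ b h2) (hwT d h4) (hwB a) (hwB c)
            simp only [quadWeight]; linarith
        · apply hsmallw
          have := hprod (w b) (w c) (w a) (w d) hb hc ha hd (hwθ b h2) (hwT c h3) (hwB a) (hwB d)
          simp only [quadWeight]; linarith
    · by_cases h2 : b = S
      · by_cases h3 : c = S
        · by_cases h4 : d = S
          · subst h2; subst h3; subst h4
            refine hsingle a h1 _ ?_ ?_ ?_ (hρ1 a)
            · simp only [quadWeight, hS]; ring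
            · simp only [quadFreq]; ring
            · simp only [quadCoeff]
          · apply hsmallw
            have := hprod (w a) (w d) (w b) (w c) ha hd hb hc (hwθ a h1) (hwT d h4) (hwB b) (hwB c)
            simp only [quadWeight]; linarith
        · apply hsmallw
          have := hprod (w a) (w c) (w b) (w d) ha hc hb hd (hwθ a h1) (hwT c h3) (hwB b) (hwB d)
          simp only [quadWeight]; linarith
      · apply hsmallw
        have := hprod (w a) (w b) (w c) (w d) ha hb hc hd (hwθ a h1) (hwT b h2) (hwB c) (hwB d)
        simp only [quadWeight]; linarith
  have hX : 0 ≤ θ * B ^ 3 * C := by positivity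
  refine sum_pos_of_dominant (T₀, S, S, S) (m := w T₀ * (m - C * θ)) ?_ hall (by positivity) ?_
  · have h1 := quadKernel_ge_of_single (q := (T₀, S, S, S)) (d := μ T₀ - μ S) hμ hy hLy hz
      (by simp only [quadFreq]; ring) (by simp only [quadCoeff]) (hdL T₀) (hρ1 T₀) hT₀
    have h2 : quadWeight w (T₀, S, S, S) = w T₀ := by simp only [quadWeight, hS]; ring
    rw [h2]
    refine mul_le_mul_of_nonneg_left ?_ hw0.le
    nlinarith
  · have h1 : C * θ ≤ θ * B ^ 3 * C := by
      have : 0 ≤ C * θ := by positivity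
      nlinarith
    have h2 : Fintype.card (ι × ι × ι × ι) * (θ * B ^ 3 * C) < m - C * θ := by linarith
    calc _ = w T₀ * (Fintype.card (ι × ι × ι × ι) * (θ * B ^ 3 * C)) := by ring
      _ < _ := by gcongr

/-- If two terms `S`, `S'` dominate all others, then the sum is close to the one of these terms. -/
theorem abs_sum_quadKernel_sub_le [Fintype ι] {w μ : ι → ℝ} {ρ : ι × ι × ι × ι → ℝ}
    {y z L P Z B θ ρ₁ ρ₃ : ℝ} (S S' : ι) (hSS : S ≠ S') (hθ : 0 ≤ θ)
    (hw : ∀ T, 0 < w T) (hμ : ∀ T, 0 ≤ μ T ∧ μ T ≤ 2 * L) (hy : 0 < y)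
    (hρ : ∀ q, |ρ q| ≤ P) (hz : |z| ≤ Z)
    (hS : w S = 1) (hwB : ∀ T, w T ≤ B) (hwθ : ∀ T, T ≠ S → T ≠ S' → w T ≤ θ)
    (h1 : ρ (S, S', S, S) = ρ₁) (h1' : ρ (S', S, S, S) = ρ₁)
    (h3 : ρ (S, S', S', S') = ρ₃) (h3' : ρ (S', S, S', S') = ρ₃) :
    |∑ q, quadWeight w q * quadKernel μ ρ y z q - (μ S' - μ S) ^ 2 *
      (w S' * (ρ₁ * (Real.sin ((μ S' - μ S) * y) / y) + ((μ S' - μ S) * Real.cos ((μ S' - μ S) * y)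
          - Real.sin ((μ S' - μ S) * y) / y) * z)
        - w S' ^ 3 * (ρ₃ * (Real.sin ((μ S' - μ S) * y) / y)
          + ((μ S' - μ S) * Real.cos ((μ S' - μ S) * y)
          - Real.sin ((μ S' - μ S) * y) / y) * z))|
      ≤ Fintype.card (ι × ι × ι × ι) * (θ * B ^ 3 * (8 * L ^ 3 * (P + 2 * Z))) := by
  classical
  set d := μ S' - μ S with hd
  set Q : Finset (ι × ι × ι × ι) := ({S, S'} : Finset ι) ×ˢ ({S, S'} : Finset ι) ×ˢ
    ({S, S'} : Finset ι) ×ˢ ({S, S'} : Finset ι) with hQ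
  have hL : 0 ≤ L := by linarith [(hμ S).1, (hμ S).2]
  have hP : 0 ≤ P := (abs_nonneg _).trans (hρ (S, S, S, S))
  have hZ : 0 ≤ Z := (abs_nonneg _).trans hz
  -- Of the sixteen quadruples in `{S, S'}` only four survive: the leading indices must differ, and
  -- the trailing ones must agree, else the frequency vanishes. Trailing `S` gives frequency `d` and
  -- weight `w S'`, trailing `S'` gives `-d` and the cube.
  have hsum : ∑ q ∈ Q, quadWeight w q * quadKernel μ ρ y z q = d ^ 2 *
      (w S' * (ρ₁ * (Real.sin (d * y) / y) + (d * Real.cos (d * y) - Real.sin (d * y) / y) * z)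
        - w S' ^ 3 * (ρ₃ * (Real.sin (d * y) / y)
          + (d * Real.cos (d * y) - Real.sin (d * y) / y) * z)) := by
    simp only [hQ, Finset.sum_product, Finset.sum_pair hSS]
    have e1 : ∀ c e, quadKernel μ ρ y z (S, S, c, e) = 0 := fun c e => by
      unfold quadKernel quadCoeff; simp
    have e2 : ∀ c e, quadKernel μ ρ y z (S', S', c, e) = 0 := fun c e => by
      unfold quadKernel quadCoeff; simp
    have e3 : ∀ q, quadFreq μ q = 0 → quadKernel μ ρ y z q = 0 := fun q hq => by
      unfold quadKernel; rw [hq]; simp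
    have e4 : ∀ q r, quadFreq μ q = d → quadCoeff μ q = d ^ 2 / 2 → ρ q = r →
        quadKernel μ ρ y z q = d ^ 2 / 2 * (r * (Real.sin (d * y) / y)
          + (d * Real.cos (d * y) - Real.sin (d * y) / y) * z) := fun q r h h' h'' => by
      unfold quadKernel; rw [h, h', h'']
    have e5 : ∀ q r, quadFreq μ q = -d → quadCoeff μ q = d ^ 2 / 2 → ρ q = r →
        quadKernel μ ρ y z q = -(d ^ 2 / 2 * (r * (Real.sin (d * y) / y)
          + (d * Real.cos (d * y) - Real.sin (d * y) / y) * z)) := fun q r h h' h'' => by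
      unfold quadKernel; rw [h, h', h'', neg_mul d, Real.cos_neg, Real.sin_neg]; ring
    have c1 : ∀ c e, quadCoeff μ (S, S', c, e) = d ^ 2 / 2 := fun c e => by
      simp only [quadCoeff, hd]; ring
    have c2 : ∀ c e, quadCoeff μ (S', S, c, e) = d ^ 2 / 2 := fun c e => by
      simp only [quadCoeff, hd]
    rw [e1, e1, e1, e1, e2, e2, e2, e2,
      e3 (S, S', S, S') (by simp only [quadFreq]; ring),
      e3 (S, S', S', S) (by simp only [quadFreq]; ring),
      e3 (S', S, S, S') (by simp only [quadFreq]; ring),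
      e3 (S', S, S', S) (by simp only [quadFreq]; ring),
      e4 (S, S', S, S) ρ₁ (by simp only [quadFreq, hd]; ring) (c1 _ _) h1,
      e4 (S', S, S, S) ρ₁ (by simp only [quadFreq, hd]; ring) (c2 _ _) h1',
      e5 (S, S', S', S') ρ₃ (by simp only [quadFreq, hd]; ring) (c1 _ _) h3,
      e5 (S', S, S', S') ρ₃ (by simp only [quadFreq, hd]; ring) (c2 _ _) h3']
    simp only [quadWeight, hS]
    ring
  rw [← hsum, ← Finset.sum_add_sum_compl Q, add_sub_cancel_left]
  have hB : 0 ≤ B := (hw S).le.trans (hwB S)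
  have hX : ∀ q ∈ Qᶜ, |quadWeight w q * quadKernel μ ρ y z q|
      ≤ θ * B ^ 3 * (8 * L ^ 3 * (P + 2 * Z)) := by
    rintro ⟨a, b, c, e⟩ hq
    rw [abs_mul, abs_of_pos (quadWeight_pos hw _)]
    refine mul_le_mul ?_ (abs_quadKernel_le hμ hy hρ hz _) (abs_nonneg _) ?_
    · have hprod : ∀ x₁ x₂ x₃ x₄ : ℝ, 0 ≤ x₁ → 0 ≤ x₂ → 0 ≤ x₃ → 0 ≤ x₄ → x₁ ≤ θ → x₂ ≤ B →
          x₃ ≤ B → x₄ ≤ B → x₁ * x₂ * x₃ * x₄ ≤ θ * B ^ 3 := by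
        intro x₁ x₂ x₃ x₄ h1 h2 h3 h4 h5 h6 h7 h8
        calc x₁ * x₂ * x₃ * x₄ ≤ θ * B * B * B := by gcongr
          _ = _ := by ring
      have ha := (hw a).le
      have hb := (hw b).le
      have hc := (hw c).le
      have he := (hw e).le
      simp only [hQ, Finset.mem_compl, Finset.mem_product, Finset.mem_insert,
        Finset.mem_singleton] at hq
      simp only [quadWeight]
      by_cases h1 : a = S ∨ a = S'
      · by_cases h2 : b = S ∨ b = S'
        · by_cases h3 : c = S ∨ c = S'
          · have h4 : ¬ (e = S ∨ e = S') := fun h4 => hq ⟨h1, h2, h3, h4⟩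
            rw [not_or] at h4
            have := hprod _ _ _ _ he ha hb hc (hwθ e h4.1 h4.2) (hwB a) (hwB b) (hwB c)
            linarith
          · rw [not_or] at h3
            have := hprod _ _ _ _ hc ha hb he (hwθ c h3.1 h3.2) (hwB a) (hwB b) (hwB e)
            linarith
        · rw [not_or] at h2
          have := hprod _ _ _ _ hb ha hc he (hwθ b h2.1 h2.2) (hwB a) (hwB c) (hwB e)
          linarith
      · rw [not_or] at h1
        exact hprod _ _ _ _ ha hb hc he (hwθ a h1.1 h1.2) (hwB b) (hwB c) (hwB e)
    · positivity
  refine (Finset.abs_sum_le_sum_abs _ _).trans ((Finset.sum_le_card_nsmul _ _ _ hX).trans ?_)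
  rw [nsmul_eq_mul]
  refine mul_le_mul_of_nonneg_right ?_ (by positivity)
  exact_mod_cast Finset.card_le_univ _

end

end KdVSoliton

/-! ### Normalized weights and the function `psi` along particle paths -/

namespace KdVSoliton

noncomputable section

variable {N : ℕ}

/-- The standing assumptions on the parameters. -/
structure Admissible (g h₀ : ℝ) (a : Fin N → ℝ) : Prop where
  one_le : 1 ≤ N
  g_pos : 0 < g
  h_pos : 0 < h₀
  a_pos : ∀ i, 0 < a i
  inj : Function.Injective a
  small : SmallAmplitude h₀ a

/-- The weights of Hirota's function divided by the one of a reference set `S`. -/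
def nweight (g h₀ : ℝ) (a s : Fin N → ℝ) (S : Finset (Fin N)) (x t : ℝ) (T : Finset (Fin N)) : ℝ :=
  weight g h₀ a s x t T / weight g h₀ a s x t S

/-- The distance to soliton `k`, counted positive if it is behind the particle for `k ∉ S`, and
in front of the particle for `k ∈ S`. -/
def signedPhase (g h₀ : ℝ) (a s : Fin N → ℝ) (S : Finset (Fin N)) (k : Fin N) (x t : ℝ) : ℝ :=
  if k ∈ S then -phase g h₀ a s k x t else phase g h₀ a s k x t

theorem sum_sub_sum_eq_symmDiff (S T : Finset (Fin N)) (f : Fin N → ℝ) :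
    ∑ k ∈ T, f k - ∑ k ∈ S, f k = ∑ k ∈ symmDiff T S, if k ∈ S then -f k else f k := by
  have hdis : Disjoint (T \ S) (S \ T) := disjoint_sdiff_sdiff
  rw [symmDiff_def, Finset.sup_eq_union, Finset.sum_union hdis,
    ← Finset.sum_sdiff_sub_sum_sdiff, sub_eq_add_neg, ← Finset.sum_neg_distrib]
  congr 1
  · exact Finset.sum_congr rfl fun k hk => by rw [if_neg (Finset.mem_sdiff.1 hk).2]
  · exact Finset.sum_congr rfl fun k hk => by rw [if_pos (Finset.mem_sdiff.1 hk).1]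

/-- Only the solitons in which `T` and `S` differ enter, with signs such that each of them makes the
weight small when it lies on the side prescribed by `S`. -/
theorem nweight_eq (g h₀ : ℝ) (a s : Fin N → ℝ) (S : Finset (Fin N)) (x t : ℝ)
    (T : Finset (Fin N)) :
    nweight g h₀ a s S x t T = alphaSet a T / alphaSet a S
      * Real.exp (-2 * ∑ k ∈ symmDiff T S, signedPhase g h₀ a s S k x t) := by
  unfold nweight weight
  rw [mul_div_mul_comm, ← Real.exp_sub]
  congr 2
  have h1 : ∑ k ∈ symmDiff T S, signedPhase g h₀ a s S k x t
      = ∑ k ∈ T, phase g h₀ a s k x t - ∑ k ∈ S, phase g h₀ a s k x t := by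
    exact (sum_sub_sum_eq_symmDiff S T fun k => phase g h₀ a s k x t).symm
  rw [h1]; ring

/-- The quotient that has the sign of the vertical velocity. -/
def psi (g h₀ : ℝ) (a s : Fin N → ℝ) (S : Finset (Fin N)) (x y t : ℝ) : ℝ :=
  quadSin (nweight g h₀ a s S x t) (freq h₀ a) y / y

theorem quadSin_div_const {ι : Type*} [Fintype ι] (w μ : ι → ℝ) (c y : ℝ) :
    quadSin (fun T => w T / c) μ y = quadSin w μ y / c ^ 4 := by
  unfold quadSin
  rw [Finset.sum_div]
  refine Finset.sum_congr rfl fun q _ => ?_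
  unfold quadWeight
  ring

/-- The quotient is homogeneous in the weights, so `S` may be any set; it is adapted to the solitons
that have passed. -/
theorem velV_eq_psi {g h₀ : ℝ} {a : Fin N → ℝ} (H : Admissible g h₀ a) (s : Fin N → ℝ)
    (S : Finset (Fin N)) (x t : ℝ) {y : ℝ} (hy0 : 0 < y)
    (hy : (∑ i, beta h₀ (a i)) * |y| ≤ Real.pi / 4) :
    ∃ c : ℝ, 0 < c ∧ velV g h₀ a s x y t = c * psi g h₀ a s S x y t := by
  have hne := expSum_ne_zero (g := g) H.a_pos H.inj s x t hy
  have hS := weight_pos (g := g) (h₀ := h₀) H.a_pos H.inj s x t S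
  have hn := Complex.normSq_pos.2 hne
  have hf := velFactor_pos H.g_pos H.h_pos
  refine ⟨velFactor g h₀ / Complex.normSq (expSum (weight g h₀ a s x t) (freq h₀ a) y) ^ 2
    * weight g h₀ a s x t S ^ 4 * y, by positivity, ?_⟩
  rw [velV_eq _ _ _ _ _ _ _ hne, im_expNum_div, psi]
  unfold nweight
  rw [quadSin_div_const]
  field_simp

theorem velV_pos_iff {g h₀ : ℝ} {a : Fin N → ℝ} (H : Admissible g h₀ a) (s : Fin N → ℝ)
    (S : Finset (Fin N)) (x t : ℝ) {y : ℝ} (hy0 : 0 < y)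
    (hy : (∑ i, beta h₀ (a i)) * |y| ≤ Real.pi / 4) :
    0 < velV g h₀ a s x y t ↔ 0 < psi g h₀ a s S x y t := by
  obtain ⟨c, hc, h⟩ := velV_eq_psi H s S x t hy0 hy
  rw [h]; exact mul_pos_iff_of_pos_left hc

theorem velV_neg_iff {g h₀ : ℝ} {a : Fin N → ℝ} (H : Admissible g h₀ a) (s : Fin N → ℝ)
    (S : Finset (Fin N)) (x t : ℝ) {y : ℝ} (hy0 : 0 < y)
    (hy : (∑ i, beta h₀ (a i)) * |y| ≤ Real.pi / 4) :
    velV g h₀ a s x y t < 0 ↔ psi g h₀ a s S x y t < 0 := by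
  obtain ⟨c, hc, h⟩ := velV_eq_psi H s S x t hy0 hy
  rw [h]
  refine ⟨fun h' => ?_, fun h' => mul_neg_of_pos_of_neg hc h'⟩
  by_contra hcon
  linarith [mul_nonneg hc.le (not_lt.1 hcon)]

/-- The growth rate of the normalized weights along a particle path with horizontal velocity
`u`. -/
def rate (g h₀ : ℝ) (a : Fin N → ℝ) (S : Finset (Fin N)) (u : ℝ) (T : Finset (Fin N)) : ℝ :=
  ∑ i ∈ T, 2 * beta h₀ (a i) * (speed g h₀ (a i) - u)
    - ∑ i ∈ S, 2 * beta h₀ (a i) * (speed g h₀ (a i) - u)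

theorem hasDerivAt_phase_path {g h₀ : ℝ} {a s : Fin N → ℝ} {X : ℝ → ℝ} {u t : ℝ}
    (hX : HasDerivAt X u t) (i : Fin N) :
    HasDerivAt (fun t => phase g h₀ a s i (X t) t)
      (-(beta h₀ (a i) * (speed g h₀ (a i) - u))) t := by
  have h := ((hX.sub_const (s i)).fun_sub
    ((hasDerivAt_id t).const_mul (speed g h₀ (a i)))).const_mul (beta h₀ (a i))
  refine h.congr_deriv ?_
  ring

theorem hasDerivAt_weight_path {g h₀ : ℝ} {a s : Fin N → ℝ} {X : ℝ → ℝ} {u t : ℝ}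
    (hX : HasDerivAt X u t) (T : Finset (Fin N)) :
    HasDerivAt (fun t => weight g h₀ a s (X t) t T)
      ((∑ i ∈ T, 2 * beta h₀ (a i) * (speed g h₀ (a i) - u)) * weight g h₀ a s (X t) t T) t := by
  have h := ((HasDerivAt.fun_sum fun i (_ : i ∈ T) =>
    hasDerivAt_phase_path (g := g) (h₀ := h₀) (a := a) (s := s) hX i).const_mul
    (-2)).exp.const_mul (alphaSet a T)
  refine h.congr_deriv ?_
  have e : ∑ i ∈ T, 2 * beta h₀ (a i) * (speed g h₀ (a i) - u)
      = -2 * ∑ i ∈ T, -(beta h₀ (a i) * (speed g h₀ (a i) - u)) := by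
    rw [Finset.mul_sum]; exact Finset.sum_congr rfl fun i _ => by ring
  rw [e]; unfold weight; ring

theorem hasDerivAt_nweight_path {g h₀ : ℝ} {a s : Fin N → ℝ} (ha : ∀ i, 0 < a i)
    (hinj : Function.Injective a) {X : ℝ → ℝ} {u t : ℝ}
    (hX : HasDerivAt X u t) (S T : Finset (Fin N)) :
    HasDerivAt (fun t => nweight g h₀ a s S (X t) t T)
      (rate g h₀ a S u T * nweight g h₀ a s S (X t) t T) t := by
  have hS := weight_pos (g := g) (h₀ := h₀) ha hinj s (X t) t S
  refine ((hasDerivAt_weight_path (g := g) (h₀ := h₀) (a := a) (s := s) hX T).fun_div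
    (hasDerivAt_weight_path hX S) hS.ne').congr_deriv ?_
  unfold nweight rate
  field_simp

/-- The time derivative of `psi` along particle paths. -/
def psiDeriv (g h₀ : ℝ) (a s : Fin N → ℝ) (S : Finset (Fin N)) (x y t : ℝ) : ℝ :=
  ∑ q, quadWeight (nweight g h₀ a s S x t) q * quadKernel (freq h₀ a)
    (quadRate (rate g h₀ a S (velU g h₀ a s x y t))) y (velV g h₀ a s x y t / y) q

theorem hasDerivAt_psi {g h₀ : ℝ} {a s : Fin N → ℝ} (ha : ∀ i, 0 < a i)
    (hinj : Function.Injective a) {X Y : ℝ → ℝ} (htr : IsTrajectory g h₀ a s X Y)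
    (S : Finset (Fin N)) {t : ℝ} (hY : Y t ≠ 0) :
    HasDerivAt (fun t => psi g h₀ a s S (X t) (Y t) t) (psiDeriv g h₀ a s S (X t) (Y t) t) t :=
  hasDerivAt_quadSin_div (fun T => hasDerivAt_nweight_path ha hinj (htr t).1 S T) (htr t).2 hY

/-- With unit rates and no vertical motion the kernel of the derivative becomes that of `psi`
itself, so the same domination lemmas serve for the sign of `psi` and of its derivative. -/
theorem psi_eq_sum (g h₀ : ℝ) (a s : Fin N → ℝ) (S : Finset (Fin N)) (x y t : ℝ) :
    psi g h₀ a s S x y t = ∑ q, quadWeight (nweight g h₀ a s S x t) q *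
      quadKernel (freq h₀ a) (fun _ => 1) y 0 q := by
  unfold psi quadSin quadKernel
  rw [Finset.sum_div]
  exact Finset.sum_congr rfl fun q _ => by ring

theorem neg_psi_eq_sum (g h₀ : ℝ) (a s : Fin N → ℝ) (S : Finset (Fin N)) (x y t : ℝ) :
    -psi g h₀ a s S x y t = ∑ q, quadWeight (nweight g h₀ a s S x t) q *
      quadKernel (freq h₀ a) (fun _ => -1) y 0 q := by
  unfold psi quadSin quadKernel
  rw [Finset.sum_div, ← Finset.sum_neg_distrib]
  exact Finset.sum_congr rfl fun q _ => by ring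

theorem curv_eq_nweight {g h₀ : ℝ} {a s : Fin N → ℝ} (ha : ∀ i, 0 < a i)
    (hinj : Function.Injective a) (S : Finset (Fin N)) (x t : ℝ) :
    curv g h₀ a s x t = expVar (nweight g h₀ a s S x t) (freq h₀ a)
      / (∑ T, nweight g h₀ a s S x t T) ^ 2 := by
  have hS := weight_pos (g := g) (h₀ := h₀) ha hinj s x t S
  have hW := sum_weight_pos (g := g) (h₀ := h₀) ha hinj s x t
  have e1 : expVar (nweight g h₀ a s S x t) (freq h₀ a)
      = expVar (weight g h₀ a s x t) (freq h₀ a) / weight g h₀ a s x t S ^ 2 := by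
    unfold expVar nweight
    rw [Finset.sum_div]
    refine Finset.sum_congr rfl fun A _ => ?_
    rw [Finset.sum_div]
    exact Finset.sum_congr rfl fun B _ => by ring
  have e2 : ∑ T, nweight g h₀ a s S x t T
      = (∑ T, weight g h₀ a s x t T) / weight g h₀ a s x t S := by
    unfold nweight; rw [Finset.sum_div]
  rw [e1, e2, curv]
  field_simp

theorem nweight_pos {g h₀ : ℝ} {a : Fin N → ℝ} (ha : ∀ i, 0 < a i) (hinj : Function.Injective a)
    (s : Fin N → ℝ) (S : Finset (Fin N)) (x t : ℝ) (T : Finset (Fin N)) :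
    0 < nweight g h₀ a s S x t T :=
  div_pos (weight_pos ha hinj s x t T) (weight_pos ha hinj s x t S)

theorem nweight_self {g h₀ : ℝ} {a : Fin N → ℝ} (ha : ∀ i, 0 < a i) (hinj : Function.Injective a)
    (s : Fin N → ℝ) (S : Finset (Fin N)) (x t : ℝ) : nweight g h₀ a s S x t S = 1 :=
  div_self (weight_pos ha hinj s x t S).ne'

theorem exists_alphaSet_ratio_le (a : Fin N → ℝ) (ha : ∀ i, 0 < a i)
    (hinj : Function.Injective a) :
    ∃ B : ℝ, 1 ≤ B ∧ ∀ S T, alphaSet a T / alphaSet a S ≤ B := by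
  have hpos : ∀ S T, 0 ≤ alphaSet a T / alphaSet a S := fun S T =>
    (div_pos (alphaSet_pos ha hinj T) (alphaSet_pos ha hinj S)).le
  refine ⟨1 + ∑ S, ∑ T, alphaSet a T / alphaSet a S, ?_, fun S T => ?_⟩
  · have : 0 ≤ ∑ S, ∑ T, alphaSet a T / alphaSet a S :=
      Finset.sum_nonneg fun S _ => Finset.sum_nonneg fun T _ => hpos S T
    linarith
  · have h1 := Finset.single_le_sum (f := fun T => alphaSet a T / alphaSet a S)
      (fun T _ => hpos S T) (Finset.mem_univ T)
    have h2 := Finset.single_le_sum (f := fun S => ∑ T, alphaSet a T / alphaSet a S)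
      (fun S _ => Finset.sum_nonneg fun T _ => hpos S T) (Finset.mem_univ S)
    have h3 := h1.trans h2
    linarith

theorem exists_forall_mul_exp_lt (K : ℝ) {c : ℝ} (hc : 0 < c) :
    ∃ r₀ : ℝ, 0 < r₀ ∧ ∀ r, r₀ ≤ r → K * Real.exp (-2 * r) < c := by
  have h : Filter.Tendsto (fun r : ℝ => K * Real.exp (-2 * r)) Filter.atTop (nhds (K * 0)) := by
    refine Filter.Tendsto.const_mul K (Real.tendsto_exp_atBot.comp ?_)
    exact Filter.tendsto_id.const_mul_atTop_of_neg (by norm_num)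
  rw [mul_zero] at h
  obtain ⟨r₀, hr₀⟩ := Filter.eventually_atTop.1 (h.eventually (gt_mem_nhds hc))
  exact ⟨max r₀ 1, by positivity, fun r hr => hr₀ r ((le_max_left _ _).trans hr)⟩

end

end KdVSoliton

/-! ### Between the solitons: `psi` increases -/

namespace KdVSoliton

noncomputable section

variable {N : ℕ}

theorem exists_beta_lower {h₀ : ℝ} {a : Fin N → ℝ} (hN : 1 ≤ N) (h : 0 < h₀)
    (ha : ∀ i, 0 < a i) : ∃ b : ℝ, 0 < b ∧ ∀ i, b ≤ beta h₀ (a i) := by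
  have : Nonempty (Fin N) := ⟨⟨0, hN⟩⟩
  obtain ⟨i, hi⟩ := Finite.exists_min fun i => beta h₀ (a i)
  exact ⟨_, beta_pos h (ha i), hi⟩

theorem speed_pos {g h₀ p : ℝ} (hg : 0 < g) (h : 0 < h₀) (hp : 0 < p) : 0 < speed g h₀ p :=
  mul_pos (Real.sqrt_pos.2 (by positivity)) (by positivity)

theorem abs_rate_le {g h₀ u : ℝ} {a : Fin N → ℝ} (h : 0 < h₀) (ha : ∀ i, 0 < a i) (hu : 0 ≤ u)
    (huc : ∀ i, u ≤ speed g h₀ (a i)) (S T : Finset (Fin N)) :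
    |rate g h₀ a S u T| ≤ ∑ i, 2 * beta h₀ (a i) * speed g h₀ (a i) := by
  have key : ∀ T : Finset (Fin N),
      0 ≤ ∑ i ∈ T, 2 * beta h₀ (a i) * (speed g h₀ (a i) - u) ∧
      ∑ i ∈ T, 2 * beta h₀ (a i) * (speed g h₀ (a i) - u)
        ≤ ∑ i, 2 * beta h₀ (a i) * speed g h₀ (a i) := by
    intro T
    have h0 : ∀ i, 0 ≤ 2 * beta h₀ (a i) * (speed g h₀ (a i) - u) := fun i =>
      mul_nonneg (by have := beta_pos h (ha i); positivity) (sub_nonneg.2 (huc i))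
    refine ⟨Finset.sum_nonneg fun i _ => h0 i, ?_⟩
    refine (Finset.sum_le_sum_of_subset_of_nonneg (Finset.subset_univ T) fun i _ _ => h0 i).trans
      (Finset.sum_le_sum fun i _ => ?_)
    have := beta_pos h (ha i)
    gcongr
    linarith
  unfold rate
  rw [abs_le]
  constructor <;> linarith [(key S).1, (key S).2, (key T).1, (key T).2]

theorem freq_sub_of_symmDiff {h₀ : ℝ} {a : Fin N → ℝ} {S T : Finset (Fin N)} {k : Fin N}
    (hk : symmDiff T S = {k}) : freq h₀ a T - freq h₀ a S
      = if k ∈ S then -(2 * beta h₀ (a k)) else 2 * beta h₀ (a k) := by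
  unfold freq
  rw [sum_sub_sum_eq_symmDiff, hk, Finset.sum_singleton]

theorem rate_of_symmDiff {g h₀ u : ℝ} {a : Fin N → ℝ} {S T : Finset (Fin N)} {k : Fin N}
    (hk : symmDiff T S = {k}) : rate g h₀ a S u T
      = if k ∈ S then -(2 * beta h₀ (a k) * (speed g h₀ (a k) - u))
        else 2 * beta h₀ (a k) * (speed g h₀ (a k) - u) := by
  unfold rate
  rw [sum_sub_sum_eq_symmDiff, hk, Finset.sum_singleton]

/-- Adding or removing one soliton changes frequency and growth rate with the same sign, because the
soliton is faster than the particle. This is why `psi` increases away from the solitons. -/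
theorem freq_mul_rate {g h₀ u : ℝ} {a : Fin N → ℝ} {S T : Finset (Fin N)} {k : Fin N}
    (hk : symmDiff T S = {k}) : (freq h₀ a T - freq h₀ a S) * rate g h₀ a S u T
      = 4 * beta h₀ (a k) ^ 2 * (speed g h₀ (a k) - u) := by
  rw [freq_sub_of_symmDiff hk, rate_of_symmDiff hk]
  split_ifs <;> ring

theorem sq_freq_sub {h₀ : ℝ} {a : Fin N → ℝ} {S T : Finset (Fin N)} {k : Fin N}
    (hk : symmDiff T S = {k}) : (freq h₀ a T - freq h₀ a S) ^ 2 = 4 * beta h₀ (a k) ^ 2 := by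
  rw [freq_sub_of_symmDiff hk]
  split_ifs <;> ring

theorem abs_velV_div_le {g h₀ : ℝ} {a : Fin N → ℝ} (H : Admissible g h₀ a) (s : Fin N → ℝ)
    (x t : ℝ) {y : ℝ} (hy0 : 0 < y) (hy : (∑ i, beta h₀ (a i)) * y ≤ Real.pi / 4) :
    |velV g h₀ a s x y t / y|
      ≤ velFactor g h₀ * (16 * (∑ i, beta h₀ (a i)) * curv g h₀ a s x t) := by
  have h1 := abs_velV_le H.g_pos H.h_pos H.a_pos H.inj s x t (y := y)
    (by rwa [abs_of_pos hy0])
  rw [abs_div, abs_of_pos hy0, div_le_iff₀ hy0]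
  rw [abs_of_pos hy0] at h1
  linarith

theorem abs_quadRate_le {ι : Type*} {r : ι → ℝ} {M : ℝ} (hr : ∀ T, |r T| ≤ M)
    (q : ι × ι × ι × ι) : |quadRate r q| ≤ 4 * M := by
  unfold quadRate
  rw [abs_le]
  have h1 := abs_le.1 (hr q.1)
  have h2 := abs_le.1 (hr q.2.1)
  have h3 := abs_le.1 (hr q.2.2.1)
  have h4 := abs_le.1 (hr q.2.2.2)
  constructor <;> linarith [h1.1, h1.2, h2.1, h2.2, h3.1, h3.2, h4.1, h4.2]

theorem rate_self (g h₀ : ℝ) (a : Fin N → ℝ) (S : Finset (Fin N)) (u : ℝ) :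
    rate g h₀ a S u S = 0 := sub_self _

theorem speed_sub_velU_ge {g h₀ : ℝ} {a : Fin N → ℝ} (H : Admissible g h₀ a) (s : Fin N → ℝ)
    (x t : ℝ) {y : ℝ} (hy0 : 0 < y) (hy : (∑ i, beta h₀ (a i)) * y ≤ Real.pi / 4) (i : Fin N) :
    √(g / h₀) * (h₀ - 2 * ⨆ i, a i) ≤ speed g h₀ (a i) - velU g h₀ a s x y t := by
  have := velU_add_lt_speed H.one_le H.g_pos H.h_pos H.a_pos H.inj s x t (y := y)
    (by rwa [abs_of_pos hy0]) i
  linarith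

theorem speedGap_pos {g h₀ : ℝ} {a : Fin N → ℝ} (H : Admissible g h₀ a) :
    0 < √(g / h₀) * (h₀ - 2 * ⨆ i, a i) :=
  mul_pos (Real.sqrt_pos.2 (div_pos H.g_pos H.h_pos))
    (sub_pos.2 (iSup_amplitude_lt H.one_le H.h_pos H.a_pos H.small))

/-- The sum of `expVar` is small if all weights but one are small. -/
theorem expVar_le {ι : Type*} [Fintype ι] {w μ : ι → ℝ} {L B θ : ℝ} (S : ι) (hw : ∀ T, 0 < w T)
    (hμ : ∀ T, 0 ≤ μ T ∧ μ T ≤ 2 * L) (hwB : ∀ T, w T ≤ B) (hwθ : ∀ T, T ≠ S → w T ≤ θ)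
    (hθ : 0 ≤ θ) :
    expVar w μ ≤ (Fintype.card ι : ℝ) ^ 2 * (θ * B * (2 * L ^ 2)) := by
  have hB : 0 ≤ B := (hw S).le.trans (hwB S)
  have hterm : ∀ A C, w A * w C * ((μ A - μ C) ^ 2 / 2) ≤ θ * B * (2 * L ^ 2) := by
    intro A C
    have hd : (μ A - μ C) ^ 2 / 2 ≤ 2 * L ^ 2 := by
      have : |μ A - μ C| ≤ 2 * L := by
        rw [abs_le]; constructor <;> linarith [(hμ A).1, (hμ A).2, (hμ C).1, (hμ C).2]
      have := pow_le_pow_left₀ (abs_nonneg _) this 2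
      rw [sq_abs] at this; linarith
    by_cases hA : A = S
    · by_cases hC : C = S
      · subst hA; subst hC
        simp only [sub_self]
        have : 0 ≤ θ * B * (2 * L ^ 2) := by positivity
        simpa using this
      · have h1 := (hw A).le
        have h2 := (hw C).le
        have := hwB A
        have := hwθ C hC
        calc w A * w C * ((μ A - μ C) ^ 2 / 2) ≤ B * θ * (2 * L ^ 2) := by gcongr
          _ = _ := by ring
    · have h1 := (hw A).le
      have h2 := (hw C).le
      have := hwB C
      have := hwθ A hA
      gcongr
  unfold expVar
  calc _ ≤ ∑ _A : ι, ∑ _C : ι, θ * B * (2 * L ^ 2) :=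
        Finset.sum_le_sum fun A _ => Finset.sum_le_sum fun C _ => hterm A C
    _ = _ := by simp only [Finset.sum_const, Finset.card_univ, nsmul_eq_mul]; ring

/-- Far from all solitons `psi` increases along particle paths, and the vertical velocity is
positive ahead of all solitons and negative behind all solitons. -/
theorem exists_gap_radius {g h₀ : ℝ} {a : Fin N → ℝ} (H : Admissible g h₀ a) :
    ∃ r₀ : ℝ, 0 < r₀ ∧ ∀ r, r₀ ≤ r → ∀ (s : Fin N → ℝ) (S : Finset (Fin N)) (x y t : ℝ), 0 < y →
      (∑ i, beta h₀ (a i)) * y ≤ Real.pi / 4 → (∀ k, r ≤ signedPhase g h₀ a s S k x t) →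
      0 < psiDeriv g h₀ a s S x y t ∧ (S = ∅ → 0 < psi g h₀ a s S x y t) ∧
        (S = Finset.univ → psi g h₀ a s S x y t < 0) := by
  obtain ⟨B₀, hB₀, hratio⟩ := exists_alphaSet_ratio_le a H.a_pos H.inj
  obtain ⟨b, hb0, hb⟩ := exists_beta_lower H.one_le H.h_pos H.a_pos
  have hgap := speedGap_pos H
  set m₁ := √(g / h₀) * (h₀ - 2 * ⨆ i, a i) with hm₁
  set L := ∑ i, beta h₀ (a i) with hL
  have hL0 : 0 < L := sum_beta_pos H.one_le H.h_pos H.a_pos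
  have hf := velFactor_pos H.g_pos H.h_pos
  set M := ∑ i, 2 * beta h₀ (a i) * speed g h₀ (a i) with hM
  have hM0 : 0 ≤ M := Finset.sum_nonneg fun i _ => by
    have := beta_pos H.h_pos (H.a_pos i)
    have := speed_pos H.g_pos H.h_pos (H.a_pos i)
    positivity
  set P := 4 * M + 1 with hP
  set n : ℝ := (Fintype.card (Finset (Fin N)) : ℝ) with hn
  -- The first summand serves the weights with two or more changes, the second the relative vertical
  -- velocity, which is small because the curvature is. Thus `θ = K * exp (-2r)` bounds both.
  set K := B₀ ^ 2 + velFactor g h₀ * (16 * L * (n ^ 2 * (B₀ * B₀ * (2 * L ^ 2)))) with hK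
  have hK0 : 0 < K := by positivity
  set C := (Fintype.card (Finset (Fin N) × Finset (Fin N) × Finset (Fin N) × Finset (Fin N)) + 1)
    * (K * (B₀ ^ 2) ^ 3 * (8 * L ^ 3 * (P + 2))) with hC
  obtain ⟨r₁, hr₁, hr₁'⟩ := exists_forall_mul_exp_lt K one_pos
  obtain ⟨r₂, hr₂, hr₂'⟩ := exists_forall_mul_exp_lt C (c := 4 * b ^ 2 * (4 * b ^ 2 * m₁) / 4)
    (by positivity)
  obtain ⟨r₃, hr₃, hr₃'⟩ := exists_forall_mul_exp_lt C (c := 4 * b ^ 2 * (2 * b) / 4)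
    (by positivity)
  refine ⟨max r₁ (max r₂ r₃), by positivity, fun r hr s S x y t hy0 hy hS => ?_⟩
  have hθ1 := hr₁' r ((le_max_left _ _).trans hr)
  have hθ2 := hr₂' r (((le_max_left _ _).trans (le_max_right _ _)).trans hr)
  have hθ3 := hr₃' r (((le_max_right _ _).trans (le_max_right _ _)).trans hr)
  have hr0 : 0 < r := hr₁.trans_le ((le_max_left _ _).trans hr)
  set E := Real.exp (-2 * r) with hE
  have hE0 : 0 < E := Real.exp_pos _
  have hE1 : E ≤ 1 := Real.exp_le_one_iff.2 (by linarith)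
  set w := nweight g h₀ a s S x t with hw_def
  set Q := fun k => signedPhase g h₀ a s S k x t with hQ
  have hw : ∀ T, 0 < w T := nweight_pos H.a_pos H.inj s S x t
  have hwS : w S = 1 := nweight_self H.a_pos H.inj s S x t
  have hweq : ∀ T, w T = alphaSet a T / alphaSet a S * Real.exp (-2 * ∑ k ∈ symmDiff T S, Q k) :=
    nweight_eq g h₀ a s S x t
  have hQ0 : ∀ k, 0 ≤ Q k := fun k => hr0.le.trans (hS k)
  have : Nonempty (Fin N) := ⟨⟨0, H.one_le⟩⟩
  obtain ⟨k₀, hk₀⟩ := Finite.exists_min Q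
  -- The dominant competitor of `S` toggles the closest soliton; its weight may be arbitrarily
  -- small, so all errors are measured relative to it.
  set T₀ := symmDiff S {k₀} with hT₀
  have hT₀S : symmDiff T₀ S = {k₀} := by
    rw [hT₀, symmDiff_comm S, symmDiff_symmDiff_cancel_right]
  have hratio' : ∀ T, 1 / B₀ ≤ alphaSet a T / alphaSet a S := fun T => by
    have h1 := hratio T S
    have h2 := alphaSet_pos H.a_pos H.inj T
    have h3 := alphaSet_pos H.a_pos H.inj S
    rw [div_le_iff₀ h2] at h1
    rw [div_le_div_iff₀ (by positivity) h3]; linarith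
  have hle : ∀ T c, c ≤ ∑ k ∈ symmDiff T S, Q k → w T ≤ B₀ * Real.exp (-2 * c) := by
    intro T c hc
    rw [hweq]
    exact mul_le_mul (hratio S T) (Real.exp_le_exp.2 (by linarith)) (Real.exp_pos _).le
      (by linarith)
  have hT₀w : Real.exp (-2 * Q k₀) ≤ B₀ * w T₀ := by
    rw [hweq, hT₀S, Finset.sum_singleton, ← mul_assoc]
    have h1 := hratio' T₀
    rw [div_le_iff₀' (by positivity)] at h1
    have := Real.exp_pos (-2 * Q k₀)
    nlinarith
  have hB1 : B₀ ≤ B₀ ^ 2 := le_self_pow₀ hB₀ (by norm_num)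
  have hB2 : 1 ≤ B₀ ^ 2 := one_le_pow₀ hB₀
  have hB' : B₀ ^ 2 ≤ K := by
    rw [hK]
    have : 0 ≤ velFactor g h₀ * (16 * L * (n ^ 2 * (B₀ * B₀ * (2 * L ^ 2)))) := by positivity
    linarith
  have hB : B₀ ≤ K := hB1.trans hB'
  have hne : ∀ T, T ≠ S → (symmDiff T S).Nonempty := fun T hT => by
    rw [Finset.nonempty_iff_ne_empty]
    intro h
    exact hT (symmDiff_eq_bot.1 h)
  have hge : ∀ T, T ≠ S → Q k₀ ≤ ∑ k ∈ symmDiff T S, Q k := fun T hT => by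
    obtain ⟨k, hk⟩ := hne T hT
    exact (hk₀ k).trans (Finset.single_le_sum (f := Q) (fun k _ => hQ0 k) hk)
  have hwB₀ : ∀ T, w T ≤ B₀ := fun T => by
    have := hle T 0 (Finset.sum_nonneg fun k _ => hQ0 k)
    simpa using this
  have hwE : ∀ T, T ≠ S → w T ≤ B₀ * E := fun T hT => hle T r ((hS k₀).trans (hge T hT))
  have hwT : ∀ T, T ≠ S → w T ≤ B₀ ^ 2 * w T₀ := fun T hT => by
    have h1 := hle T _ (hge T hT)
    nlinarith
  have hnb : ∀ T, T ≠ S → (¬ ∃ k, symmDiff T S = {k}) → w T ≤ K * E * w T₀ := fun T hT hnb => by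
    obtain ⟨k, hk⟩ := hne T hT
    have hk2 : ∃ k' ∈ symmDiff T S, k' ≠ k := by
      by_contra hcon
      push Not at hcon
      exact hnb ⟨k, Finset.eq_singleton_iff_unique_mem.2 ⟨hk, hcon⟩⟩
    obtain ⟨k', hk', hkk'⟩ := hk2
    have h1 : Q k₀ + r ≤ ∑ k ∈ symmDiff T S, Q k := by
      have h2 : Q k + Q k' ≤ ∑ k ∈ symmDiff T S, Q k := by
        rw [← Finset.sum_pair hkk'.symm]
        exact Finset.sum_le_sum_of_subset_of_nonneg
          (Finset.insert_subset hk (Finset.singleton_subset_iff.2 hk')) fun j _ _ => hQ0 j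
      linarith [hk₀ k, hS k']
    have h2 := hle T _ h1
    rw [mul_add, Real.exp_add, ← hE] at h2
    have h3 : B₀ * (Real.exp (-2 * Q k₀) * E) ≤ B₀ * (B₀ * w T₀ * E) := by gcongr
    have h4 : B₀ ^ 2 * (E * w T₀) ≤ K * (E * w T₀) := by
      have := hw T₀
      gcongr
    linarith
  have hcurv : curv g h₀ a s x t ≤ n ^ 2 * (B₀ * E * B₀ * (2 * L ^ 2)) := by
    rw [curv_eq_nweight H.a_pos H.inj S]
    have h1 := expVar_le S hw (freq_bounds (h₀ := h₀) a) hwB₀ hwE (by positivity)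
    have h2 : 1 ≤ ∑ T, w T := by
      rw [← hwS]
      exact Finset.single_le_sum (f := w) (fun T _ => (hw T).le) (Finset.mem_univ S)
    have h3 : 1 ≤ (∑ T, w T) ^ 2 := one_le_pow₀ h2
    exact (div_le_self (expVar_nonneg _ _ hw) h3).trans h1
  have hz : |velV g h₀ a s x y t / y| ≤ K * E := by
    refine (abs_velV_div_le H s x t hy0 hy).trans ?_
    calc velFactor g h₀ * (16 * L * curv g h₀ a s x t)
        ≤ velFactor g h₀ * (16 * L * (n ^ 2 * (B₀ * E * B₀ * (2 * L ^ 2)))) := by gcongr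
      _ = velFactor g h₀ * (16 * L * (n ^ 2 * (B₀ * B₀ * (2 * L ^ 2)))) * E := by ring
      _ ≤ _ := by
        rw [hK]
        gcongr
        have : 0 ≤ B₀ ^ 2 := by positivity
        linarith
  -- `m` is a lower bound for frequency times rate over all neighbours of `S`: `4b²m₁` for the
  -- derivative of `psi`, and `2b` for `psi` with `S` empty or `-psi` with `S` full, when toggling
  -- only adds or only removes solitons.
  have key : ∀ (ρ : Finset (Fin N) × Finset (Fin N) × Finset (Fin N) × Finset (Fin N) → ℝ)
      (rt : Finset (Fin N) → ℝ) (z m : ℝ), (∀ q, |ρ q| ≤ P) → |z| ≤ K * E →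
      (∀ T, ρ (T, S, S, S) = rt T) → (∀ T, ρ (S, T, S, S) = rt T) → 0 ≤ m →
      (∀ T k, symmDiff T S = {k} → m ≤ (freq h₀ a T - freq h₀ a S) * rt T) →
      C * E < 4 * b ^ 2 * m / 4 →
      0 < ∑ q, quadWeight w q * quadKernel (freq h₀ a) ρ y z q := by
    intro ρ rt z m hρ hz hρ1 hρ2 hm hrt hsmall
    refine sum_quadKernel_pos (m := 4 * b ^ 2 * m / 4) (θ := K * E) (B := B₀ ^ 2) (P := P) S T₀
      (fun T => ∃ k, symmDiff T S = {k})
      hw (freq_bounds (h₀ := h₀) a) hy0 hy hρ hz hθ1.le hB2 hwS (fun T => (hwB₀ T).trans hB1)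
      (fun T hT => (hwE T hT).trans (by gcongr)) hwT hnb hρ1 hρ2
      (fun T ⟨k, hk⟩ => hm.trans (hrt T k hk)) ?_ (hm.trans (hrt T₀ k₀ hT₀S)) ?_
    · rw [sq_freq_sub hT₀S]
      have h1 := hrt T₀ k₀ hT₀S
      have h2 := hb k₀
      gcongr
    · refine lt_of_eq_of_lt ?_ hsmall
      rw [hC]; ring
  refine ⟨?_, ?_, ?_⟩
  · have hu0 := (velU_pos H.one_le H.g_pos H.h_pos H.a_pos H.inj s x t (y := y)
      (by rwa [abs_of_pos hy0])).le
    have huc := speed_sub_velU_ge H s x t hy0 hy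
    refine key _ (rate g h₀ a S (velU g h₀ a s x y t)) _ (4 * b ^ 2 * m₁) (fun q => ?_) hz ?_ ?_
      (by positivity) ?_ hθ2
    · refine (abs_quadRate_le (M := M) (fun T => abs_rate_le H.h_pos H.a_pos hu0
        (fun i => by linarith [huc i]) S T) q).trans ?_
      rw [hP]; linarith
    · intro T; simp only [quadRate, rate_self]; ring
    · intro T; simp only [quadRate, rate_self]; ring
    · intro T k hk
      rw [freq_mul_rate hk]
      have h1 := hb k
      have h2 := huc k
      gcongr
  · intro hSe
    rw [psi_eq_sum]
    refine key _ (fun _ => 1) 0 (2 * b) (fun q => ?_) (by rw [abs_zero]; positivity)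
      (fun _ => rfl) (fun _ => rfl) (by positivity) ?_ hθ3
    · rw [abs_one, hP]; linarith
    · intro T k hk
      rw [freq_sub_of_symmDiff hk, hSe, if_neg (Finset.notMem_empty k)]
      linarith [hb k]
  · intro hSe
    rw [← neg_pos, neg_psi_eq_sum]
    refine key _ (fun _ => -1) 0 (2 * b) (fun q => ?_) (by rw [abs_zero]; positivity)
      (fun _ => rfl) (fun _ => rfl) (by positivity) ?_ hθ3
    · rw [abs_neg, abs_one, hP]; linarith
    · intro T k hk
      rw [freq_sub_of_symmDiff hk, hSe, if_pos (Finset.mem_univ k)]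
      linarith [hb k]

end

end KdVSoliton

/-! ### Close to one soliton: `psi` behaves like `q - q³` -/

namespace KdVSoliton

noncomputable section

variable {N : ℕ}

theorem symmDiff_insert_self {S : Finset (Fin N)} {i : Fin N} (hi : i ∉ S) :
    symmDiff (insert i S) S = {i} := by
  ext k
  simp only [Finset.mem_symmDiff, Finset.mem_insert, Finset.mem_singleton]
  constructor
  · rintro (⟨h1 | h1, h2⟩ | ⟨h1, h2⟩)
    · exact h1
    · exact absurd h1 h2
    · exact absurd (Or.inr h1) h2
  · rintro rfl; exact Or.inl ⟨Or.inl rfl, hi⟩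

theorem core_pos {ψ A q e b B c : ℝ} (h : |ψ - A * (q - q ^ 3)| ≤ e) (hb : 0 < b) (hA : b ≤ A)
    (hB : 0 < B) (hc : 0 ≤ c) (hq : B⁻¹ ≤ q) (hq2 : c ≤ 1 - q ^ 2) (he : e < b * (B⁻¹ * c)) :
    0 < ψ := by
  have h1 : b * (B⁻¹ * c) ≤ A * (q * (1 - q ^ 2)) := by
    have : 0 < B⁻¹ := inv_pos.2 hB
    have : 0 < A := by linarith
    have : 0 < q := by linarith
    gcongr
  have h2 := (abs_le.1 h).1
  have h3 : A * (q - q ^ 3) = A * (q * (1 - q ^ 2)) := by ring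
  linarith

theorem core_neg {ψ A q e b c : ℝ} (h : |ψ - A * (q - q ^ 3)| ≤ e) (hb : 0 < b) (hA : b ≤ A)
    (hc : 0 ≤ c) (hq : 1 ≤ q) (hq2 : c ≤ q ^ 2 - 1) (he : e < b * c) : ψ < 0 := by
  have h1 : b * c ≤ A * (q * (q ^ 2 - 1)) := by
    have : 0 < A := by linarith
    have h2 : c ≤ q * (q ^ 2 - 1) := by nlinarith
    gcongr
  have h2 := (abs_le.1 h).2
  have h3 : A * (q - q ^ 3) = -(A * (q * (q ^ 2 - 1))) := by ring
  linarith

/-- The main part is `-d² q (rt σ (3q²-1) - κ(1-q²))`. Near `q = 1` the first bracketed term is at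
least `b m d/2`, while `κ`, which carries the vertical motion and is not small, is multiplied by
`1-q²`, at most `τ` in modulus. -/
theorem core_deriv_neg {ψ d σ q rt κ e b m τ Z : ℝ}
    (h : |ψ - d ^ 2 * (q * (rt * σ + κ) - q ^ 3 * (3 * rt * σ + κ))| ≤ e) (hb : 0 < b) (hm : 0 < m)
    (hd : 2 * b ≤ d) (hσ : d / 2 ≤ σ) (hrt : 2 * b * m ≤ rt) (hκ : |κ| ≤ 2 * d * Z) (hq0 : 0 < q)
    (hτ : τ ≤ 1 / 2) (hτZ : 8 * Z * τ ≤ b * m) (hq1 : 1 - τ ≤ q ^ 2) (hq2 : q ^ 2 ≤ 1 + τ)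
    (he : e < b ^ 4 * m) : ψ < 0 := by
  have hd0 : 0 < d := by linarith
  have hqhalf : 1 / 2 ≤ q := by nlinarith
  have hrt0 : 0 ≤ rt := by
    have : 0 < 2 * b * m := by positivity
    linarith
  have h3 : b * m * d ≤ rt * σ := by
    calc b * m * d = 2 * b * m * (d / 2) := by ring
      _ ≤ _ := by gcongr
  have h4 : b * m * d / 2 ≤ rt * σ * (3 * q ^ 2 - 1) := by
    have : (1 : ℝ) / 2 ≤ 3 * q ^ 2 - 1 := by linarith
    calc b * m * d / 2 = b * m * d * (1 / 2) := by ring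
      _ ≤ _ := by
        have h0 : 0 ≤ b * m * d := by positivity
        have h1 := h0.trans h3
        gcongr
  have h5 : |κ * (1 - q ^ 2)| ≤ 2 * d * Z * τ := by
    rw [abs_mul]
    have : |1 - q ^ 2| ≤ τ := by rw [abs_le]; constructor <;> linarith
    have : 0 ≤ 2 * d * Z := (abs_nonneg _).trans hκ
    gcongr
  have h6 : b * m * d / 4 ≤ rt * σ * (3 * q ^ 2 - 1) - κ * (1 - q ^ 2) := by
    have h7 := (abs_le.1 h5).2
    have h8 := mul_le_mul_of_nonneg_left hτZ hd0.le
    nlinarith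
  have h7 : b ^ 4 * m ≤ d ^ 2 * q * (rt * σ * (3 * q ^ 2 - 1) - κ * (1 - q ^ 2)) := by
    calc b ^ 4 * m = (2 * b) ^ 2 * (1 / 2) * (b * m * (2 * b) / 4) := by ring
      _ ≤ d ^ 2 * q * (b * m * d / 4) := by gcongr
      _ ≤ _ := by gcongr
  have h8 : d ^ 2 * (q * (rt * σ + κ) - q ^ 3 * (3 * rt * σ + κ))
      = -(d ^ 2 * q * (rt * σ * (3 * q ^ 2 - 1) - κ * (1 - q ^ 2))) := by ring
  have h9 := (abs_le.1 h).2
  rw [h8] at h9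
  linarith

/-- The normalized weights if only soliton `i` is close. -/
theorem core_weights {g h₀ : ℝ} {a : Fin N → ℝ} (H : Admissible g h₀ a) {B₀ : ℝ} (hB₀ : 1 ≤ B₀)
    (hratio : ∀ S T, alphaSet a T / alphaSet a S ≤ B₀) {r R : ℝ} (hR0 : 0 ≤ R) {s : Fin N → ℝ}
    {S : Finset (Fin N)} {i : Fin N} {x t : ℝ} (hi : i ∉ S) (hir : |phase g h₀ a s i x t| ≤ r)
    (hfar : ∀ k, k ≠ i → R ≤ signedPhase g h₀ a s S k x t) :
    (∀ T, nweight g h₀ a s S x t T ≤ B₀ * Real.exp (2 * r)) ∧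
    (B₀ * Real.exp (2 * r))⁻¹ ≤ nweight g h₀ a s S x t (insert i S) ∧
    (∀ T, T ≠ S → T ≠ insert i S →
      nweight g h₀ a s S x t T ≤ B₀ * Real.exp (2 * r) * Real.exp (-2 * R)) := by
  have hr0 : 0 ≤ r := (abs_nonneg _).trans hir
  have hsd : symmDiff (insert i S) S = {i} := symmDiff_insert_self hi
  have hratio' : ∀ T, B₀⁻¹ ≤ alphaSet a T / alphaSet a S := fun T => by
    rw [← inv_div]
    have h2 := alphaSet_pos H.a_pos H.inj T
    have h3 := alphaSet_pos H.a_pos H.inj S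
    exact inv_anti₀ (by positivity) (hratio T S)
  have hle : ∀ T c, c ≤ ∑ k ∈ symmDiff T S, signedPhase g h₀ a s S k x t →
      nweight g h₀ a s S x t T ≤ B₀ * Real.exp (-2 * c) := by
    intro T c hc
    rw [nweight_eq]
    exact mul_le_mul (hratio S T) (Real.exp_le_exp.2 (by linarith)) (Real.exp_pos _).le
      (by linarith)
  have hQi : signedPhase g h₀ a s S i x t = phase g h₀ a s i x t := by
    simp only [signedPhase, if_neg hi]
  rw [abs_le] at hir
  have hup : nweight g h₀ a s S x t (insert i S) ≤ B₀ * Real.exp (2 * r) := by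
    refine (hle (insert i S) (-r) ?_).trans_eq (by ring_nf)
    rw [hsd, Finset.sum_singleton, hQi]; linarith
  have hθ : ∀ T, T ≠ S → T ≠ insert i S →
      nweight g h₀ a s S x t T ≤ B₀ * Real.exp (2 * r) * Real.exp (-2 * R) := by
    intro T hT hT'
    have hj : ∃ j ∈ symmDiff T S, j ≠ i := by
      by_contra hcon
      push Not at hcon
      rcases (Finset.subset_singleton_iff.1 (fun k hk => Finset.mem_singleton.2 (hcon k hk)) :
        symmDiff T S = ∅ ∨ symmDiff T S = {i}) with h | h
      · exact hT (symmDiff_eq_bot.1 h)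
      · exact hT' (symmDiff_left_injective S (h.trans hsd.symm))
    obtain ⟨j, hj, hji⟩ := hj
    -- Some `j ≠ i` contributes at least `R`, and only soliton `i` may contribute negatively, at
    -- least `-r`; adding `r` to its term makes all terms nonnegative.
    have h1 : R - r ≤ ∑ k ∈ symmDiff T S, signedPhase g h₀ a s S k x t := by
      have h2 : signedPhase g h₀ a s S j x t + (if j = i then r else 0)
          ≤ ∑ k ∈ symmDiff T S, (signedPhase g h₀ a s S k x t + if k = i then r else 0) := by
        refine Finset.single_le_sum
          (f := fun k => signedPhase g h₀ a s S k x t + if k = i then r else 0) (fun k _ => ?_) hj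
        by_cases h : k = i
        · rw [if_pos h, h, hQi]; linarith
        · rw [if_neg h]; linarith [hfar k h]
      rw [Finset.sum_add_distrib, if_neg hji, Finset.sum_ite_eq'] at h2
      have h3 := hfar j hji
      have h4 : (if i ∈ symmDiff T S then r else 0) ≤ r := by split_ifs <;> linarith
      linarith
    refine (hle T _ h1).trans_eq ?_
    rw [mul_assoc, ← Real.exp_add]; ring_nf
  refine ⟨fun T => ?_, ?_, hθ⟩
  · have hE1 : 1 ≤ Real.exp (2 * r) := Real.one_le_exp (by linarith)
    by_cases h1 : T = S
    · rw [h1, nweight_self H.a_pos H.inj]; nlinarith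
    · by_cases h2 : T = insert i S
      · rw [h2]; exact hup
      · exact (hθ T h1 h2).trans (mul_le_of_le_one_right (by positivity)
          (Real.exp_le_one_iff.2 (by linarith)))
  · rw [nweight_eq, hsd, Finset.sum_singleton, hQi, mul_inv, ← Real.exp_neg]
    exact mul_le_mul (hratio' _) (Real.exp_le_exp.2 (by linarith)) (Real.exp_pos _).le
      ((inv_nonneg.2 (by linarith)).trans (hratio' _))

/-- If the particle is close to soliton `i` only, then `psi` changes its sign where the normalized
weight of this soliton is about one. -/
theorem exists_core_radius {g h₀ : ℝ} {a : Fin N → ℝ} (H : Admissible g h₀ a) :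
    ∃ ρ₀ : ℝ, 0 < ρ₀ ∧ ∀ ρ, 0 < ρ → ρ ≤ ρ₀ → ∀ r : ℝ, ∃ R₀ : ℝ, 0 < R₀ ∧ ∀ R, R₀ ≤ R →
      ∀ (s : Fin N → ℝ) (S : Finset (Fin N)) (i : Fin N) (x y t : ℝ), i ∉ S → 0 < y →
      (∑ i, beta h₀ (a i)) * y ≤ Real.pi / 4 → |phase g h₀ a s i x t| ≤ r →
      (∀ k, k ≠ i → R ≤ signedPhase g h₀ a s S k x t) →
      (nweight g h₀ a s S x t (insert i S) ≤ Real.exp (-2 * ρ) → 0 < psi g h₀ a s S x y t) ∧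
      (Real.exp (2 * ρ) ≤ nweight g h₀ a s S x t (insert i S) → psi g h₀ a s S x y t < 0) ∧
      (Real.exp (-2 * ρ) ≤ nweight g h₀ a s S x t (insert i S) →
        nweight g h₀ a s S x t (insert i S) ≤ Real.exp (2 * ρ) →
        psiDeriv g h₀ a s S x y t < 0) := by
  obtain ⟨B₀, hB₀, hratio⟩ := exists_alphaSet_ratio_le a H.a_pos H.inj
  obtain ⟨b, hb0, hb⟩ := exists_beta_lower H.one_le H.h_pos H.a_pos
  have hgap := speedGap_pos H
  have hspeed := fun s x t y => speed_sub_velU_ge H s x t (y := y)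
  generalize √(g / h₀) * (h₀ - 2 * ⨆ i, a i) = m₁ at hgap hspeed
  have hfb := freq_bounds (h₀ := h₀) a
  have hL0 : 0 < ∑ i, beta h₀ (a i) := sum_beta_pos H.one_le H.h_pos H.a_pos
  have hrate := fun u => abs_rate_le (g := g) (u := u) H.h_pos H.a_pos
  have hM0 : 0 ≤ ∑ i, 2 * beta h₀ (a i) * speed g h₀ (a i) := Finset.sum_nonneg fun i _ => by
    have := beta_pos H.h_pos (H.a_pos i)
    have := speed_pos H.g_pos H.h_pos (H.a_pos i)
    positivity
  generalize ∑ i, 2 * beta h₀ (a i) * speed g h₀ (a i) = M at hrate hM0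
  have hA := iSup_amplitude_pos H.one_le H.a_pos
  obtain ⟨Z, hZ0, hZ⟩ : ∃ Z : ℝ, 0 ≤ Z ∧ ∀ s x t y, 0 < y →
      (∑ i, beta h₀ (a i)) * y ≤ Real.pi / 4 → |velV g h₀ a s x y t / y| ≤ Z := by
    refine ⟨16 * (∑ i, beta h₀ (a i)) * (√(g / h₀) * ⨆ i, a i), by positivity,
      fun s x t y hy0 hy => (abs_velV_div_le H s x t hy0 hy).trans ?_⟩
    have := velFactor_mul_curv_le (g := g) H.one_le H.h_pos H.a_pos H.inj s x t
    nlinarith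
  -- `τ` is the tolerance for `q²` about one that `core_deriv_neg` needs; with `ρ₀ = log(1+τ)/4`,
  -- weights in `[e^{-2ρ}, e^{2ρ}]` satisfy `|q²-1| ≤ τ`.
  obtain ⟨τ, hτ0, hτ1, hτ2⟩ : ∃ τ : ℝ, 0 < τ ∧ τ ≤ 1 / 2 ∧ 8 * Z * τ ≤ b * m₁ := by
    refine ⟨min (1 / 2) (b * m₁ / (8 * (Z + 1))), by positivity, min_le_left _ _, ?_⟩
    have h1 : min (1 / 2) (b * m₁ / (8 * (Z + 1))) ≤ b * m₁ / (8 * (Z + 1)) := min_le_right _ _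
    rw [le_div_iff₀ (by positivity)] at h1
    have h2 : 0 ≤ min (1 / 2) (b * m₁ / (8 * (Z + 1))) := by positivity
    linarith
  refine ⟨Real.log (1 + τ) / 4, div_pos (Real.log_pos (by linarith)) (by norm_num), ?_⟩
  intro ρ hρ0 hρ1 r
  have hexpρ : Real.exp (4 * ρ) ≤ 1 + τ := by
    rw [← Real.le_log_iff_exp_le (by positivity)]; linarith
  have hexpρ1 : 1 < Real.exp (4 * ρ) := Real.one_lt_exp_iff.2 (by linarith)
  have hexpn : Real.exp (-(4 * ρ)) < 1 := Real.exp_lt_one_iff.2 (by linarith)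
  have hexpn' : 1 - τ ≤ Real.exp (-(4 * ρ)) := by
    have h1 : Real.exp (4 * ρ) * Real.exp (-(4 * ρ)) = 1 := by rw [← Real.exp_add]; simp
    nlinarith [Real.exp_pos (-(4 * ρ))]
  have hsq1 : Real.exp (2 * ρ) ^ 2 = Real.exp (4 * ρ) := by
    rw [← Real.exp_nat_mul]; congr 1; push_cast; ring
  have hsq2 : Real.exp (-2 * ρ) ^ 2 = Real.exp (-(4 * ρ)) := by
    rw [← Real.exp_nat_mul]; congr 1; push_cast; ring
  obtain ⟨B, hB⟩ : ∃ B : ℝ, B = B₀ * Real.exp (2 * r) := ⟨_, rfl⟩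
  have hB0 : 0 < B := by rw [hB]; have := Real.exp_pos (2 * r); positivity
  obtain ⟨C, hC⟩ : ∃ C : ℝ, C = Fintype.card (Finset (Fin N) × Finset (Fin N) × Finset (Fin N)
    × Finset (Fin N)) * (B * B ^ 3 * (8 * (∑ i, beta h₀ (a i)) ^ 3 * (4 * M + 1 + 2 * Z))) :=
    ⟨_, rfl⟩
  obtain ⟨r₁, hr₁, hr₁'⟩ := exists_forall_mul_exp_lt C
    (c := 4 * b ^ 3 * (B⁻¹ * (1 - Real.exp (-(4 * ρ)))))
    (by have : 0 < 1 - Real.exp (-(4 * ρ)) := by linarith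
        positivity)
  obtain ⟨r₂, hr₂, hr₂'⟩ := exists_forall_mul_exp_lt C
    (c := 4 * b ^ 3 * (Real.exp (4 * ρ) - 1))
    (by have : 0 < Real.exp (4 * ρ) - 1 := by linarith
        positivity)
  obtain ⟨r₃, hr₃, hr₃'⟩ := exists_forall_mul_exp_lt C (c := b ^ 4 * m₁) (by positivity)
  refine ⟨max r₁ (max r₂ r₃), by positivity, fun R hR s S i x y t hi hy0 hy hir hfar => ?_⟩
  have hR1 := hr₁' R ((le_max_left _ _).trans hR)
  have hR2 := hr₂' R (((le_max_left _ _).trans (le_max_right _ _)).trans hR)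
  have hR3 := hr₃' R (((le_max_right _ _).trans (le_max_right _ _)).trans hR)
  have hR0 : 0 < R := hr₁.trans_le ((le_max_left _ _).trans hR)
  obtain ⟨hwB, hwlow, hwθ⟩ := core_weights H hB₀ hratio hR0.le hi hir hfar
  rw [← hB] at hwB hwlow hwθ
  have hw := nweight_pos (g := g) (h₀ := h₀) H.a_pos H.inj s S x t
  have hwS := nweight_self (g := g) (h₀ := h₀) H.a_pos H.inj s S x t
  have hSS : S ≠ insert i S := fun h => hi (by rw [h]; exact Finset.mem_insert_self i S)
  have hsd : symmDiff (insert i S) S = {i} := symmDiff_insert_self hi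
  have hdeq : freq h₀ a (insert i S) - freq h₀ a S = 2 * beta h₀ (a i) := by
    rw [freq_sub_of_symmDiff hsd, if_neg hi]
  have hbi := hb i
  have hbL : beta h₀ (a i) ≤ ∑ i, beta h₀ (a i) :=
    Finset.single_le_sum (f := fun i => beta h₀ (a i)) (fun j _ => Real.sqrt_nonneg _)
      (Finset.mem_univ i)
  have hdb : 2 * b ≤ freq h₀ a (insert i S) - freq h₀ a S := by rw [hdeq]; linarith
  have hdy : |freq h₀ a (insert i S) - freq h₀ a S| * y ≤ Real.pi / 2 := by
    rw [hdeq, abs_of_pos (by linarith)]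
    have := mul_le_mul_of_nonneg_right hbL hy0.le
    linarith
  have hD0 := Real.exp_pos (-2 * R)
  have hpsi := abs_sum_quadKernel_sub_le (ρ := fun _ => 1) (y := y) (z := 0) (P := 4 * M + 1)
    (Z := Z) (θ := B * Real.exp (-2 * R)) (ρ₁ := 1) (ρ₃ := 1) S (insert i S) hSS
    (by positivity) hw hfb hy0 (fun q => by rw [abs_one]; linarith) (by rw [abs_zero]; exact hZ0)
    hwS hwB hwθ rfl rfl rfl rfl
  rw [← psi_eq_sum] at hpsi
  have hu0 := (velU_pos H.one_le H.g_pos H.h_pos H.a_pos H.inj s x t (y := y)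
    (by rwa [abs_of_pos hy0])).le
  have huc := hspeed s x t y hy0 hy
  have hrS : rate g h₀ a S (velU g h₀ a s x y t) S = 0 := rate_self g h₀ a S _
  -- A product with one factor `q` grows at the rate of `q`, the cube at three times that rate; this
  -- difference leaves a definite sign at `q = 1`.
  have hder := abs_sum_quadKernel_sub_le (ρ := quadRate (rate g h₀ a S (velU g h₀ a s x y t)))
    (y := y) (z := velV g h₀ a s x y t / y) (P := 4 * M + 1) (Z := Z)
    (θ := B * Real.exp (-2 * R)) (ρ₁ := rate g h₀ a S (velU g h₀ a s x y t) (insert i S))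
    (ρ₃ := 3 * rate g h₀ a S (velU g h₀ a s x y t) (insert i S)) S (insert i S) hSS
    (by positivity) hw hfb hy0
    (fun q => (abs_quadRate_le (M := M) (fun T => hrate _ hu0
      (fun i => by linarith [huc i]) S T) q).trans (by linarith))
    (hZ s x t y hy0 hy) hwS hwB hwθ (by simp only [quadRate, hrS]; ring)
    (by simp only [quadRate, hrS]; ring) (by simp only [quadRate, hrS]; ring)
    (by simp only [quadRate, hrS]; ring)
  have hrt : 2 * b * m₁ ≤ rate g h₀ a S (velU g h₀ a s x y t) (insert i S) := by
    rw [rate_of_symmDiff hsd, if_neg hi]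
    have := huc i
    have := beta_pos H.h_pos (H.a_pos i)
    gcongr
  have e1 : Fintype.card (Finset (Fin N) × Finset (Fin N) × Finset (Fin N)
      × Finset (Fin N)) * (B * Real.exp (-2 * R) * B ^ 3 *
        (8 * (∑ i, beta h₀ (a i)) ^ 3 * (4 * M + 1 + 2 * Z))) = C * Real.exp (-2 * R) := by
    rw [hC]; ring
  rw [e1] at hpsi hder
  generalize freq h₀ a (insert i S) - freq h₀ a S = d at *
  have hd0 : 0 < d := by linarith
  have hσ1 : d / 2 ≤ Real.sin (d * y) / y := by
    have := mul_sin_div_ge (r := 1) hy0 hdy (by linarith)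
    rw [mul_one, one_mul] at this
    exact this
  have hσ2 : |Real.sin (d * y) / y| ≤ d := (abs_sin_mul_div_le d hy0).trans (abs_of_pos hd0).le
  have hq0 := hw (insert i S)
  generalize nweight g h₀ a s S x t (insert i S) = q at *
  have hd3 : 4 * b ^ 3 ≤ d ^ 2 * (Real.sin (d * y) / y) := by
    calc 4 * b ^ 3 = (2 * b) ^ 2 * (2 * b / 2) := by ring
      _ ≤ d ^ 2 * (Real.sin (d * y) / y) := by
        have : 2 * b / 2 ≤ Real.sin (d * y) / y := by linarith
        gcongr
  have hpsi' : |psi g h₀ a s S x y t - d ^ 2 * (Real.sin (d * y) / y) * (q - q ^ 3)|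
      ≤ C * Real.exp (-2 * R) := by
    refine le_of_eq_of_le ?_ hpsi
    congr 1
    ring
  refine ⟨fun hqρ => ?_, fun hqρ => ?_, fun hq1 hq2 => ?_⟩
  · refine core_pos hpsi' (by positivity) hd3 hB0 (sub_nonneg.2 hexpn.le) hwlow ?_ hR1
    have := pow_le_pow_left₀ hq0.le hqρ 2
    linarith
  · refine core_neg hpsi' (by positivity) hd3 (sub_nonneg.2 hexpρ1.le)
      ((Real.one_le_exp (by linarith)).trans hqρ) ?_ hR2
    have := pow_le_pow_left₀ (Real.exp_pos _).le hqρ 2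
    linarith
  · refine core_deriv_neg hder hb0 hgap hdb hσ1 hrt (Z := Z) (τ := τ) ?_ hq0 hτ1 hτ2 ?_ ?_ hR3
    · rw [abs_mul]
      have h2 : |d * Real.cos (d * y) - Real.sin (d * y) / y| ≤ 2 * d := by
        refine (abs_sub _ _).trans ?_
        have : |d * Real.cos (d * y)| ≤ d := by
          rw [abs_mul, abs_of_pos hd0]
          exact mul_le_of_le_one_right hd0.le (Real.abs_cos_le_one (d * y))
        linarith
      exact mul_le_mul h2 (hZ s x t y hy0 hy) (abs_nonneg _) (by positivity)
    · have := pow_le_pow_left₀ (Real.exp_pos _).le hq1 2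
      linarith
    · have := pow_le_pow_left₀ hq0.le hq2 2
      linarith

end

end KdVSoliton

/-! ### Order of passage and the alternating sign pattern -/

namespace KdVSoliton

noncomputable section

variable {N : ℕ}

theorem exists_zero_of_deriv_pos {f f' : ℝ → ℝ} {t₁ t₂ : ℝ} (h12 : t₁ < t₂)
    (hf : ∀ t ∈ Set.Icc t₁ t₂, HasDerivAt f (f' t) t) (hf' : ∀ t ∈ Set.Icc t₁ t₂, 0 < f' t)
    (h1 : f t₁ < 0) (h2 : 0 < f t₂) :
    ∃ d ∈ Set.Ioo t₁ t₂, (∀ t ∈ Set.Ico t₁ d, f t < 0) ∧ ∀ t ∈ Set.Ioc d t₂, 0 < f t := by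
  have hcont : ContinuousOn f (Set.Icc t₁ t₂) := fun t ht =>
    (hf t ht).continuousAt.continuousWithinAt
  have hmono : StrictMonoOn f (Set.Icc t₁ t₂) := by
    refine strictMonoOn_of_deriv_pos (convex_Icc _ _) hcont fun t ht => ?_
    have ht' := interior_subset ht
    rw [(hf t ht').deriv]
    exact hf' t ht'
  obtain ⟨d, hd, hd0⟩ := intermediate_value_Ioo h12.le hcont ⟨h1, h2⟩
  have hd' := Set.Ioo_subset_Icc_self hd
  refine ⟨d, hd, fun t ht => ?_, fun t ht => ?_⟩
  · rw [← hd0]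
    exact hmono ⟨ht.1, ht.2.le.trans hd.2.le⟩ hd' ht.2
  · rw [← hd0]
    exact hmono hd' ⟨hd.1.le.trans ht.1.le, ht.2⟩ ht.1

/-- The alternating pattern of signs that results from zeros `c k` between `e k` and `x k`, and
zeros `d k` between `x k` and `e (k + 1)`. -/
theorem exists_alternating {V : ℝ → ℝ} {e x c d : ℕ → ℝ} (hN : 1 ≤ N)
    (hstart : ∀ t ≤ e 0, 0 < V t) (hend : ∀ t, x (N - 1) ≤ t → V t < 0)
    (hc : ∀ k < N, c k ∈ Set.Ioo (e k) (x k))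
    (hc1 : ∀ k < N, ∀ t ∈ Set.Ico (e k) (c k), 0 < V t)
    (hc2 : ∀ k < N, ∀ t ∈ Set.Ioc (c k) (x k), V t < 0)
    (hd : ∀ k, k + 1 < N → d k ∈ Set.Ioo (x k) (e (k + 1)))
    (hd1 : ∀ k, k + 1 < N → ∀ t ∈ Set.Ico (x k) (d k), V t < 0)
    (hd2 : ∀ k, k + 1 < N → ∀ t ∈ Set.Ioc (d k) (e (k + 1)), 0 < V t) :
    ∃ τ : ℕ → ℝ, (∀ k, τ (2 * k + 1) = c k) ∧ StrictMonoOn τ (Set.Icc 1 (2 * N - 1)) ∧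
      (∀ t, (t < τ 1 ∨ ∃ k ∈ Set.Icc 1 (N - 1), t ∈ Set.Ioo (τ (2 * k)) (τ (2 * k + 1))) →
        0 < V t) ∧
      (∀ t, ((∃ k ∈ Set.Icc 1 (N - 1), t ∈ Set.Ioo (τ (2 * k - 1)) (τ (2 * k))) ∨
        τ (2 * N - 1) < t) → V t < 0) := by
  -- Times are numbered from one, the zeros `c`, `d` from zero: `τ (2k+1) = c k` and `τ (2k+2) = d
  -- k`. The value at `0` is irrelevant.
  obtain ⟨τ, hτ⟩ : ∃ τ : ℕ → ℝ, τ = fun n => if n % 2 = 1 then c (n / 2) else d (n / 2 - 1) :=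
    ⟨_, rfl⟩
  have hodd : ∀ k, τ (2 * k + 1) = c k := fun k => by
    simp only [hτ]
    rw [if_pos (by omega)]
    congr 1
    omega
  have heven : ∀ k, τ (2 * k + 2) = d k := fun k => by
    simp only [hτ]
    rw [if_neg (by omega)]
    congr 1
    omega
  have hlast : 2 * N - 1 = 2 * (N - 1) + 1 := by omega
  refine ⟨τ, hodd, ?_, ?_, ?_⟩
  · refine strictMonoOn_of_lt_add_one Set.ordConnected_Icc fun n _ hn hn' => ?_
    rcases Nat.even_or_odd' n with ⟨k, rfl | rfl⟩
    · obtain ⟨l, rfl⟩ : ∃ l, k = l + 1 := ⟨k - 1, by have := hn.1; omega⟩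
      have hl : l + 1 < N := by have := hn'.2; omega
      rw [show 2 * (l + 1) + 1 = 2 * (l + 1) + 1 from rfl, hodd, mul_add, mul_one, heven]
      exact (hd l hl).2.trans (hc (l + 1) hl).1
    · have hl : k + 1 < N := by have := hn'.2; omega
      rw [hodd, show 2 * k + 1 + 1 = 2 * k + 2 from rfl, heven]
      exact (hc k (by omega)).2.trans (hd k hl).1
  · rintro t (ht | ⟨k, hk, ht⟩)
    · have h0 : τ 1 = c 0 := hodd 0
      rw [h0] at ht
      by_cases h : t ≤ e 0
      · exact hstart t h
      · exact hc1 0 hN t ⟨(not_le.1 h).le, ht⟩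
    · obtain ⟨l, rfl⟩ : ∃ l, k = l + 1 := ⟨k - 1, by have := hk.1; omega⟩
      have hl : l + 1 < N := by have := hk.1; have := hk.2; omega
      rw [hodd, mul_add, mul_one, heven] at ht
      by_cases h : t ≤ e (l + 1)
      · exact hd2 l hl t ⟨ht.1, h⟩
      · exact hc1 (l + 1) hl t ⟨(not_le.1 h).le, ht.2⟩
  · rintro t (⟨k, hk, ht⟩ | ht)
    · obtain ⟨l, rfl⟩ : ∃ l, k = l + 1 := ⟨k - 1, by have := hk.1; omega⟩
      have hl : l + 1 < N := by have := hk.1; have := hk.2; omega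
      rw [show 2 * (l + 1) - 1 = 2 * l + 1 by omega, hodd, mul_add, mul_one, heven] at ht
      by_cases h : t ≤ x l
      · exact hc2 l (by omega) t ⟨ht.1, h⟩
      · exact hd1 l hl t ⟨(not_le.1 h).le, ht.2⟩
    · rw [hlast, hodd] at ht
      by_cases h : t ≤ x (N - 1)
      · exact hc2 (N - 1) (by omega) t ⟨ht, h⟩
      · exact hend t (not_le.1 h).le

section Ordering

variable {P : Fin N → ℝ → ℝ} {R : ℝ}

/-- If soliton `i` passes the particle before soliton `j`, then it is far ahead while `j` is
close. -/
theorem lt_neg_of_pass_before (hanti : ∀ k, StrictAnti (P k)) (hR : 0 < R)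
    (havoid : ∀ t i j, |P i t| ≤ R → |P j t| ≤ R → i = j) {i j : Fin N} (hij : i ≠ j)
    {ti tj : ℝ} (hi : P i ti = 0) (hj : P j tj = 0) (hle : ti ≤ tj) {t : ℝ} (ht : |P j t| ≤ R) :
    P i t < -R := by
  by_contra hcon
  have h1 : R < P i t := by
    by_contra h2
    exact hij (havoid t i j (abs_le.2 ⟨not_lt.1 hcon, not_lt.1 h2⟩) ht)
  -- Otherwise `i` is still far behind at `t`, hence passes later; at `ti` the phase of `j` lies
  -- between `0` and `P j t ≤ R`, so both phases are small at once.
  have h2 : t < ti := (hanti i).lt_iff_gt.1 (by rw [hi]; linarith)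
  refine hij (havoid ti i j (by rw [hi, abs_zero]; exact hR.le) (abs_le.2 ⟨?_, ?_⟩))
  · have := (hanti j).antitone hle
    linarith
  · exact ((hanti j).antitone h2.le).trans (abs_le.1 ht).2

/-- If soliton `j` passes the particle after soliton `i`, then it is far behind while `i` is
close. -/
theorem lt_of_pass_after (hanti : ∀ k, StrictAnti (P k)) (hR : 0 < R)
    (havoid : ∀ t i j, |P i t| ≤ R → |P j t| ≤ R → i = j) {i j : Fin N} (hij : i ≠ j)
    {ti tj : ℝ} (hi : P i ti = 0) (hj : P j tj = 0) (hle : ti ≤ tj) {t : ℝ} (ht : |P i t| ≤ R) :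
    R < P j t := by
  by_contra hcon
  have h1 : P j t < -R := by
    by_contra h2
    exact hij (havoid t i j ht (abs_le.2 ⟨not_lt.1 h2, not_lt.1 hcon⟩))
  have h2 : tj < t := (hanti j).lt_iff_gt.1 (by rw [hj]; linarith)
  refine hij (havoid tj i j (abs_le.2 ⟨?_, ?_⟩) (by rw [hj, abs_zero]; exact hR.le))
  · exact (abs_le.1 ht).1.trans ((hanti i).antitone h2.le)
  · have := (hanti i).antitone hle
    linarith

/-- The alternating pattern for a family of decreasing phases no two of which are small at the same
time. The set `S` collects the solitons that have passed. -/
theorem exists_passing_times (hN : 1 ≤ N) {V : ℝ → ℝ} {r : ℝ}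
    {Q : Finset (Fin N) → Fin N → ℝ → Prop} (hanti : ∀ k, StrictAnti (P k))
    (hsurj : ∀ k, Function.Surjective (P k)) (hr : 0 < r) (hrR : r ≤ R)
    (havoid : ∀ t i j, |P i t| ≤ R → |P j t| ≤ R → i = j)
    (hcore : ∀ S i t₁ t₂, i ∉ S → P i t₁ = r → P i t₂ = -r →
      (∀ t ∈ Set.Icc t₁ t₂, ∀ k, k ≠ i → R ≤ if k ∈ S then -P k t else P k t) →
      ∃ c ∈ Set.Ioo t₁ t₂, Q S i c ∧ (∀ t ∈ Set.Ico t₁ c, 0 < V t) ∧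
        ∀ t ∈ Set.Ioc c t₂, V t < 0)
    (hgap : ∀ (S : Finset (Fin N)) t₁ t₂, t₁ < t₂ →
      (∀ t ∈ Set.Icc t₁ t₂, ∀ k, r ≤ if k ∈ S then -P k t else P k t) → V t₁ < 0 → 0 < V t₂ →
      ∃ d ∈ Set.Ioo t₁ t₂, (∀ t ∈ Set.Ico t₁ d, V t < 0) ∧ ∀ t ∈ Set.Ioc d t₂, 0 < V t)
    (hstart : ∀ t, (∀ k, r ≤ P k t) → 0 < V t) (hend : ∀ t, (∀ k, r ≤ -P k t) → V t < 0) :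
    ∃ (τ : ℕ → ℝ) (σ : Equiv.Perm (Fin N)), StrictMonoOn τ (Set.Icc 1 (2 * N - 1)) ∧
      (∀ t, (t < τ 1 ∨ ∃ k ∈ Set.Icc 1 (N - 1), t ∈ Set.Ioo (τ (2 * k)) (τ (2 * k + 1))) →
        0 < V t) ∧
      (∀ t, ((∃ k ∈ Set.Icc 1 (N - 1), t ∈ Set.Ioo (τ (2 * k - 1)) (τ (2 * k))) ∨
        τ (2 * N - 1) < t) → V t < 0) ∧
      ∀ k : Fin N, (∀ j < k, P (σ j) (τ (2 * (k : ℕ) + 1)) < -R) ∧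
        (∀ j > k, R < P (σ j) (τ (2 * (k : ℕ) + 1))) ∧
        Q ((Finset.univ.filter fun j => j < k).image σ) (σ k) (τ (2 * (k : ℕ) + 1)) := by
  have hR : 0 < R := hr.trans_le hrR
  choose T hT using hsurj
  -- `T k c` is the time at which soliton `k` has phase `c`; sorting by the times of phase zero
  -- gives the order of passage.
  obtain ⟨σ, hσ⟩ : ∃ σ : Equiv.Perm (Fin N), Monotone ((fun i => T i 0) ∘ σ) :=
    ⟨_, Tuple.monotone_sort _⟩
  have hbefore : ∀ j k, j < k → ∀ t, |P (σ k) t| ≤ R → P (σ j) t < -R := fun j k hjk t ht =>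
    lt_neg_of_pass_before hanti hR havoid (fun h => hjk.ne (σ.injective h)) (hT _ _) (hT _ _)
      (hσ hjk.le) ht
  have hafter : ∀ j k, k < j → ∀ t, |P (σ k) t| ≤ R → R < P (σ j) t := fun j k hjk t ht =>
    lt_of_pass_after hanti hR havoid (fun h => hjk.ne (σ.injective h)) (hT _ _) (hT _ _)
      (hσ hjk.le) ht
  have habs : |r| ≤ R := by rwa [abs_of_pos hr]
  have habs' : |-r| ≤ R := by rwa [abs_neg]
  obtain ⟨A, hA⟩ : ∃ A : ℕ → Finset (Fin N),
      A = fun k => (Finset.univ.filter fun j : Fin N => (j : ℕ) < k).image σ := ⟨_, rfl⟩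
  have hmem : ∀ k j, σ j ∈ A k ↔ (j : ℕ) < k := by
    intro k j
    rw [hA]
    simp
  have hle : ∀ k t c, t ≤ T k c → c ≤ P k t := fun k t c h => by
    have := (hanti k).antitone h
    rwa [hT] at this
  have hge : ∀ k t c, T k c ≤ t → P k t ≤ c := fun k t c h => by
    have := (hanti k).antitone h
    rwa [hT] at this
  -- Soliton `σ k` is within `r` exactly on `[e k, x k]`, and the gap after it is `[x k, e (k+1)]`;
  -- `A k` holds the solitons passed before. The value `0` beyond `N` is never used.
  obtain ⟨e, he⟩ : ∃ e : ℕ → ℝ, ∀ k (h : k < N), e k = T (σ ⟨k, h⟩) r :=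
    ⟨fun k => if h : k < N then T (σ ⟨k, h⟩) r else 0, fun k h => dif_pos h⟩
  obtain ⟨x, hx⟩ : ∃ x : ℕ → ℝ, ∀ k (h : k < N), x k = T (σ ⟨k, h⟩) (-r) :=
    ⟨fun k => if h : k < N then T (σ ⟨k, h⟩) (-r) else 0, fun k h => dif_pos h⟩
  have hcoreAbs : ∀ k (h : k < N), ∀ t ∈ Set.Icc (e k) (x k), |P (σ ⟨k, h⟩) t| ≤ R := by
    intro k h t ht
    rw [he k h, hx k h] at ht
    exact abs_le.2 ⟨by linarith [hle _ _ _ ht.2], (hge _ _ _ ht.1).trans hrR⟩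
  have hcore' : ∀ k, ∃ c, ∀ h : k < N, c ∈ Set.Ioo (e k) (x k) ∧ Q (A k) (σ ⟨k, h⟩) c ∧
      (∀ t ∈ Set.Ico (e k) c, 0 < V t) ∧ ∀ t ∈ Set.Ioc c (x k), V t < 0 := by
    intro k
    by_cases h : k < N
    · obtain ⟨c, hc⟩ := hcore (A k) (σ ⟨k, h⟩) (e k) (x k) (by simp [hmem])
        (by rw [he k h, hT]) (by rw [hx k h, hT]) (fun t ht i hi => by
          obtain ⟨j, rfl⟩ := σ.surjective i
          have hj : j ≠ ⟨k, h⟩ := fun hj => hi (by rw [hj])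
          have ht' := hcoreAbs k h t ht
          rcases lt_or_gt_of_ne hj with hlt | hgt
          · rw [if_pos ((hmem k j).2 hlt)]
            linarith [hbefore _ _ hlt t ht']
          · rw [if_neg (fun hm => (lt_asymm ((hmem k j).1 hm) hgt))]
            exact (hafter _ _ hgt t ht').le)
      exact ⟨c, fun _ => hc⟩
    · exact ⟨0, fun h' => absurd h' h⟩
  choose c hc using hcore'
  have hfar : ∀ k (h : k + 1 < N), ∀ t ∈ Set.Icc (x k) (e (k + 1)), ∀ i,
      r ≤ if i ∈ A (k + 1) then -P i t else P i t := by
    intro k h t ht i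
    have hk : k < N := by omega
    rw [hx k hk, he (k + 1) h] at ht
    obtain ⟨j, rfl⟩ := σ.surjective i
    by_cases hj : (j : ℕ) < k + 1
    · rw [if_pos ((hmem _ j).2 hj)]
      rcases Nat.lt_succ_iff_lt_or_eq.1 hj with hlt | heq
      · have h1 := hbefore j ⟨k, hk⟩ hlt (T (σ ⟨k, hk⟩) (-r)) (by rwa [hT])
        have h2 := (hanti (σ j)).antitone ht.1
        linarith
      · have : j = ⟨k, hk⟩ := Fin.ext heq
        rw [this]
        linarith [hge _ _ _ ht.1]
    · rw [if_neg (fun hm => hj ((hmem _ j).1 hm))]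
      rcases Nat.eq_or_lt_of_le (not_lt.1 hj) with heq | hlt
      · have : j = ⟨k + 1, h⟩ := Fin.ext heq.symm
        rw [this]
        exact hle _ _ _ ht.2
      · have h1 := hafter j ⟨k + 1, h⟩ hlt (T (σ ⟨k + 1, h⟩) r) (by rwa [hT])
        have h2 := (hanti (σ j)).antitone ht.2
        linarith
  have hgap' : ∀ k, ∃ d, k + 1 < N → d ∈ Set.Ioo (x k) (e (k + 1)) ∧
      (∀ t ∈ Set.Ico (x k) d, V t < 0) ∧ ∀ t ∈ Set.Ioc d (e (k + 1)), 0 < V t := by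
    intro k
    by_cases h : k + 1 < N
    · have hk : k < N := by omega
      have hlt : x k < e (k + 1) := by
        rw [hx k hk, he (k + 1) h]
        refine (hanti (σ ⟨k, hk⟩)).lt_iff_gt.1 ?_
        have := hbefore ⟨k, hk⟩ ⟨k + 1, h⟩ (by simp [Fin.lt_def]) (T (σ ⟨k + 1, h⟩) r)
          (by rwa [hT])
        rw [hT]
        linarith
      obtain ⟨d, hd⟩ := hgap (A (k + 1)) (x k) (e (k + 1)) hlt (hfar k h)
        ((hc k hk).2.2.2 _ ⟨(hc k hk).1.2, le_rfl⟩)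
        ((hc (k + 1) h).2.2.1 _ ⟨le_rfl, (hc (k + 1) h).1.1⟩)
      exact ⟨d, fun _ => hd⟩
    · exact ⟨0, fun h' => absurd h' h⟩
  choose d hd using hgap'
  have hN1 : N - 1 < N := by omega
  obtain ⟨τ, hτ, hmono, hpos, hneg⟩ := exists_alternating (V := V) (e := e) (x := x) (c := c)
    (d := d) hN
    (fun t ht => hstart t fun i => by
      obtain ⟨j, rfl⟩ := σ.surjective i
      rw [he 0 hN] at ht
      rcases Nat.eq_zero_or_pos (j : ℕ) with h0 | h0
      · have : j = ⟨0, hN⟩ := Fin.ext h0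
        rw [this]
        exact hle _ _ _ ht
      · have h1 := hafter j ⟨0, hN⟩ h0 (T (σ ⟨0, hN⟩) r) (by rwa [hT])
        have h2 := (hanti (σ j)).antitone ht
        linarith)
    (fun t ht => hend t fun i => by
      obtain ⟨j, rfl⟩ := σ.surjective i
      rw [hx _ hN1] at ht
      rcases Nat.eq_or_lt_of_le (Nat.le_sub_one_of_lt j.2) with h0 | h0
      · have : j = ⟨N - 1, hN1⟩ := Fin.ext h0
        rw [this]
        linarith [hge _ _ _ ht]
      · have h1 := hbefore j ⟨N - 1, hN1⟩ h0 (T (σ ⟨N - 1, hN1⟩) (-r)) (by rwa [hT])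
        have h2 := (hanti (σ j)).antitone ht
        linarith)
    (fun k h => (hc k h).1) (fun k h => (hc k h).2.2.1) (fun k h => (hc k h).2.2.2)
    (fun k h => (hd k h).1) (fun k h => (hd k h).2.1) (fun k h => (hd k h).2.2)
  refine ⟨τ, σ, hmono, hpos, hneg, fun k => ?_⟩
  rw [hτ]
  have hck := hc k k.2
  have habsk := hcoreAbs k k.2 (c k) (Set.Ioo_subset_Icc_self hck.1)
  refine ⟨fun j hj => hbefore j k hj _ habsk, fun j hj => hafter j k hj _ habsk, ?_⟩
  have := hck.2.1
  rw [hA] at this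
  exact this

end Ordering

end

end KdVSoliton

/-! ### Particles below the height `π/(4 ∑ β_i)` -/

namespace KdVSoliton

noncomputable section

variable {N : ℕ}

theorem strictAnti_and_surjective_of_deriv_le {f f' : ℝ → ℝ} {m : ℝ} (hm : 0 < m)
    (hf : ∀ t, HasDerivAt f (f' t) t) (hf' : ∀ t, f' t ≤ -m) :
    StrictAnti f ∧ Function.Surjective f := by
  have hd : Differentiable ℝ f := fun t => (hf t).differentiableAt
  have hle : ∀ x y, x ≤ y → f y - f x ≤ -m * (y - x) :=
    image_sub_le_mul_sub_of_deriv_le hd fun t => by rw [(hf t).deriv]; exact hf' t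
  refine ⟨fun x y hxy => ?_, fun c => ?_⟩
  · have h1 := hle x y hxy.le
    have h2 := mul_pos hm (sub_pos.2 hxy)
    linarith
  · have hq := div_nonneg (abs_nonneg (f 0 - c)) hm.le
    have hmq : m * (|f 0 - c| / m) = |f 0 - c| := mul_div_cancel₀ _ hm.ne'
    refine mem_range_of_exists_le_of_exists_ge hd.continuous ⟨|f 0 - c| / m, ?_⟩
      ⟨-(|f 0 - c| / m), ?_⟩
    · have h1 := hle _ _ hq
      have h2 := le_abs_self (f 0 - c)
      linarith
    · have h1 := hle _ _ (neg_nonpos.2 hq)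
      have h2 := neg_abs_le (f 0 - c)
      linarith

theorem alphaProd_pos {a : Fin N → ℝ} (ha : ∀ i, 0 < a i) (hinj : Function.Injective a)
    {S : Finset (Fin N)} {i : Fin N} (hi : i ∉ S) : 0 < ∏ j ∈ S, alpha (a j) (a i) :=
  Finset.prod_pos fun j hj =>
    alpha_pos (ha j) (ha i) fun h => hi (by rw [← hinj h]; exact hj)

/-- So the normalized weight is one exactly at phase `½ ln ∏ α`, the crest of soliton `i` as shifted
by the solitons in `S`. -/
theorem nweight_insert {g h₀ : ℝ} {a : Fin N → ℝ} (ha : ∀ i, 0 < a i)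
    (hinj : Function.Injective a) (s : Fin N → ℝ) {S : Finset (Fin N)} {i : Fin N} (hi : i ∉ S)
    (x t : ℝ) : nweight g h₀ a s S x t (insert i S)
      = Real.exp (Real.log (∏ j ∈ S, alpha (a j) (a i)) - 2 * phase g h₀ a s i x t) := by
  have hS := alphaSet_pos ha hinj S
  rw [nweight_eq, symmDiff_insert_self hi, Finset.sum_singleton, signedPhase, if_neg hi,
    alphaSet_insert _ _ _ hi, mul_div_cancel_left₀ _ hS.ne', sub_eq_add_neg, Real.exp_add,
    Real.exp_log (alphaProd_pos ha hinj hi), neg_mul]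

/-- Particles that avoid interactions and do not rise above the height `π / (4 ∑ β)` move up and
down with the solitons. -/
theorem exists_movesWithSolitons {g h₀ : ℝ} {a : Fin N → ℝ} (H : Admissible g h₀ a) {δ : ℝ}
    (hδ : 0 < δ) : ∃ R : ℝ, 0 < R ∧ ∀ (s : Fin N → ℝ) (X Y : ℝ → ℝ),
      IsTrajectory g h₀ a s X Y →
      (∀ t, 0 < Y t ∧ Y t * ∑ i, beta h₀ (a i) ≤ Real.pi / 4) →
      AvoidsInteractions g h₀ a s R X → MovesWithSolitons g h₀ a s R δ X Y := by
  obtain ⟨b, hb0, hb⟩ := exists_beta_lower H.one_le H.h_pos H.a_pos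
  obtain ⟨r₀, hr₀, hgap⟩ := exists_gap_radius H
  obtain ⟨ρ₀, hρ₀, hcore⟩ := exists_core_radius H
  -- Constants in order of dependence: `ρ < bδ`, since dividing a phase error by `β_i ≥ b` gives a
  -- distance; then `r`, so large that `|phase| ≤ r` contains every shifted crest with its margin
  -- `ρ`; then `R`, depending on both.
  obtain ⟨ρ, hρ0, hρ1, hρδ⟩ : ∃ ρ : ℝ, 0 < ρ ∧ ρ ≤ ρ₀ ∧ ρ < b * δ :=
    ⟨min ρ₀ (b * δ / 2), by positivity, min_le_left _ _,
      (min_le_right _ _).trans_lt (by linarith [mul_pos hb0 hδ])⟩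
  obtain ⟨r, hrr₀, hrG⟩ : ∃ r : ℝ, r₀ ≤ r ∧ ∀ S i,
      |Real.log (∏ j ∈ S, alpha (a j) (a i)) / 2| + ρ < r := by
    obtain ⟨G, hG⟩ : ∃ G, ∀ p : Finset (Fin N) × Fin N,
        |Real.log (∏ j ∈ p.1, alpha (a j) (a p.2)) / 2| ≤ G := by
      obtain ⟨G, hG⟩ := (Set.finite_range fun p : Finset (Fin N) × Fin N =>
        |Real.log (∏ j ∈ p.1, alpha (a j) (a p.2)) / 2|).bddAbove
      exact ⟨G, fun p => hG ⟨p, rfl⟩⟩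
    refine ⟨max r₀ (G + ρ + 1), le_max_left _ _, fun S i => ?_⟩
    have h1 := hG (S, i)
    have h2 := le_max_right r₀ (G + ρ + 1)
    simp only at h1
    linarith
  have hr : 0 < r := hr₀.trans_le hrr₀
  obtain ⟨R₀, hR₀, hcore⟩ := hcore ρ hρ0 hρ1 r
  refine ⟨max R₀ r, by positivity, fun s X Y htr hY havoid => ?_⟩
  have hm := speedGap_pos H
  have hYL : ∀ t, (∑ i, beta h₀ (a i)) * Y t ≤ Real.pi / 4 := fun t => by
    rw [mul_comm]; exact (hY t).2
  have hYabs : ∀ t, (∑ i, beta h₀ (a i)) * |Y t| ≤ Real.pi / 4 := fun t => by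
    rw [abs_of_pos (hY t).1]; exact hYL t
  have hP : ∀ k, StrictAnti (fun t => phase g h₀ a s k (X t) t) ∧
      Function.Surjective fun t => phase g h₀ a s k (X t) t := fun k =>
    strictAnti_and_surjective_of_deriv_le (mul_pos hb0 hm)
      (fun t => hasDerivAt_phase_path (htr t).1 k) fun t =>
        neg_le_neg (mul_le_mul (hb k) (speed_sub_velU_ge H s (X t) t (hY t).1 (hYL t) k) hm.le
          (hb0.le.trans (hb k)))
  have hψ : ∀ S t, HasDerivAt (fun t => psi g h₀ a s S (X t) (Y t) t)
      (psiDeriv g h₀ a s S (X t) (Y t) t) t := fun S t =>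
    hasDerivAt_psi H.a_pos H.inj htr S (hY t).1.ne'
  have hpos := fun S t => velV_pos_iff H s S (X t) t (hY t).1 (hYabs t)
  have hneg := fun S t => velV_neg_iff H s S (X t) t (hY t).1 (hYabs t)
  refine (exists_passing_times H.one_le
    (P := fun k t => phase g h₀ a s k (X t) t) (V := fun t => velV g h₀ a s (X t) (Y t) t)
    (R := max R₀ r) (r := r) (Q := fun S i t => i ∉ S →
      |phase g h₀ a s i (X t) t - Real.log (∏ j ∈ S, alpha (a j) (a i)) / 2| ≤ ρ)
    (fun k => (hP k).1) (fun k => (hP k).2) hr (le_max_right _ _) havoid ?_ ?_ ?_ ?_).elim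
    fun τ ⟨σ, hmono, h1, h2, h3⟩ => ?_
  · intro S i t₁ t₂ hi ht₁ ht₂ hfar
    have hstrict := (hP i).1
    obtain ⟨G, hG⟩ : ∃ G, G = Real.log (∏ j ∈ S, alpha (a j) (a i)) := ⟨_, rfl⟩
    have hrG := hrG S i
    have hn := fun x t => nweight_insert (g := g) (h₀ := h₀) H.a_pos H.inj s hi x t
    rw [← hG] at hrG
    simp only [← hG] at hn ⊢
    have hG1 := le_abs_self (G / 2)
    have hG2 := neg_abs_le (G / 2)
    -- Up to `ta` the weight `q` is at most `e^{-2ρ}` and `psi` is positive; from `tb` on it is at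
    -- least `e^{2ρ}` and `psi` is negative; in between `psi` decreases strictly and has one zero.
    obtain ⟨ta, hta⟩ := (hP i).2 (G / 2 + ρ)
    obtain ⟨tb, htb⟩ := (hP i).2 (G / 2 - ρ)
    simp only at ht₁ ht₂ hta htb
    have h1a : t₁ < ta := hstrict.lt_iff_gt.1 (by rw [ht₁, hta]; linarith)
    have hab : ta < tb := hstrict.lt_iff_gt.1 (by rw [htb, hta]; linarith)
    have hb2 : tb < t₂ := hstrict.lt_iff_gt.1 (by rw [htb, ht₂]; linarith)
    have hall : ∀ t ∈ Set.Icc t₁ t₂, _ := fun t ht =>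
      hcore (max R₀ r) (le_max_left _ _) s S i (X t) (Y t) t hi (hY t).1 (hYL t)
        (abs_le.2 ⟨by rw [← ht₂]; exact hstrict.antitone ht.2,
          by rw [← ht₁]; exact hstrict.antitone ht.1⟩) (hfar t ht)
    simp only [hn, Real.exp_le_exp] at hall
    have hposa : ∀ t ∈ Set.Icc t₁ ta, 0 < psi g h₀ a s S (X t) (Y t) t := fun t ht => by
      have := hstrict.antitone ht.2
      simp only [hta] at this
      exact (hall t ⟨ht.1, by linarith [ht.2]⟩).1 (by linarith)
    have hnegb : ∀ t ∈ Set.Icc tb t₂, psi g h₀ a s S (X t) (Y t) t < 0 := fun t ht => by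
      have := hstrict.antitone ht.1
      simp only [htb] at this
      exact (hall t ⟨by linarith [ht.1], ht.2⟩).2.1 (by linarith)
    obtain ⟨c, hc, hc1, hc2⟩ := exists_zero_of_deriv_pos hab
      (fun t _ => (hψ S t).fun_neg)
      (fun t ht => by
        have h1 := hstrict.antitone ht.1
        have h2 := hstrict.antitone ht.2
        simp only [hta, htb] at h1 h2
        exact neg_pos.2 ((hall t ⟨by linarith [ht.1], by linarith [ht.2]⟩).2.2 (by linarith)
          (by linarith)))
      (neg_lt_zero.2 (hposa ta ⟨h1a.le, le_rfl⟩)) (neg_pos.2 (hnegb tb ⟨le_rfl, hb2.le⟩))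
    refine ⟨c, ⟨h1a.trans hc.1, hc.2.trans hb2⟩, fun _ => ?_, fun t ht => (hpos S t).2 ?_,
      fun t ht => (hneg S t).2 ?_⟩
    · have h1 := hstrict.antitone hc.1.le
      have h2 := hstrict.antitone hc.2.le
      simp only [hta, htb] at h1 h2
      exact abs_le.2 ⟨by linarith, by linarith⟩
    · by_cases h : t ≤ ta
      · exact hposa t ⟨ht.1, h⟩
      · exact neg_lt_zero.1 (hc1 t ⟨(not_le.1 h).le, ht.2⟩)
    · by_cases h : t ≤ tb
      · exact neg_pos.1 (hc2 t ⟨ht.1, h⟩)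
      · exact hnegb t ⟨(not_le.1 h).le, ht.2⟩
  · intro S t₁ t₂ h12 hfar hV1 hV2
    obtain ⟨d, hd, hd1, hd2⟩ := exists_zero_of_deriv_pos h12 (fun t _ => hψ S t)
      (fun t ht => (hgap r hrr₀ s S (X t) (Y t) t (hY t).1 (hYL t) (hfar t ht)).1)
      ((hneg S t₁).1 hV1) ((hpos S t₂).1 hV2)
    exact ⟨d, hd, fun t ht => (hneg S t).2 (hd1 t ht), fun t ht => (hpos S t).2 (hd2 t ht)⟩
  · intro t ht
    exact (hpos ∅ t).2 ((hgap r hrr₀ s ∅ (X t) (Y t) t (hY t).1 (hYL t)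
      (fun k => by rw [signedPhase, if_neg (Finset.notMem_empty k)]; exact ht k)).2.1 rfl)
  · intro t ht
    exact (hneg Finset.univ t).2 ((hgap r hrr₀ s Finset.univ (X t) (Y t) t (hY t).1 (hYL t)
      (fun k => by rw [signedPhase, if_pos (Finset.mem_univ k)]; exact ht k)).2.2 rfl)
  · refine ⟨τ, σ, ⟨hmono, h1, h2⟩, fun k => ⟨(h3 k).1, (h3 k).2.1, ?_⟩⟩
    have h4 := (h3 k).2.2 (by simp)
    rw [Finset.prod_image σ.injective.injOn] at h4
    have hβ := beta_pos H.h_pos (H.a_pos (σ k))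
    generalize τ (2 * (k : ℕ) + 1) = T at h4 ⊢
    generalize Real.log (∏ j ∈ Finset.univ.filter (fun j => j < k), alpha (a (σ j)) (a (σ k))) = G
      at h4 ⊢
    have h5 : X T - (s (σ k) + speed g h₀ (a (σ k)) * T + 1 / (2 * beta h₀ (a (σ k))) * G)
        = (phase g h₀ a s (σ k) (X T) T - G / 2) / beta h₀ (a (σ k)) := by
      unfold phase
      field_simp
      ring
    rw [h5, abs_div, abs_of_pos hβ, div_lt_iff₀ hβ]
    have := mul_le_mul_of_nonneg_left (hb (σ k)) hδ.le
    linarith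

end

end KdVSoliton

/-! ### Small amplitudes: particles stay below `2h₀` -/

namespace KdVSoliton

noncomputable section

open Matrix

variable {N : ℕ}

theorem hasDerivAt_solVec_path {g h₀ : ℝ} {a s : Fin N → ℝ} (h : 0 < h₀) (ha : ∀ i, 0 < a i)
    {X : ℝ → ℝ} {u t : ℝ} (hX : HasDerivAt X u t) (i : Fin N) :
    HasDerivAt (fun t => solVec g h₀ a s (X t) t i)
      (betaVec h₀ a i * (√(g * h₀) - u + √(g * h₀) * (2 * h₀ ^ 2 / 3) * betaVec h₀ a i ^ 2)
        * solVec g h₀ a s (X t) t i) t := by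
  have h1 := (hasDerivAt_phase_path (g := g) (h₀ := h₀) (a := a) (s := s)
    hX i).fun_neg.exp.const_mul (√(2 * beta h₀ (a i)))
  refine h1.congr_deriv ?_
  have h2 : speed g h₀ (a i) = √(g * h₀) + √(g * h₀) * (2 * h₀ ^ 2 / 3) * beta h₀ (a i) ^ 2 := by
    rw [beta_sq h (ha i).le, speed]
    field_simp
    ring
  simp only [solVec, betaVec, h2]
  ring

/-- Bounds on the amplitudes that depend on `N` only. -/
theorem small_of_div_le {h₀ : ℝ} {a : Fin N → ℝ} (hN : 1 ≤ N) (h : 0 < h₀) (ha : ∀ i, 0 < a i)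
    (hs : ∀ i, a i / h₀ ≤ 1 / (1000 * (N : ℝ) ^ 3)) :
    (N : ℝ) * (h₀ * ∑ i, beta h₀ (a i)) ^ 2 ≤ 3 / 4000 ∧ ⨆ i, a i ≤ h₀ / 1000 := by
  have hN' : (1 : ℝ) ≤ N := by exact_mod_cast hN
  have hne : Nonempty (Fin N) := ⟨⟨0, hN⟩⟩
  constructor
  · have h1 : (∑ i, beta h₀ (a i)) ^ 2 ≤ N * ∑ i, beta h₀ (a i) ^ 2 := by
      have := sq_sum_le_card_mul_sum_sq (s := Finset.univ) (f := fun i => beta h₀ (a i))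
      simpa using this
    -- `h₀²β_i² = (3/4) a_i/h₀`. One factor `N` of the threshold is consumed by the Cauchy–Schwarz
    -- inequality, one by the number of solitons, and one by the factor `N` in front, which the
    -- bound `N` on the trace requires.
    have h2 : ∀ i, h₀ ^ 2 * beta h₀ (a i) ^ 2 ≤ 3 / (4000 * (N : ℝ) ^ 3) := fun i => by
      rw [beta_sq h (ha i).le]
      calc h₀ ^ 2 * (3 * a i / (4 * h₀ ^ 3)) = 3 / 4 * (a i / h₀) := by field_simp
        _ ≤ 3 / 4 * (1 / (1000 * (N : ℝ) ^ 3)) := by have := hs i; gcongr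
        _ = _ := by field_simp; norm_num
    have h3 : ∑ i, h₀ ^ 2 * beta h₀ (a i) ^ 2 ≤ N * (3 / (4000 * (N : ℝ) ^ 3)) := by
      refine (Finset.sum_le_sum fun i _ => h2 i).trans_eq ?_
      simp
    rw [← Finset.mul_sum] at h3
    calc (N : ℝ) * (h₀ * ∑ i, beta h₀ (a i)) ^ 2 = N * h₀ ^ 2 * (∑ i, beta h₀ (a i)) ^ 2 := by ring
      _ ≤ N * h₀ ^ 2 * (N * ∑ i, beta h₀ (a i) ^ 2) := by gcongr
      _ = N * N * (h₀ ^ 2 * ∑ i, beta h₀ (a i) ^ 2) := by ring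
      _ ≤ N * N * (N * (3 / (4000 * (N : ℝ) ^ 3))) := by gcongr
      _ = _ := by field_simp
  · refine ciSup_le fun i => ?_
    have h1 := hs i
    rw [div_le_iff₀ h] at h1
    have h2 : 1 / (1000 * (N : ℝ) ^ 3) ≤ 1 / 1000 := by
      refine one_div_le_one_div_of_le (by norm_num) ?_
      have := one_le_pow₀ hN' (n := 3)
      linarith
    have := mul_le_mul_of_nonneg_right h2 h.le
    linarith

theorem mul_sum_beta_le {h₀ L n : ℝ} (hn : 1 ≤ n) (h : n * (h₀ * L) ^ 2 ≤ 3 / 4000) :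
    h₀ * L ≤ 1 / 30 := by
  by_contra hcon
  have h1 : 1 / 900 < (h₀ * L) ^ 2 := by nlinarith
  nlinarith

theorem smallAmplitude_of_div_le {h₀ : ℝ} {a : Fin N → ℝ} (hN : 1 ≤ N) (h : 0 < h₀)
    (ha : ∀ i, 0 < a i) (hs : ∀ i, a i / h₀ ≤ 1 / (1000 * (N : ℝ) ^ 3)) : SmallAmplitude h₀ a := by
  obtain ⟨h1, h2⟩ := small_of_div_le hN h ha hs
  have h3 := mul_sum_beta_le (by exact_mod_cast hN) h1
  have hL := sum_beta_pos hN h ha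
  have h4 := mul_le_mul_of_nonneg_right h2 hL.le
  rw [SmallAmplitude]
  have := Real.pi_gt_three
  linarith

/-- Along particle paths the trace of the resolvent decreases and controls the relative vertical
velocity. -/
theorem exists_deriv_trace_le {g h₀ : ℝ} {a : Fin N → ℝ} (H : Admissible g h₀ a)
    (hs : (N : ℝ) * (h₀ * ∑ i, beta h₀ (a i)) ^ 2 ≤ 3 / 4000) (hA : ⨆ i, a i ≤ h₀ / 1000)
    {s : Fin N → ℝ} {X Y : ℝ → ℝ} (htr : IsTrajectory g h₀ a s X Y) {t : ℝ} (hY0 : 0 < Y t) :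
    ∃ D, HasDerivAt (fun t => (resolvent (betaVec h₀ a) (solVec g h₀ a s (X t) t)).trace) D t ∧
      ((∑ i, beta h₀ (a i)) * Y t ≤ Real.pi / 4 →
        velV g h₀ a s (X t) (Y t) t / Y t + 1 / (2 * N) * D ≤ 0) := by
  have hN' : (1 : ℝ) ≤ N := by exact_mod_cast H.one_le
  have hdet := fun t => (det_soliton_pos (g := g) H.h_pos H.a_pos H.inj s (X t) t).ne'
  refine ⟨_, hasDerivAt_trace_resolvent (betaVec_pos H.h_pos H.a_pos)
    (hasDerivAt_solVec_path H.h_pos H.a_pos (htr t).1) hdet, fun hY => ?_⟩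
  have hL := sum_beta_pos H.one_le H.h_pos H.a_pos
  have hbL : ∀ i, betaVec h₀ a i ≤ ∑ i, beta h₀ (a i) := fun i =>
    Finset.single_le_sum (f := fun i => beta h₀ (a i)) (fun j _ => Real.sqrt_nonneg _)
      (Finset.mem_univ i)
  have hslope := slope_bounds (g := g) (h₀ := h₀) H.a_pos H.inj s (X t) t
  rw [slope_eq H.h_pos H.a_pos H.inj] at hslope
  have herr := abs_trace_error_le (betaVec_pos H.h_pos H.a_pos) hbL hL (hdet t)
    (resolvent_spec (hdet t) _) (resolvent_spec (hdet t) _) (resolvent_spec (hdet t) _)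
    (w := solW g h₀ a s (X t) t) (by rw [abs_of_nonneg hslope.1]; exact hslope.2)
  have hV := (le_abs_self _).trans (abs_velV_div_le H s (X t) t hY0 hY)
  have hcurv : curv g h₀ a s (X t) t ≤ 2 * (∑ i, beta h₀ (a i)) *
      (solW g h₀ a s (X t) t ⬝ᵥ solW g h₀ a s (X t) t) := by
    rw [curv_eq H.h_pos H.a_pos H.inj, mul_assoc]
    refine mul_le_mul_of_nonneg_left ?_ zero_le_two
    rw [dotProduct, dotProduct, Finset.mul_sum]
    refine Finset.sum_le_sum fun i _ => ?_
    have := mul_le_mul_of_nonneg_right (hbL i) (mul_self_nonneg (solW g h₀ a s (X t) t i))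
    rw [Pi.mul_apply]
    linarith
  have hu := velU_le H.one_le H.g_pos H.h_pos H.a_pos H.inj s (X t) t
    (by rwa [abs_of_pos hY0])
  have hw0 := dotProduct_self_nonneg (solW g h₀ a s (X t) t)
  have hq : 0 < √(g / h₀) := Real.sqrt_pos.2 (div_pos H.g_pos H.h_pos)
  rw [sqrt_mul_eq H.g_pos H.h_pos]
  rw [velFactor] at hV
  unfold solW at herr hcurv hw0
  have hh := H.h_pos
  generalize resolvent (betaVec h₀ a) (solVec g h₀ a s (X t) t) *ᵥ solVec g h₀ a s (X t) t
    = w at *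
  generalize w ⬝ᵥ w = W at *
  generalize 2 * (w ⬝ᵥ _) - _ = E at *
  generalize velV g h₀ a s (X t) (Y t) t / Y t = v at *
  generalize velU g h₀ a s (X t) (Y t) t = u at *
  generalize curv g h₀ a s (X t) t = K at *
  generalize ∑ i, beta h₀ (a i) = L at *
  generalize ⨆ i, a i = A at *
  generalize √(g / h₀) = q at *
  generalize (N : ℝ) = n at *
  clear hdet hslope htr hbL
  have hE := (abs_le.1 herr).1
  have hq0 : 0 < q * h₀ := by positivity
  have hX2 : (h₀ * L) ^ 2 ≤ 3 / 4000 := by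
    refine le_trans ?_ hs
    exact le_mul_of_one_le_left (sq_nonneg _) hN'
  have hu' : u ≤ q * h₀ / 4 := by
    have := mul_le_mul_of_nonneg_left hA hq.le
    linarith
  -- Dissipation: `-D` is at least `(q h₀/4) W`, `W = w·w`. The drift gives at least three quarters
  -- of `q h₀ W`, and the error `69 L² W` of the dispersive part is absorbed by smallness.
  have h1 : q * h₀ / 4 * W ≤ (q * h₀ - u) * W + q * h₀ * (2 * h₀ ^ 2 / 3) * E := by
    have h2 : q * h₀ * (2 * h₀ ^ 2 / 3) * (-(69 * L ^ 2 * W)) ≤ q * h₀ * (2 * h₀ ^ 2 / 3) * E := by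
      gcongr
    have h3 : q * h₀ * (2 * h₀ ^ 2 / 3) * (-(69 * L ^ 2 * W))
        = -(46 * (q * h₀ * W) * (h₀ * L) ^ 2) := by ring
    have h4 := mul_le_mul_of_nonneg_left hX2 (mul_nonneg hq0.le hw0)
    have h5 := mul_le_mul_of_nonneg_right hu' hw0
    have h6 := mul_nonneg hq0.le hw0
    linarith
  -- The relative vertical velocity is bounded by the same `W`, with a small coefficient; weight
  -- `1/(2N)` on the trace therefore suffices.
  have h2 : v ≤ 128 / 3 * (h₀ * L) ^ 2 * (q * h₀ * W) := by
    refine hV.trans ?_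
    calc q * (4 * h₀ ^ 3 / 3) * (16 * L * K)
        ≤ q * (4 * h₀ ^ 3 / 3) * (16 * L * (2 * L * W)) := by gcongr
      _ = _ := by ring
  have hn0 : 0 < n := by linarith
  have h3 : 128 / 3 * (h₀ * L) ^ 2 ≤ 1 / (8 * n) := by
    rw [le_div_iff₀ (by positivity)]
    linarith
  have h4 := mul_le_mul_of_nonneg_right h3 (mul_nonneg hq0.le hw0)
  have h5 := mul_le_mul_of_nonneg_left h1 (show 0 ≤ 1 / (2 * n) by positivity)
  have h6 : 1 / (2 * n) * (q * h₀ / 4 * W) = 1 / (8 * n) * (q * h₀ * W) := by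
    field_simp
    ring
  linarith

/-- A path that reached the bed would always have been on it, against its limit in the past. -/
theorem trajectory_pos {g h₀ : ℝ} {a : Fin N → ℝ} (H : Admissible g h₀ a) {s : Fin N → ℝ}
    {X Y : ℝ → ℝ} (htr : IsTrajectory g h₀ a s X Y) {y₀ : ℝ} (hy₀ : 0 < y₀)
    (hlim : Filter.Tendsto Y Filter.atBot (nhds y₀)) (t : ℝ) : 0 < Y t := by
  have hcont : Continuous Y := continuous_iff_continuousAt.2 fun t => (htr t).2.continuousAt
  by_contra hcon
  obtain ⟨t₁, ht₁⟩ := (hlim.eventually (lt_mem_nhds hy₀)).exists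
  obtain ⟨z, hz⟩ := mem_range_of_exists_le_of_exists_ge hcont ⟨t, not_lt.1 hcon⟩ ⟨t₁, ht₁.le⟩
  exact ht₁.ne' (trajectory_bed H.one_le H.g_pos H.h_pos H.a_pos H.inj htr hz t₁)

/-- Particles that start in the fluid do not rise above twice the depth. -/
theorem trajectory_lt {g h₀ : ℝ} {a : Fin N → ℝ} (H : Admissible g h₀ a)
    (hs : (N : ℝ) * (h₀ * ∑ i, beta h₀ (a i)) ^ 2 ≤ 3 / 4000) (hA : ⨆ i, a i ≤ h₀ / 1000)
    {s : Fin N → ℝ} {X Y : ℝ → ℝ} (htr : IsTrajectory g h₀ a s X Y) {y₀ : ℝ} (hy₀ : 0 < y₀)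
    (hy₀' : y₀ ≤ h₀) (hlim : Filter.Tendsto Y Filter.atBot (nhds y₀)) (t : ℝ) :
    Y t < 2 * h₀ := by
  have hh := H.h_pos
  have hN' : (1 : ℝ) ≤ N := by exact_mod_cast H.one_le
  have hYpos := trajectory_pos H htr hy₀ hlim
  have hcont : Continuous Y := continuous_iff_continuousAt.2 fun t => (htr t).2.continuousAt
  have hLh := mul_sum_beta_le hN' hs
  by_contra hcon
  obtain ⟨t₀, ht₀, ht₀t⟩ := ((hlim.eventually (gt_mem_nhds
    (show y₀ < 11 / 10 * h₀ by linarith))).and (Filter.eventually_le_atBot t)).exists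
  -- First time at height `2h₀`, after a time `t₀` of height below `1.1 h₀`. In between the path is
  -- in the strip, as `2h₀ ∑ β_i ≤ 1/15`, so the monotonicity is available.
  obtain ⟨t₁, ⟨ht₁, hYt₁⟩, hleast⟩ := (isCompact_Icc.inter_right
    (isClosed_le continuous_const hcont) :
      IsCompact (Set.Icc t₀ t ∩ {t | 2 * h₀ ≤ Y t})).exists_isLeast
    ⟨t, ⟨ht₀t, le_rfl⟩, not_lt.1 hcon⟩
  have hYlt : ∀ z ∈ Set.Ico t₀ t₁, Y z < 2 * h₀ := fun z hz => by
    by_contra h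
    exact absurd (hleast ⟨⟨hz.1, hz.2.le.trans ht₁.2⟩, not_lt.1 h⟩) (not_le.2 hz.2)
  choose D hD hDle using fun z => exists_deriv_trace_le H hs hA htr (hYpos z)
  have hbnd := fun z => trace_resolvent_bounds (betaVec_pos H.h_pos H.a_pos)
    (det_soliton_pos (g := g) H.h_pos H.a_pos H.inj s (X z) z).ne'
  generalize hτ : (fun t => (resolvent (betaVec h₀ a) (solVec g h₀ a s (X t) t)).trace) = τ at hD
  have hbnd' : ∀ z, 0 ≤ τ z ∧ τ z ≤ N := fun z => by
    rw [← hτ]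
    simpa using hbnd z
  have hΛ : ∀ z, HasDerivAt (fun t => Real.log (Y t) + 1 / (2 * N) * τ t)
      (velV g h₀ a s (X z) (Y z) z / Y z + 1 / (2 * N) * D z) z := fun z =>
    ((htr z).2.log (hYpos z).ne').fun_add ((hD z).const_mul _)
  have hanti : AntitoneOn (fun t => Real.log (Y t) + 1 / (2 * N) * τ t) (Set.Icc t₀ t₁) := by
    refine antitoneOn_of_deriv_nonpos (convex_Icc _ _)
      (fun z _ => (hΛ z).continuousAt.continuousWithinAt)
      (fun z _ => (hΛ z).differentiableAt.differentiableWithinAt) fun z hz => ?_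
    rw [interior_Icc] at hz
    rw [(hΛ z).deriv]
    refine hDle z ?_
    have h1 := hYlt z ⟨hz.1.le, hz.2⟩
    have hL := sum_beta_pos H.one_le H.h_pos H.a_pos
    have h2 := mul_le_mul_of_nonneg_left h1.le hL.le
    have := Real.pi_gt_three
    linarith
  have hle := hanti ⟨le_rfl, ht₁.1⟩ ⟨ht₁.1, le_rfl⟩ ht₁.1
  simp only at hle
  have h1 : Real.log (2 * h₀) ≤ Real.log (Y t₁) := Real.log_le_log (by positivity) hYt₁
  have h2 : Real.log (Y t₀) ≤ Real.log (11 / 10 * h₀) := Real.log_le_log (hYpos t₀) ht₀.le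
  rw [Real.log_mul (by norm_num) hh.ne'] at h1 h2
  -- The trace term can release at most `1/2`, so `ln 2 ≤ ln 1.1 + 1/2 ≤ 0.6`, which is false.
  have h3 := Real.log_two_gt_d9
  have h4 : Real.log (11 / 10) ≤ 11 / 10 - 1 := Real.log_le_sub_one_of_pos (by norm_num)
  have h5 : 1 / (2 * (N : ℝ)) * τ t₀ ≤ 1 / 2 := by
    rw [one_div_mul_eq_div, div_le_iff₀ (by positivity)]
    linarith [(hbnd' t₀).2]
  have h6 : 0 ≤ 1 / (2 * (N : ℝ)) * τ t₁ := mul_nonneg (by positivity) (hbnd' t₁).1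
  linarith

end

end KdVSoliton

/-! ### The main theorem -/

open KdVSoliton in
theorem theorem1p1 (N : ℕ) (hN : 1 ≤ N) :
    ∃ ε₀ : ℝ, 0 < ε₀ ∧
    ∀ (g h₀ : ℝ) (a : Fin N → ℝ), 0 < g → 0 < h₀ → (∀ i, 0 < a i) → Function.Injective a →
      -- amplitudes below a threshold that depends only on `N` satisfy the smallness condition
      ((∀ i, a i / h₀ ≤ ε₀) → SmallAmplitude h₀ a) ∧
      (SmallAmplitude h₀ a →
        -- (a) on the bed the velocity is horizontal and positive, and particles stay on the bed
        (∀ s : Fin N → ℝ,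
          (∀ x t, velV g h₀ a s x 0 t = 0 ∧ 0 < velU g h₀ a s x 0 t) ∧
          ∀ X Y : ℝ → ℝ, IsTrajectory g h₀ a s X Y → (∃ t₀, Y t₀ = 0) →
            ∀ t, Y t = 0 ∧ 0 < deriv X t) ∧
        -- (b) positive horizontal velocity below the surface, which lies below `h₀ + max a_i`
        (∀ (s : Fin N → ℝ) (x t : ℝ), eta g h₀ a s x t ≤ (⨆ i, a i) ∧
          ∀ y, 0 ≤ y → y ≤ h₀ + eta g h₀ a s x t → 0 < velU g h₀ a s x y t) ∧
        -- (c), (d) for particles that stay above the bed and below the height `π / (4 ∑ β_i)`,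
        -- which is at least `h₀ + max a_i`, in particular for those that stay in the fluid
        (∀ δ : ℝ, 0 < δ → ∃ R : ℝ, 0 < R ∧ ∀ (s : Fin N → ℝ) (X Y : ℝ → ℝ),
          IsTrajectory g h₀ a s X Y →
          (∀ t, 0 < Y t ∧ Y t * ∑ i, beta h₀ (a i) ≤ Real.pi / 4) →
          AvoidsInteractions g h₀ a s R X →
          MovesWithSolitons g h₀ a s R δ X Y)) ∧
      -- (c), (d) for all particles that start in the fluid above the bed, for small amplitudes
      ((∀ i, a i / h₀ ≤ ε₀) →
        ∀ δ : ℝ, 0 < δ → ∃ R : ℝ, 0 < R ∧ ∀ (s : Fin N → ℝ) (X Y : ℝ → ℝ) (x₀ y₀ : ℝ),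
          IsTrajectory g h₀ a s X Y →
          Filter.Tendsto X Filter.atBot (nhds x₀) → Filter.Tendsto Y Filter.atBot (nhds y₀) →
          0 < y₀ → y₀ ≤ h₀ →
          AvoidsInteractions g h₀ a s R X →
          MovesWithSolitons g h₀ a s R δ X Y) := by
  have hN' : (0 : ℝ) < N := by exact_mod_cast hN
  refine ⟨1 / (1000 * (N : ℝ) ^ 3), by positivity, fun g h₀ a hg h ha hinj =>
    ⟨smallAmplitude_of_div_le hN h ha, fun hs => ?_, fun hsmall δ hδ => ?_⟩⟩
  · have hL := sum_beta_pos hN h ha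
    have hbed : ∀ (s : Fin N → ℝ) x t, 0 < velU g h₀ a s x 0 t := fun s x t =>
      velU_pos hN hg h ha hinj s x t (by rw [abs_zero, mul_zero]; linarith [Real.pi_pos])
    refine ⟨fun s => ⟨fun x t => ⟨velV_bed hg h ha hinj s x t, hbed s x t⟩,
      fun X Y htr ⟨t₀, ht₀⟩ t => ?_⟩, fun s x t => ⟨eta_le hN h ha hinj s x t, fun y hy0 hy => ?_⟩,
      fun δ hδ => exists_movesWithSolitons ⟨hN, hg, h, ha, hinj, hs⟩ hδ⟩
    · have hY := trajectory_bed hN hg h ha hinj htr ht₀ t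
      refine ⟨hY, ?_⟩
      rw [(htr t).1.deriv, hY]
      exact hbed s (X t) t
    · refine velU_pos hN hg h ha hinj s x t ?_
      rw [abs_of_nonneg hy0, mul_comm]
      -- Below the surface `y ≤ h₀ + η ≤ h₀ + a`, so the smallness condition is exactly what keeps
      -- `y` in the strip.
      refine (mul_le_mul_of_nonneg_right (hy.trans ?_) hL.le).trans hs
      linarith [eta_le (g := g) hN h ha hinj s x t]
  · have H : Admissible g h₀ a := ⟨hN, hg, h, ha, hinj, smallAmplitude_of_div_le hN h ha hsmall⟩
    obtain ⟨h1, h2⟩ := small_of_div_le hN h ha hsmall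
    obtain ⟨R, hR, hmoves⟩ := exists_movesWithSolitons H hδ
    refine ⟨R, hR, fun s X Y x₀ y₀ htr _ hlimY hy₀ hy₀' havoid =>
      hmoves s X Y htr (fun t => ?_) havoid⟩
    refine ⟨trajectory_pos H htr hy₀ hlimY t, ?_⟩
    have h3 := trajectory_lt H h1 h2 htr hy₀ hy₀' hlimY t
    have h4 := mul_le_mul_of_nonneg_right h3.le (sum_beta_pos hN h ha).le
    have h5 := mul_sum_beta_le (by exact_mod_cast hN) h1
    linarith [Real.pi_gt_three]
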